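/- Let $G$ be an ergodic probability measure preserving (pmp) groupoid: a discrete standard Borel groupoid with object space $G^0$, source map $\mathbf s$, range map $\mathbf r$, and a Borel probability measure $\mathfrak h$ on $G^0$ such that $\int|A\cap \mathbf r^{-1}(e)|\,d\mathfrak h(e)=\int|A\cap \mathbf s^{-1}(e)|\,d\mathfrak h(e)$ for every Borel set $A\subset G$; ergodic means that every invariant Borel subset of $G^0$ has measure $0$ or $1$. Let $[\![G]\!]$ be the inverse semigroup of Borel sets $s\subset G$ on which $\mathbf s$ and $\mathbf r$ are injective, with trace $\tau(s)=\mathfrak h(s\cap G^0)$, and let $[\![d]\!]$ be the inverse semigroup of partial permutations of $\{1,\dots,d\}$, with $\mathrm{tr}(\sigma)=\frac1d|\{x:\sigma x=x\}|$ and $|\sigma-\rho|=\frac1d|\{x:\sigma x\neq\rho x\}|$ (where $\sigma x\ne\rho x$ also if exactly one of the two is defined). For finite $F\subset[\![G]\!]$ and $n\ge1$ let $F_\pm^n$ be the set of products of at most $n$ elements of $F\cup F^{-1}\cup\{\mathrm{Id}\}$, and $\Sigma F_\pm^n$ the set of finite sums (unions) of elements of $F_\pm^n$ with pairwise disjoint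 domains and pairwise disjoint ranges. For $\delta>0$ let $\mathrm{SA}(F,n,\delta,d)$ be the set of maps $\sigma:\Sigma F_\pm^n\to[\![d]\!]$ with $|\sigma(st)-\sigma(s)\sigma(t)|<\delta$ whenever $s,t,st\in\Sigma F_\pm^n$ and $|\mathrm{tr}(\sigma(s))-\tau(s)|<\delta$ for $s\in F_\pm^n$. For $E\subset F$ let $|\mathrm{SA}(F,n,\delta,d)|_E$ be the number of restrictions $\sigma|_E$ of its elements. The sofic dimension is $$s(G)=\sup_{E}\inf_{F\supset E}\inf_{n\ge1}\inf_{\delta>0}\limsup_{d\to\infty}\frac{\log|\mathrm{SA}(F,n,\delta,d)|_E}{d\log d}\in[-\infty,+\infty],$$ with $E\subset F$ ranging over finite subsets of $[\![G]\!]$ and $\log 0=-\infty$. The lower sofic dimension $\underline s(G)$ and, for a free ultrafilter $\omega$ on the positive integers, the $\omega$ sofic dimension $s^\omega(G)$ are obtained by replacing $\limsup_{d\to\infty}$ by $\liminf_{d\to\infty}$ and $\lim_{d\to\omega}$ respectively. $G$ is $s$-regular if $\underline s(G)=s(G)$. Let $p\neq0$ be a projection in $L^\infty(G^0)$, that is $p=1_A$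 with $A\subset G^0$ Borel, and $\mathfrak h(p)=\mathfrak h(A)>0$. Let $pGp$ be the pmp groupoid of all $g\in G$ with $\mathbf s(g),\mathbf r(g)\in A$, with the normalized restricted measure $\mathfrak h|_A/\mathfrak h(p)$. Then, in $[-\infty,+\infty]$: 1. $s(G)-1=\mathfrak h(p)\,(s(pGp)-1)$. 2. $\underline s(G)-1=\mathfrak h(p)\,(\underline s(pGp)-1)$. 3. For every free ultrafilter $\omega$, $s^\omega(G)-1=\mathfrak h(p)\,(s^{\mathfrak h(p)\omega}(pGp)-1)$, where $\mathfrak h(p)\omega$ is the image of $\omega$ under $d\mapsto\lfloor\mathfrak h(p)d\rfloor$. 4. $G$ is $s$-regular if and only if $pGp$ is $s$-regular. 5. If $G$ is $s$-regular, then also $s^\omega(G)-1=\mathfrak h(p)\,(s^{\omega}(pGp)-1)$ for every free ultrafilter $\omega$. -/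

import Mathlib

open MeasureTheory Filter Topology Set
open scoped ENNReal

universe u v

/-- A discrete standard Borel groupoid with object space `X` and arrow space `G`.
The product `mul g h _` (also written `gh`) is defined when the source of `g` is the range of `h`;
`one e` is the unit at the object `e`. -/
structure DiscreteBorelGroupoid (X : Type u) (G : Type v)
    [MeasurableSpace X] [MeasurableSpace G] where
  standardBorel_obj : StandardBorelSpace X
  standardBorel_arr : StandardBorelSpace G
  src : G → X
  rng : G → X
  one : X → G
  inv : G → G
  mul : (g h : G) → src g = rng h → G
  src_one : ∀ e, src (one e) = e
  rng_one : ∀ e, rng (one e) = e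
  src_inv : ∀ g, src (inv g) = rng g
  rng_inv : ∀ g, rng (inv g) = src g
  src_mul : ∀ g h (e : src g = rng h), src (mul g h e) = src h
  rng_mul : ∀ g h (e : src g = rng h), rng (mul g h e) = rng g
  one_mul : ∀ g, mul (one (rng g)) g (src_one (rng g)) = g
  mul_one : ∀ g, mul g (one (src g)) (rng_one (src g)).symm = g
  mul_assoc : ∀ g h k (e₁ : src g = rng h) (e₂ : src h = rng k),
    mul (mul g h e₁) k ((src_mul g h e₁).trans e₂) =
      mul g (mul h k e₂) (e₁.trans (rng_mul h k e₂).symm)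
  inv_mul : ∀ g, mul (inv g) g (src_inv g) = one (src g)
  mul_inv : ∀ g, mul g (inv g) (rng_inv g).symm = one (rng g)
  measurable_src : Measurable src
  measurable_rng : Measurable rng
  measurable_one : Measurable one
  measurable_inv : Measurable inv
  measurable_mul :
    Measurable (fun p : {p : G × G // src p.1 = rng p.2} => mul p.1.1 p.1.2 p.2)
  countable_src : ∀ e, (src ⁻¹' {e}).Countable
  countable_rng : ∀ e, (rng ⁻¹' {e}).Countable

/-- A probability measure preserving (pmp) groupoid: a discrete standard Borel groupoid with a
probability measure `μ` on its objects for which the left Haar measure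
`A ↦ ∫ |A ∩ rng⁻¹ e| dμ(e)` and the right Haar measure `A ↦ ∫ |A ∩ src⁻¹ e| dμ(e)` coincide. -/
structure PmpGroupoid (X : Type u) (G : Type v) [MeasurableSpace X] [MeasurableSpace G]
    extends DiscreteBorelGroupoid X G where
  μ : Measure X
  isProbabilityMeasure : IsProbabilityMeasure μ
  haar_eq : ∀ A : Set G, MeasurableSet A →
    ∫⁻ e, ((A ∩ rng ⁻¹' {e}).encard : ℝ≥0∞) ∂μ = ∫⁻ e, ((A ∩ src ⁻¹' {e}).encard : ℝ≥0∞) ∂μ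

namespace PmpGroupoid

variable {X : Type u} {G : Type v} [MeasurableSpace X] [MeasurableSpace G]

/-- Ergodicity: every invariant Borel set of objects is null or conull. -/
def IsErgodic (𝒢 : PmpGroupoid X G) : Prop :=
  ∀ A : Set X, MeasurableSet A → (∀ g : G, 𝒢.src g ∈ A ↔ 𝒢.rng g ∈ A) →
    𝒢.μ A = 0 ∨ 𝒢.μ A = 1

/-- The full inverse semigroup `[[G]]`: the Borel sets of arrows on which source and range are
injective. -/
def fullInverseSemigroup (𝒢 : PmpGroupoid X G) : Set (Set G) :=
  {s | MeasurableSet s ∧ InjOn 𝒢.src s ∧ InjOn 𝒢.rng s}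

/-- The product `st` of two sets of arrows. -/
def setMul (𝒢 : PmpGroupoid X G) (s t : Set G) : Set G :=
  {k | ∃ g ∈ s, ∃ h ∈ t, ∃ e : 𝒢.src g = 𝒢.rng h, k = 𝒢.mul g h e}

/-- The inverse `s⁻¹` of a set of arrows. -/
def setInv (𝒢 : PmpGroupoid X G) (s : Set G) : Set G := 𝒢.inv '' s

/-- The identity of `[[G]]`, that is the set of units. -/
def setOne (𝒢 : PmpGroupoid X G) : Set G := range 𝒢.one

/-- The trace `τ(s) = μ {e | s e = e}`. -/
noncomputable def trace (𝒢 : PmpGroupoid X G) (s : Set G) : ℝ := 𝒢.μ.real {e | 𝒢.one e ∈ s}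

/-- `F_± = F ∪ F⁻¹ ∪ {Id}`. -/
def symmetrize (𝒢 : PmpGroupoid X G) (F : Set (Set G)) : Set (Set G) :=
  F ∪ 𝒢.setInv '' F ∪ {𝒢.setOne}

/-- `F_±^n`: the products of (at most) `n` elements of `F_±`. -/
def wordBall (𝒢 : PmpGroupoid X G) (F : Set (Set G)) : ℕ → Set (Set G)
  | 0 => {𝒢.setOne}
  | n + 1 => image2 𝒢.setMul (𝒢.wordBall F n) (𝒢.symmetrize F)

/-- `Σ B`: the finite sums (unions) of elements of `B` with pairwise disjoint domains and pairwise
disjoint ranges. -/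
def orthogonalSums (𝒢 : PmpGroupoid X G) (B : Set (Set G)) : Set (Set G) :=
  {u | ∃ T : Finset (Set G), (T : Set (Set G)) ⊆ B ∧
    (T : Set (Set G)).Pairwise (fun s t => Disjoint (𝒢.src '' s) (𝒢.src '' t)) ∧
    (T : Set (Set G)).Pairwise (fun s t => Disjoint (𝒢.rng '' s) (𝒢.rng '' t)) ∧
    u = ⋃₀ (T : Set (Set G))}

end PmpGroupoid

namespace PEquiv

/-- The product `a b` (first `b`, then `a`) of partial permutations. -/
def prod {d : ℕ} (a b : Fin d ≃. Fin d) : Fin d ≃. Fin d := b.trans a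

/-- The normalized Hamming distance on the partial permutations of `d` points. -/
noncomputable def hammingDistance {d : ℕ} (a b : Fin d ≃. Fin d) : ℝ :=
  ({x : Fin d | a x ≠ b x}.ncard : ℝ) / d

/-- The normalized number of fixed points. -/
noncomputable def normalizedTrace {d : ℕ} (a : Fin d ≃. Fin d) : ℝ :=
  ({x : Fin d | a x = some x}.ncard : ℝ) / d

end PEquiv

namespace PmpGroupoid

variable {X : Type u} {G : Type v} [MeasurableSpace X] [MeasurableSpace G]

/-- `SA(F, n, δ, d)`: the maps `σ : Σ F_±^n → [[d]]` that are `δ`-multiplicative, and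
`δ`-trace-preserving on `F_±^n`.
They are written as maps on all sets of arrows; only the values on `Σ F_±^n` matter. -/
def SA (𝒢 : PmpGroupoid X G) (F : Set (Set G)) (n : ℕ) (δ : ℝ) (d : ℕ) :
    Set (Set G → (Fin d ≃. Fin d)) :=
  {σ | (∀ s ∈ 𝒢.orthogonalSums (𝒢.wordBall F n), ∀ t ∈ 𝒢.orthogonalSums (𝒢.wordBall F n),
        𝒢.setMul s t ∈ 𝒢.orthogonalSums (𝒢.wordBall F n) →
        PEquiv.hammingDistance (σ (𝒢.setMul s t)) (PEquiv.prod (σ s) (σ t)) < δ) ∧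
      ∀ s ∈ 𝒢.wordBall F n, |PEquiv.normalizedTrace (σ s) - 𝒢.trace s| < δ}

/-- `|SA(F, n, δ, d)|_E`: the number of restrictions to `E` of elements of `SA(F, n, δ, d)`. -/
noncomputable def cardSA (𝒢 : PmpGroupoid X G) (E F : Set (Set G)) (n : ℕ) (δ : ℝ) (d : ℕ) :
    ℕ∞ :=
  ((fun σ : Set G → (Fin d ≃. Fin d) => fun e : E => σ e) '' 𝒢.SA F n δ d).encard

/-- `log |SA(F, n, δ, d)|_E / (d log d)`, with `log 0 = -∞`. -/
noncomputable def logRatio (𝒢 : PmpGroupoid X G) (E F : Set (Set G)) (n : ℕ) (δ : ℝ) (d : ℕ) :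
    EReal :=
  ENNReal.log (𝒢.cardSA E F n δ d : ℝ≥0∞) / ((d * Real.log d : ℝ) : EReal)

/-- The sofic dimension of a set `K ⊆ [[G]]`, where `L` is the notion of limit as `d → ∞`
(upper limit, lower limit or limit along an ultrafilter). -/
noncomputable def dimOf (𝒢 : PmpGroupoid X G) (L : (ℕ → EReal) → EReal) (K : Set (Set G)) :
    EReal :=
  ⨆ (E : Finset (Set G)) (_ : (E : Set (Set G)) ⊆ K),
    ⨅ (F : Finset (Set G)) (_ : E ⊆ F) (_ : (F : Set (Set G)) ⊆ K),
      ⨅ (n : ℕ) (_ : 1 ≤ n), ⨅ (δ : ℝ) (_ : 0 < δ),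
        L (fun d => 𝒢.logRatio (E : Set (Set G)) (F : Set (Set G)) n δ d)

/-- The sofic dimension `s(G)`. -/
noncomputable def soficDim (𝒢 : PmpGroupoid X G) : EReal :=
  𝒢.dimOf (fun f => limsup f atTop) 𝒢.fullInverseSemigroup

/-- The lower sofic dimension. -/
noncomputable def lowerSoficDim (𝒢 : PmpGroupoid X G) : EReal :=
  𝒢.dimOf (fun f => liminf f atTop) 𝒢.fullInverseSemigroup

/-- The `ω` sofic dimension, for an ultrafilter `ω`. -/
noncomputable def ultraSoficDim (𝒢 : PmpGroupoid X G) (ω : Ultrafilter ℕ) : EReal :=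
  𝒢.dimOf (fun f => limUnder (ω : Filter ℕ) f) 𝒢.fullInverseSemigroup

/-- The limit used in `ultraSoficDim` exists. -/
theorem tendsto_limUnder_ultrafilter (ω : Ultrafilter ℕ) (f : ℕ → EReal) :
    Tendsto f (ω : Filter ℕ) (𝓝 (limUnder (ω : Filter ℕ) f)) := by
  have h := Ultrafilter.le_nhds_lim (ω.map f)
  exact h

/-- `G` is `s`-regular if its lower sofic dimension equals its sofic dimension. -/
def IsSRegular (𝒢 : PmpGroupoid X G) : Prop := 𝒢.lowerSoficDim = 𝒢.soficDim

/-- The arrows of the corner `pGp`, where `p` is the indicator function of `A`. -/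
abbrev CornerArrow (𝒢 : PmpGroupoid X G) (A : Set X) : Type v :=
  {g : G // 𝒢.src g ∈ A ∧ 𝒢.rng g ∈ A}

theorem measurableSet_cornerArrow (𝒢 : PmpGroupoid X G) {A : Set X} (hA : MeasurableSet A) :
    MeasurableSet {g : G | 𝒢.src g ∈ A ∧ 𝒢.rng g ∈ A} :=
  (𝒢.measurable_src hA).inter (𝒢.measurable_rng hA)

theorem one_mem_corner (𝒢 : PmpGroupoid X G) {A : Set X} {e : X} (he : e ∈ A) :
    𝒢.src (𝒢.one e) ∈ A ∧ 𝒢.rng (𝒢.one e) ∈ A := by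
  rw [𝒢.src_one, 𝒢.rng_one]; exact ⟨he, he⟩

theorem inv_mem_corner (𝒢 : PmpGroupoid X G) {A : Set X} {g : G}
    (hg : 𝒢.src g ∈ A ∧ 𝒢.rng g ∈ A) : 𝒢.src (𝒢.inv g) ∈ A ∧ 𝒢.rng (𝒢.inv g) ∈ A := by
  rw [𝒢.src_inv, 𝒢.rng_inv]; exact ⟨hg.2, hg.1⟩

theorem mul_mem_corner (𝒢 : PmpGroupoid X G) {A : Set X} {g h : G}
    (hg : 𝒢.src g ∈ A ∧ 𝒢.rng g ∈ A) (hh : 𝒢.src h ∈ A ∧ 𝒢.rng h ∈ A)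
    (e : 𝒢.src g = 𝒢.rng h) :
    𝒢.src (𝒢.mul g h e) ∈ A ∧ 𝒢.rng (𝒢.mul g h e) ∈ A := by
  rw [𝒢.src_mul, 𝒢.rng_mul]; exact ⟨hh.1, hg.2⟩

/-- Counting integral over the corner. -/
theorem lintegral_corner (𝒢 : PmpGroupoid X G) {A : Set X} (hA : MeasurableSet A)
    (B : Set (𝒢.CornerArrow A)) (f : G → X) (hf : ∀ g : 𝒢.CornerArrow A, f g ∈ A) :
    ∫⁻ e : A, ((B ∩ (fun g : 𝒢.CornerArrow A => (⟨f g, hf g⟩ : A)) ⁻¹' {e}).encard : ℝ≥0∞)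
        ∂(𝒢.μ.comap Subtype.val) =
      ∫⁻ e, (((Subtype.val '' B) ∩ f ⁻¹' {e}).encard : ℝ≥0∞) ∂𝒢.μ := by
  have h1 : ∀ e : A,
      ((B ∩ (fun g : 𝒢.CornerArrow A => (⟨f g, hf g⟩ : A)) ⁻¹' {e}).encard : ℝ≥0∞) =
        (fun e : X => (((Subtype.val '' B) ∩ f ⁻¹' {e}).encard : ℝ≥0∞)) e := by
    intro e
    have : (Subtype.val '' B) ∩ f ⁻¹' {(e : X)} =
        Subtype.val '' (B ∩ (fun g : 𝒢.CornerArrow A => (⟨f g, hf g⟩ : A)) ⁻¹' {e}) := by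
      ext g
      constructor
      · rintro ⟨⟨g, hg, rfl⟩, he⟩
        exact ⟨g, ⟨hg, Subtype.ext he⟩, rfl⟩
      · rintro ⟨g, ⟨hg, he⟩, rfl⟩
        exact ⟨⟨g, hg, rfl⟩, congrArg Subtype.val he⟩
    simp only [this, Subtype.val_injective.encard_image]
  refine ((lintegral_congr h1).trans (lintegral_subtype_comap hA
    (fun e : X => (((Subtype.val '' B) ∩ f ⁻¹' {e}).encard : ℝ≥0∞)))).trans ?_
  rw [← lintegral_indicator hA]
  refine lintegral_congr fun e => ?_
  by_cases he : e ∈ A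
  · simp [he]
  · have : (Subtype.val '' B) ∩ f ⁻¹' {e} = ∅ := by
      ext g
      simp only [mem_inter_iff, mem_image, mem_preimage, mem_singleton_iff, mem_empty_iff_false,
        iff_false, not_and]
      rintro ⟨g, -, rfl⟩ h
      exact he (h ▸ hf g)
    simp [he, this]

/-- The corner `pGp` (`p` the indicator function of the Borel set `A`): all arrows with source and
range in `A`, with the normalized restriction `μ(A)⁻¹ μ|_A` of the measure. -/
noncomputable def corner (𝒢 : PmpGroupoid X G) (A : Set X) (hA : MeasurableSet A)
    (h0 : 𝒢.μ A ≠ 0) : PmpGroupoid A (𝒢.CornerArrow A) where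
  standardBorel_obj := by
    have := 𝒢.standardBorel_obj
    exact hA.standardBorel
  standardBorel_arr := by
    have := 𝒢.standardBorel_arr
    exact (𝒢.measurableSet_cornerArrow hA).standardBorel
  src g := ⟨𝒢.src g, g.2.1⟩
  rng g := ⟨𝒢.rng g, g.2.2⟩
  one e := ⟨𝒢.one e, 𝒢.one_mem_corner e.2⟩
  inv g := ⟨𝒢.inv g, 𝒢.inv_mem_corner g.2⟩
  mul g h e := ⟨𝒢.mul g h (congrArg Subtype.val e), 𝒢.mul_mem_corner g.2 h.2 _⟩
  src_one e := Subtype.ext (𝒢.src_one e)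
  rng_one e := Subtype.ext (𝒢.rng_one e)
  src_inv g := Subtype.ext (𝒢.src_inv g)
  rng_inv g := Subtype.ext (𝒢.rng_inv g)
  src_mul g h e := Subtype.ext (𝒢.src_mul g h _)
  rng_mul g h e := Subtype.ext (𝒢.rng_mul g h _)
  one_mul g := Subtype.ext (𝒢.one_mul g)
  mul_one g := Subtype.ext (𝒢.mul_one g)
  mul_assoc g h k e₁ e₂ := Subtype.ext
    (𝒢.mul_assoc g h k (congrArg Subtype.val e₁) (congrArg Subtype.val e₂))
  inv_mul g := Subtype.ext (𝒢.inv_mul g)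
  mul_inv g := Subtype.ext (𝒢.mul_inv g)
  measurable_src := (𝒢.measurable_src.comp measurable_subtype_coe).subtype_mk
  measurable_rng := (𝒢.measurable_rng.comp measurable_subtype_coe).subtype_mk
  measurable_one := (𝒢.measurable_one.comp measurable_subtype_coe).subtype_mk
  measurable_inv := (𝒢.measurable_inv.comp measurable_subtype_coe).subtype_mk
  measurable_mul := by
    refine Measurable.subtype_mk ?_
    have h : Measurable (fun p : {p : 𝒢.CornerArrow A × 𝒢.CornerArrow A //
        (⟨𝒢.src p.1, p.1.2.1⟩ : A) = ⟨𝒢.rng p.2, p.2.2.2⟩} =>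
        (⟨((p.1.1 : G), (p.1.2 : G)), congrArg Subtype.val p.2⟩ :
          {p : G × G // 𝒢.src p.1 = 𝒢.rng p.2})) := by
      refine Measurable.subtype_mk ?_
      exact (measurable_subtype_coe.comp (measurable_fst.comp measurable_subtype_coe)).prodMk
        (measurable_subtype_coe.comp (measurable_snd.comp measurable_subtype_coe))
    exact 𝒢.measurable_mul.comp h
  countable_src e := by
    refine ((𝒢.countable_src e).preimage Subtype.val_injective).mono ?_
    intro g hg
    exact congrArg Subtype.val hg
  countable_rng e := by
    refine ((𝒢.countable_rng e).preimage Subtype.val_injective).mono ?_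
    intro g hg
    exact congrArg Subtype.val hg
  μ := (𝒢.μ A)⁻¹ • 𝒢.μ.comap Subtype.val
  isProbabilityMeasure := by
    have := 𝒢.isProbabilityMeasure
    refine ⟨?_⟩
    rw [Measure.smul_apply, comap_subtype_coe_apply hA, image_univ, Subtype.range_coe, smul_eq_mul,
      ENNReal.inv_mul_cancel h0 (measure_ne_top _ _)]
  haar_eq B hB := by
    rw [lintegral_smul_measure, lintegral_smul_measure,
      𝒢.lintegral_corner hA B 𝒢.rng (fun g => g.2.2),
      𝒢.lintegral_corner hA B 𝒢.src (fun g => g.2.1)]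
    exact congrArg (fun c => (𝒢.μ A)⁻¹ • c)
      (𝒢.haar_eq _ ((𝒢.measurableSet_cornerArrow hA).subtype_image hB))

end PmpGroupoid

/-- The rescaling of an ultrafilter on the positive integers: the image of `ω` under
`d ↦ ⌊c d⌋`. -/
noncomputable def rescaleUltrafilter (c : ℝ) (ω : Ultrafilter ℕ) : Ultrafilter ℕ :=
  ω.map (fun d => ⌊c * d⌋₊)

/-! Write c for the measure of p and m = ⌊c d⌋. Ergodicity yields partial isometries w_0 = p, w_1,
..., w_k in [[G]] with domains in A whose ranges partition the objects up to a null set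
(`IsErgodic.exists_isTransversal`). They turn an element s into the matrix of its entries w_a⁻¹ s
w_b, which lie in the corner. So an approximation of G on d points amounts, up to o(d) bad points,
to an approximation of pGp on m points together with partial bijections recording how the translates
by the w_a are placed.

Counting these data gives two inequalities. For the upper bound (`IsTransversal.numRestr_le`), an
approximation of G is decoded from the fixed point set of p (at most 2^d choices), its compression
to the corner, and k partial bijections coming from w_1, ..., w_k. Their domains have about (1 - c)
d points in total, so they cost a factor exp((1 - c) d log d + o(d log d)). For the lower bound
(`IsTransversal.numRestr_mul_factorial_le`), each corner approximation is expanded to d points and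
conjugated by all d! permutations. The corner approximation and the permutation can both be decoded,
up to o(d) points, from the resulting approximation of G and the placement of the zeroth copy of the
m points. That placement has at most exp(c d log d + o(d log d)) values, so the net gain is again (1
- c) d log d.

As m log m / (d log d) tends to c, both inequalities say that the growth rate for G is c times the
rate for pGp plus 1 - c. The map y ↦ c y + 1 - c is an order isomorphism of the extended reals, so
it passes through suprema and through each notion of limit (`LimitPair`, `iSup_growth_eq`).

Two devices keep the estimates soft. The filter `ae` replaces "for all but o(d) points", so that
approximate identities are handled pointwise. The filter `approxFilter` lives on the set of all
approximations, so that a limit statement about one tautological family is a statement uniform in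
all good approximations. -/

namespace Sofic

/-! ### Asymptotic density on families of finite sets -/

section AlmostEverywhere

set_option linter.unusedSectionVars false

variable {ι : Type*} {l : Filter ι} {N : ι → ℕ} {Y Z : ι → Type} [∀ i, Finite (Y i)]
  [∀ i, Finite (Z i)]

/-- The `i`-th normalized cardinality of a set of points of a family of finite types. -/
noncomputable def dens (N : ι → ℕ) (S : Set (Σ i, Y i)) (i : ι) : ℝ :=
  ({y | ⟨i, y⟩ ∈ S}.ncard : ℝ) / N i

theorem dens_nonneg (S : Set (Σ i, Y i)) (i : ι) : 0 ≤ dens N S i := by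
  unfold dens; positivity

theorem dens_mono {S T : Set (Σ i, Y i)} (h : S ⊆ T) (i : ι) : dens N S i ≤ dens N T i := by
  unfold dens
  have : {y | (⟨i, y⟩ : Σ i, Y i) ∈ S}.ncard ≤ {y | (⟨i, y⟩ : Σ i, Y i) ∈ T}.ncard :=
    ncard_le_ncard (fun y hy => h hy) (toFinite _)
  gcongr

theorem dens_union_le (S T : Set (Σ i, Y i)) (i : ι) :
    dens N (S ∪ T) i ≤ dens N S i + dens N T i := by
  unfold dens
  rw [← add_div]
  gcongr
  exact_mod_cast ncard_union_le {y | (⟨i, y⟩ : Σ i, Y i) ∈ S} {y | (⟨i, y⟩ : Σ i, Y i) ∈ T}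

theorem dens_union_add_inter (S T : Set (Σ i, Y i)) (i : ι) :
    dens N (S ∪ T) i + dens N (S ∩ T) i = dens N S i + dens N T i := by
  unfold dens
  rw [← add_div, ← add_div]
  congr 1
  exact_mod_cast ncard_union_add_ncard_inter {y | (⟨i, y⟩ : Σ i, Y i) ∈ S}
    {y | (⟨i, y⟩ : Σ i, Y i) ∈ T} (toFinite _) (toFinite _)

variable (l N Y) in
/-- The filter of sets whose complement has density tending to `0` along `l`. -/
def ae : Filter (Σ i, Y i) where
  sets := {S | Tendsto (dens N Sᶜ) l (𝓝 0)}
  univ_sets := by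
    have : dens N (univ : Set (Σ i, Y i))ᶜ = fun _ => 0 := by
      ext i; simp [dens]
    change Tendsto _ _ _
    rw [this]
    exact tendsto_const_nhds
  sets_of_superset {S T} hS hST :=
    squeeze_zero (fun i => dens_nonneg _ i) (fun i => dens_mono (compl_subset_compl.2 hST) i) hS
  inter_sets {S T} hS hT := by
    refine squeeze_zero (fun i => dens_nonneg _ i) (fun i => ?_) (by simpa using hS.add hT)
    rw [compl_inter]
    exact dens_union_le _ _ i

theorem mem_ae {S : Set (Σ i, Y i)} : S ∈ ae l N Y ↔ Tendsto (dens N Sᶜ) l (𝓝 0) := Iff.rfl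

theorem ae_not_mem_iff {S : Set (Σ i, Y i)} :
    (∀ᶠ z in ae l N Y, z ∉ S) ↔ Tendsto (dens N S) l (𝓝 0) := by
  have : {z | z ∉ S}ᶜ = S := by ext; simp
  rw [Filter.Eventually, mem_ae, this]

/-- Pulling back along a family of partial bijections. -/
theorem ae_pull (a : ∀ i, Y i ≃. Z i) {P : (Σ i, Z i) → Prop} (h : ∀ᶠ z in ae l N Z, P z) :
    ∀ᶠ y in ae l N Y, ∀ z, a y.1 y.2 = some z → P ⟨y.1, z⟩ := by
  refine squeeze_zero (fun i => dens_nonneg _ i) (fun i => ?_) h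
  unfold dens
  gcongr
  have key : ∀ y ∈ {y | (⟨i, y⟩ : Σ i, Y i) ∈ {y : Σ i, Y i | ∀ z, a y.1 y.2 = some z → P ⟨y.1, z⟩}ᶜ},
      ∃ z, a i y = some z ∧ ¬ P ⟨i, z⟩ := by
    intro y hy
    simpa using hy
  rcases isEmpty_or_nonempty (Z i) with hZ | hZ
  · rw [show {y | (⟨i, y⟩ : Σ i, Y i) ∈
        {y : Σ i, Y i | ∀ z, a y.1 y.2 = some z → P ⟨y.1, z⟩}ᶜ} = ∅ from
      eq_empty_of_forall_notMem fun y hy => hZ.elim (key y hy).choose]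
    simp
  choose! f hf using key
  refine ncard_le_ncard_of_injOn f (fun y hy => (hf y hy).2) ?_ (toFinite _)
  intro y hy y' hy' e
  exact (a i).inj (hf y hy).1 (e ▸ (hf y' hy').1)

theorem dens_tendsto_of_ae_iff {S T : Set (Σ i, Y i)} {c : ℝ}
    (h : ∀ᶠ z in ae l N Y, z ∈ S ↔ z ∈ T) (hS : Tendsto (dens N S) l (𝓝 c)) :
    Tendsto (dens N T) l (𝓝 c) := by
  have h0 : Tendsto (dens N {z | ¬ (z ∈ S ↔ z ∈ T)}) l (𝓝 0) := h
  have h1 : Tendsto (fun i => dens N T i - dens N S i) l (𝓝 0) := by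
    refine squeeze_zero_norm (fun i => ?_) h0
    rw [Real.norm_eq_abs, abs_sub_le_iff]
    constructor
    · rw [sub_le_iff_le_add]
      refine (dens_mono (fun z hz => ?_) i).trans (dens_union_le _ _ i)
      by_cases h' : z ∈ S
      · exact Or.inr h'
      · exact Or.inl (by simp [h', hz])
    · rw [sub_le_iff_le_add]
      refine (dens_mono (fun z hz => ?_) i).trans (dens_union_le _ _ i)
      by_cases h' : z ∈ T
      · exact Or.inr h'
      · exact Or.inl (by simp [h', hz])
  simpa using h1.add hS

/-- The difference has limit density c - c = 0. This is how equalities of measures become pointwise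
statements about approximations: an inclusion between sets of equal density is an equality up to
negligible points. -/
theorem ae_of_dens_eq {S T : Set (Σ i, Y i)} {c : ℝ} (h : ∀ᶠ z in ae l N Y, z ∈ S → z ∈ T)
    (hS : Tendsto (dens N S) l (𝓝 c)) (hT : Tendsto (dens N T) l (𝓝 c)) :
    ∀ᶠ z in ae l N Y, z ∈ T → z ∈ S := by
  have h1 : Tendsto (dens N (S ∩ T)) l (𝓝 c) := by
    refine dens_tendsto_of_ae_iff ?_ hS
    filter_upwards [h] with z hz
    exact ⟨fun hs => ⟨hs, hz hs⟩, fun hs => hs.1⟩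
  have h2 : ∀ i, dens N (T \ S) i = dens N T i - dens N (S ∩ T) i := by
    intro i
    have := dens_union_add_inter (N := N) (T \ S) (S ∩ T) i
    have e1 : (T \ S) ∪ (S ∩ T) = T := by ext z; by_cases z ∈ S <;> simp [*]
    have e2 : (T \ S) ∩ (S ∩ T) = ∅ := by ext z; simp; tauto
    rw [e1, e2] at this
    have e3 : dens N (∅ : Set (Σ i, Y i)) i = 0 := by simp [dens]
    linarith
  have h3 : Tendsto (dens N (T \ S)) l (𝓝 0) := by
    have := hT.sub h1
    rw [sub_self] at this
    exact this.congr fun i => (h2 i).symm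
  filter_upwards [ae_not_mem_iff.2 h3] with z hz hT
  by_contra hS
  exact hz ⟨hT, hS⟩

theorem dens_biUnion_tendsto {κ : Type*} (s : Finset κ) (S : κ → Set (Σ i, Y i)) (c : κ → ℝ)
    (hS : ∀ k ∈ s, Tendsto (dens N (S k)) l (𝓝 (c k)))
    (hd : ∀ k ∈ s, ∀ k' ∈ s, k ≠ k' → ∀ᶠ z in ae l N Y, z ∈ S k → z ∉ S k') :
    Tendsto (dens N (⋃ k ∈ s, S k)) l (𝓝 (∑ k ∈ s, c k)) := by
  classical
  induction s using Finset.induction_on with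
  | empty =>
    have : dens N (∅ : Set (Σ i, Y i)) = fun _ => 0 := by ext i; simp [dens]
    simp only [Finset.notMem_empty, iUnion_of_empty, iUnion_empty, this, Finset.sum_empty]
    exact tendsto_const_nhds
  | insert a s ha ih =>
    have ih' := ih (fun k hk => hS k (Finset.mem_insert_of_mem hk))
      (fun k hk k' hk' => hd k (Finset.mem_insert_of_mem hk) k' (Finset.mem_insert_of_mem hk'))
    rw [Finset.sum_insert ha, Finset.set_biUnion_insert]
    have h0 : Tendsto (dens N (S a ∩ ⋃ k ∈ s, S k)) l (𝓝 0) := by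
      rw [← ae_not_mem_iff]
      have : ∀ᶠ z in ae l N Y, ∀ k ∈ s, z ∈ S a → z ∉ S k := by
        rw [Filter.eventually_all_finset]
        intro k hk
        exact hd a (Finset.mem_insert_self _ _) k (Finset.mem_insert_of_mem hk)
          (fun e => ha (e ▸ hk))
      filter_upwards [this] with z hz
      simp only [mem_inter_iff, mem_iUnion, not_and, not_exists]
      intro h k hk
      exact hz k hk h
    have h1 := ((hS a (Finset.mem_insert_self _ _)).add ih').sub h0
    rw [sub_zero] at h1
    refine h1.congr fun i => ?_
    have := dens_union_add_inter (N := N) (S a) (⋃ k ∈ s, S k) i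
    linarith

theorem dens_iUnion_tendsto {κ : Type*} [Fintype κ] (S : κ → Set (Σ i, Y i)) (c : κ → ℝ)
    (hS : ∀ k, Tendsto (dens N (S k)) l (𝓝 (c k)))
    (hd : ∀ k k', k ≠ k' → ∀ᶠ z in ae l N Y, z ∈ S k → z ∉ S k') :
    Tendsto (dens N (⋃ k, S k)) l (𝓝 (∑ k, c k)) := by
  have := dens_biUnion_tendsto Finset.univ S c (fun k _ => hS k) (fun k _ k' _ => hd k k')
  simpa using this

/-- Transferring densities along a family of partial bijections. -/
theorem dens_transfer (a : ∀ i, Y i ≃. Z i) {S : Set (Σ i, Z i)} {c : ℝ}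
    (hS : Tendsto (dens N S) l (𝓝 c))
    (ha : ∀ᶠ z in ae l N Z, z ∈ S → ∃ y, a z.1 y = some z.2) :
    Tendsto (dens N {y : Σ i, Y i | ∃ z, a y.1 y.2 = some z ∧ (⟨y.1, z⟩ : Σ i, Z i) ∈ S}) l
      (𝓝 c) := by
  have h1 : Tendsto (dens N {z : Σ i, Z i | z ∈ S ∧ ∃ y, a z.1 y = some z.2}) l (𝓝 c) := by
    refine dens_tendsto_of_ae_iff ?_ hS
    filter_upwards [ha] with z hz
    exact ⟨fun h => ⟨h, hz h⟩, fun h => h.1⟩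
  refine h1.congr fun i => ?_
  unfold dens
  congr 2
  refine Set.ncard_congr' ?_
  refine Equiv.symm <| Equiv.ofBijective
    (fun y => ⟨y.2.choose, y.2.choose_spec.2, y.1, y.2.choose_spec.1⟩) ⟨?_, ?_⟩
  · rintro ⟨y, hy⟩ ⟨y', hy'⟩ e
    have e' : hy.choose = hy'.choose := congrArg Subtype.val e
    exact Subtype.ext ((a i).inj hy.choose_spec.1 (e' ▸ hy'.choose_spec.1))
  · rintro ⟨z, hz, y, hy⟩
    have hy0 : ∃ z, a i y = some z ∧ (⟨i, z⟩ : Σ i, Z i) ∈ S := ⟨z, hy, hz⟩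
    refine ⟨⟨y, hy0⟩, Subtype.ext ?_⟩
    have := hy0.choose_spec.1
    exact Option.some_injective _ (this.symm.trans hy)

theorem dens_univ_fin {n : ι → ℕ} (i : ι) :
    dens N (univ : Set (Σ i, Fin (n i))) i = (n i : ℝ) / N i := by
  have : {y : Fin (n i) | (⟨i, y⟩ : Σ i, Fin (n i)) ∈ univ} = univ :=
    eq_univ_of_forall fun y => mem_univ _
  rw [dens, this, ncard_univ, Nat.card_eq_fintype_card, Fintype.card_fin]

end AlmostEverywhere

/-! ### Partial bijections from relations and matchings -/

/-- The partial bijection obtained from a relation by discarding all conflicts. -/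
noncomputable def pequivOfRel {α β : Type*} (R : α → β → Prop) : α ≃. β := by
  classical
  exact
  { toFun := fun x => if h : ∃ y, R x y ∧ (∀ y', R x y' → y' = y) ∧ ∀ x', R x' y → x' = x
      then some h.choose else none
    invFun := fun y => if h : ∃ x, R x y ∧ (∀ y', R x y' → y' = y) ∧ ∀ x', R x' y → x' = x
      then some h.choose else none
    inv := by
      intro x y
      constructor
      · intro hy
        split_ifs at hy with h
        · have h1 := h.choose_spec
          have h2 : h.choose = x := by simpa using hy
          rw [h2] at h1
          have h3 : ∃ y, R x y ∧ (∀ y', R x y' → y' = y) ∧ ∀ x', R x' y → x' = x := ⟨y, h1⟩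
          rw [dif_pos h3]
          exact congrArg some (h1.2.1 _ h3.choose_spec.1)
      · intro hx
        split_ifs at hx with h
        · have h1 := h.choose_spec
          have h2 : h.choose = y := by simpa using hx
          rw [h2] at h1
          have h3 : ∃ x, R x y ∧ (∀ y', R x y' → y' = y) ∧ ∀ x', R x' y → x' = x := ⟨x, h1⟩
          rw [dif_pos h3]
          exact congrArg some (h1.2.2 _ h3.choose_spec.1) }

theorem pequivOfRel_eq_some {α β : Type*} {R : α → β → Prop} {x : α} {y : β} :
    pequivOfRel R x = some y ↔ R x y ∧ (∀ y', R x y' → y' = y) ∧ ∀ x', R x' y → x' = x := by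
  classical
  have : pequivOfRel R x = if h : ∃ y, R x y ∧ (∀ y', R x y' → y' = y) ∧ ∀ x', R x' y → x' = x
      then some h.choose else none := rfl
  rw [this]
  constructor
  · intro hy
    split_ifs at hy with h
    · have h1 := h.choose_spec
      have h2 : h.choose = y := by simpa using hy
      rwa [h2] at h1
  · intro h
    have h3 : ∃ y, R x y ∧ (∀ y', R x y' → y' = y) ∧ ∀ x', R x' y → x' = x := ⟨y, h⟩
    rw [dif_pos h3]
    exact congrArg some (h.2.1 _ h3.choose_spec.1)

theorem exists_matching_of_le {α β : Type*} [Finite α] [Finite β] {S : Set α} {T : Set β}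
    (h : S.ncard ≤ T.ncard) : ∃ f : α ≃. β, (∀ x y, f x = some y → x ∈ S ∧ y ∈ T) ∧
      {x | ∃ y, f x = some y} = S := by
  classical
  rcases S.eq_empty_or_nonempty with rfl | hne
  · exact ⟨⊥, by simp, by simp⟩
  obtain ⟨T', hT', hc⟩ := Set.exists_subset_card_eq h
  obtain ⟨f, hf⟩ : ∃ f : α → β, BijOn f S T' := by
    have hTne : T'.Nonempty := by
      rw [← ncard_pos (toFinite _), hc]; exact (ncard_pos (toFinite _)).2 hne
    have : Nonempty β := ⟨hTne.some⟩
    obtain ⟨e⟩ : Nonempty (S ≃ T') := by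
      rw [← Nat.card_coe_set_eq, ← Nat.card_coe_set_eq] at hc
      exact Finite.card_eq.1 hc.symm
    refine ⟨fun x => if h : x ∈ S then e ⟨x, h⟩ else Classical.arbitrary β, ?_, ?_, ?_⟩
    · intro x hx; simp [hx]
    · intro x hx y hy e'
      simp only [hx, hy, dif_pos] at e'
      exact congrArg Subtype.val (e.injective (Subtype.ext e'))
    · intro y hy
      exact ⟨e.symm ⟨y, hy⟩, (e.symm ⟨y, hy⟩).2, by simp⟩
  refine ⟨pequivOfRel (fun x y => x ∈ S ∧ y = f x), ?_, ?_⟩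
  · intro x y hxy
    obtain ⟨⟨h1, rfl⟩, -⟩ := pequivOfRel_eq_some.1 hxy
    exact ⟨h1, hT' (hf.mapsTo h1)⟩
  · ext x
    constructor
    · rintro ⟨y, hy⟩
      exact (pequivOfRel_eq_some.1 hy).1.1
    · intro hx
      refine ⟨f x, pequivOfRel_eq_some.2 ⟨⟨hx, rfl⟩, fun y' h => h.2, ?_⟩⟩
      rintro x' ⟨h1, h2⟩
      exact (hf.injOn hx h1 h2).symm

/-- Two subsets of finite types are matched as far as their cardinalities allow. -/
theorem exists_matching {α β : Type*} [Finite α] [Finite β] (S : Set α) (T : Set β) :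
    ∃ f : α ≃. β, (∀ x y, f x = some y → x ∈ S ∧ y ∈ T) ∧
      ({x | ∃ y, f x = some y}.ncard = min S.ncard T.ncard) := by
  rcases le_total S.ncard T.ncard with h | h
  · obtain ⟨f, h1, h2⟩ := exists_matching_of_le h
    exact ⟨f, h1, by rw [h2, min_eq_left h]⟩
  · obtain ⟨f, h1, h2⟩ := exists_matching_of_le h
    refine ⟨f.symm, fun x y hxy => (h1 y x (f.eq_some_iff.1 hxy)).symm, ?_⟩
    rw [min_eq_right h, ← h2]
    refine Set.ncard_congr' (Equiv.ofBijective
      (fun x => ⟨x.2.choose, x.1, f.eq_some_iff.1 x.2.choose_spec⟩) ⟨?_, ?_⟩)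
    · rintro ⟨x, hx⟩ ⟨x', hx'⟩ e
      have e' : hx.choose = hx'.choose := congrArg Subtype.val e
      exact Subtype.ext (f.symm.inj hx.choose_spec (e' ▸ hx'.choose_spec))
    · rintro ⟨y, x, hyx⟩
      have h0 : ∃ y, f.symm x = some y := ⟨y, f.eq_some_iff.2 hyx⟩
      exact ⟨⟨x, h0⟩, Subtype.ext (Option.some_injective _
        (h0.choose_spec.symm.trans (f.eq_some_iff.2 hyx)))⟩

end Sofic

/-! ### Measurable selection of injective restrictions -/

namespace Sofic

section Selection

/-- The box of sequences bounded by `a` in the first `n` coordinates. -/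
def boundedSeq (a : ℕ → ℕ) (n : ℕ) : Set (ℕ → ℕ) := {x | ∀ i < n, x i ≤ a i}

theorem isCompact_Iic_seq (a : ℕ → ℕ) : IsCompact {x : ℕ → ℕ | ∀ i, x i ≤ a i} := by
  have := isCompact_univ_pi (fun i => (finite_Iic (a i)).isCompact)
  refine this.of_isClosed_subset ?_ ?_
  · simp only [ofPred_forall]
    exact isClosed_iInter fun i => isClosed_le (continuous_apply i) continuous_const
  · intro x hx i _
    exact hx i

/-- Compactness: truncating counterexamples x n by a gives points of the compact box, and truncation
leaves the first n coordinates of x n unchanged. A limit of a subsequence of the truncations is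
therefore a limit of the x n themselves. -/
theorem exists_boundedSeq_subset (a : ℕ → ℕ) {V : Set (ℕ → ℕ)} (hV : IsOpen V)
    (h : {x | ∀ i, x i ≤ a i} ⊆ V) : ∃ n, boundedSeq a n ⊆ V := by
  by_contra! hn
  have : ∀ n, ∃ x, x ∈ boundedSeq a n ∧ x ∉ V := fun n => not_subset.1 (hn n)
  choose x hx hxV using this
  let z : ℕ → ℕ → ℕ := fun n i => min (x n i) (a i)
  obtain ⟨w, hw, φ, hφ, hlim⟩ := (isCompact_Iic_seq a).tendsto_subseq
    (x := z) (fun n i => min_le_right _ _)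
  have hx' : Tendsto (x ∘ φ) atTop (𝓝 w) := by
    rw [tendsto_pi_nhds] at hlim ⊢
    intro i
    refine (hlim i).congr' ?_
    filter_upwards [eventually_gt_atTop i] with n hn
    have : i < φ n := hn.trans_le hφ.le_apply
    simpa [z] using hx (φ n) i this
  exact (hV.isClosed_compl.mem_of_tendsto hx' (Eventually.of_forall fun n => hxV _)) (h hw)

variable {X : Type*} [TopologicalSpace X] [T2Space X]

/-- A point off the compact image is separated from it by disjoint open sets, and some finite stage
already maps into the open set around the image. The closed sets on the right are measurable, so
continuity of the measure from above applies to them. -/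
theorem image_Iic_seq_eq_iInter (a : ℕ → ℕ) {F : (ℕ → ℕ) → X} (hF : Continuous F) :
    F '' {x | ∀ i, x i ≤ a i} = ⋂ n, closure (F '' boundedSeq a n) := by
  refine Subset.antisymm ?_ ?_
  · refine subset_iInter fun n => (image_mono ?_).trans subset_closure
    exact fun x hx i _ => hx i
  · intro y hy
    by_contra hyK
    have hK : IsClosed (F '' {x | ∀ i, x i ≤ a i}) :=
      ((isCompact_Iic_seq a).image hF).isClosed
    obtain ⟨U, W, hU, hW, hKU, hyW, hd⟩ := SeparatedNhds.of_isCompact_isCompact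
      ((isCompact_Iic_seq a).image hF) (isCompact_singleton (x := y))
      (disjoint_singleton_right.2 hyK)
    obtain ⟨n, hn⟩ := exists_boundedSeq_subset a (hU.preimage hF) (image_subset_iff.1 hKU)
    have h1 : closure (F '' boundedSeq a n) ⊆ Wᶜ :=
      closure_minimal ((image_subset_iff.2 hn).trans
        (fun u hu hw => disjoint_left.1 hd hu hw)) hW.isClosed_compl
    exact h1 (mem_iInter.1 hy n) (hyW rfl)

/-- A nonempty compact set of sequences has a lexicographically least element. -/
theorem exists_lex_least {C : Set (ℕ → ℕ)} (hC : IsCompact C) (hne : C.Nonempty) :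
    ∃ z ∈ C, ∀ y ∈ C, ∀ n, (∀ i < n, y i = z i) → z n ≤ y n := by
  have hmin : ∀ D : Set (ℕ → ℕ), D.Nonempty → ∀ n, ∃ x ∈ D, ∀ y ∈ D, x n ≤ y n := by
    intro D hD n
    have h := Nat.sInf_mem (hD.image fun x => x n)
    obtain ⟨x, hx, hxn⟩ := h
    exact ⟨x, hx, fun y hy => hxn.trans_le (Nat.sInf_le ⟨y, hy, rfl⟩)⟩
  choose! m hm hm' using hmin
  let D : ℕ → Set (ℕ → ℕ) := fun n => Nat.rec C (fun n D => D ∩ {x | x n = m D n n}) n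
  have hD : ∀ n, D (n + 1) = D n ∩ {x | x n = m (D n) n n} := fun n => rfl
  have hDne : ∀ n, (D n).Nonempty := by
    intro n
    induction n with
    | zero => exact hne
    | succ n ih => exact ⟨m (D n) n, hm _ ih n, rfl⟩
  have hDc : ∀ n, IsClosed (D n) := by
    intro n
    induction n with
    | zero => exact hC.isClosed
    | succ n ih =>
      rw [hD]
      exact ih.inter (isClosed_eq (continuous_apply n) continuous_const)
  obtain ⟨z, hz⟩ := IsCompact.nonempty_iInter_of_sequence_nonempty_isCompact_isClosed D
    (fun n => inter_subset_left) hDne hC hDc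
  rw [mem_iInter] at hz
  refine ⟨z, hz 0, fun y hy n hyz => ?_⟩
  have hyD : ∀ k ≤ n, y ∈ D k := by
    intro k
    induction k with
    | zero => exact fun _ => hy
    | succ k ih =>
      intro hk
      exact ⟨ih (by omega), (hyz k (by omega)).trans (hz (k + 1)).2⟩
  have : z n = m (D n) n n := (hz (n + 1)).2
  rw [this]
  exact hm' _ (hDne n) n y (hyD n le_rfl)

/-- Keep the lexicographically least point of each fibre of F in K. The discarded points form a
countable union of projections of compact sets, indexed by the first coordinate at which a smaller
point of the same fibre differs. -/
theorem exists_measurable_injOn_image_eq {F : (ℕ → ℕ) → X} (hF : Continuous F)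
    {K : Set (ℕ → ℕ)} (hK : IsCompact K) :
    ∃ T ⊆ K, MeasurableSet T ∧ InjOn F T ∧ F '' T = F '' K := by
  -- Writing the strict inequality as `p.2 n + 1 ≤ p.1 n` makes the condition visibly closed.
  let W : ℕ → Set ((ℕ → ℕ) × (ℕ → ℕ)) := fun n =>
    (K ×ˢ K) ∩ {p | F p.1 = F p.2 ∧ (∀ i < n, p.2 i = p.1 i) ∧ p.2 n + 1 ≤ p.1 n}
  have hc : ∀ k, Continuous fun x : ℕ → ℕ => x k := fun k => continuous_apply k
  have hW : ∀ n, IsCompact (W n) := by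
    intro n
    refine (hK.prod hK).inter_right ?_
    refine IsClosed.inter
      (isClosed_eq (hF.comp continuous_fst) (hF.comp continuous_snd)) (IsClosed.inter ?_ ?_)
    · have : {p : (ℕ → ℕ) × (ℕ → ℕ) | ∀ i < n, p.2 i = p.1 i} =
          ⋂ i, ⋂ (_ : i < n), {p | p.2 i = p.1 i} := by ext; simp
      change IsClosed {p : (ℕ → ℕ) × (ℕ → ℕ) | ∀ i < n, p.2 i = p.1 i}
      rw [this]
      exact isClosed_iInter fun i => isClosed_iInter fun _ =>
        isClosed_eq ((hc i).comp continuous_snd)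
          ((hc i).comp continuous_fst)
    · exact isClosed_le (((hc n).comp continuous_snd).add continuous_const)
        ((hc n).comp continuous_fst)
  refine ⟨K \ ⋃ n, Prod.fst '' W n, sdiff_subset, ?_, ?_, ?_⟩
  · exact hK.measurableSet.diff (MeasurableSet.iUnion fun n =>
      ((hW n).image continuous_fst).measurableSet)
  · intro x hx y hy e
    by_contra hne
    have hex : ∃ n, x n ≠ y n := by
      by_contra! h; exact hne (funext h)
    have hlt := Nat.find_spec hex
    have hmin : ∀ i < Nat.find hex, x i = y i := fun i hi => by
      simpa using Nat.find_min hex hi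
    rcases lt_or_gt_of_ne hlt with h | h
    · exact hy.2 (mem_iUnion.2 ⟨Nat.find hex, (y, x), ⟨⟨hy.1, hx.1⟩, e.symm, hmin, h⟩, rfl⟩)
    · exact hx.2 (mem_iUnion.2 ⟨Nat.find hex, (x, y), ⟨⟨hx.1, hy.1⟩, e,
        fun i hi => (hmin i hi).symm, h⟩, rfl⟩)
  · refine Subset.antisymm (image_mono sdiff_subset) ?_
    rintro _ ⟨x, hx, rfl⟩
    obtain ⟨z, hz, hz'⟩ := exists_lex_least (C := K ∩ F ⁻¹' {F x})
      (hK.inter_right (isClosed_singleton.preimage hF)) ⟨x, hx, rfl⟩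
    refine ⟨z, ⟨hz.1, ?_⟩, hz.2⟩
    simp only [mem_iUnion, not_exists]
    rintro n ⟨⟨a, b⟩, ⟨⟨ha, hb⟩, h1, h2, h3⟩, rfl⟩
    have := hz' b ⟨hb, h1.symm.trans hz.2⟩ n h2
    exact absurd h3 (by simp only [not_le]; exact Nat.lt_succ_of_le this)

variable [MeasurableSpace X] [BorelSpace X]

/-- The capacity argument for analytic sets: bound the coordinates one after the other so that the
outer measure of the image stays above a fixed r > 0. The closures of these images then have measure
at least r, and they decrease to the image of a compact box. -/
theorem exists_isCompact_image_ne_zero (μ : Measure X) [IsFiniteMeasure μ] {F : (ℕ → ℕ) → X}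
    (hF : Continuous F) (h : μ (range F) ≠ 0) :
    ∃ K : Set (ℕ → ℕ), IsCompact K ∧ μ (F '' K) ≠ 0 := by
  obtain ⟨r, hr0, hr⟩ := exists_between (pos_iff_ne_zero.2 h)
  have step : ∀ D : Set (ℕ → ℕ), r < μ (F '' D) → ∀ n, ∃ k, r < μ (F '' (D ∩ {x | x n ≤ k})) := by
    intro D hD n
    have h1 : D = ⋃ k, D ∩ {x | x n ≤ k} := by
      ext x; simp only [mem_iUnion, mem_inter_iff]
      exact ⟨fun hx => ⟨x n, hx, le_refl (x n)⟩, fun ⟨_, hx, _⟩ => hx⟩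
    have hm : Monotone fun k => F '' (D ∩ {x | x n ≤ k}) := by
      intro k k' hk
      exact image_mono (inter_subset_inter_right _ fun x hx => le_trans hx hk)
    -- Continuity from below along an increasing union holds for outer measure, so these images need
    -- not be measurable.
    rw [h1, image_iUnion, hm.measure_iUnion] at hD
    exact lt_iSup_iff.1 hD
  have hb : ∃ a : ℕ → ℕ, ∀ n, r < μ (F '' boundedSeq a n) := by
    choose! g hg using step
    let D : ℕ → Set (ℕ → ℕ) := fun n => Nat.rec univ (fun n D => D ∩ {x | x n ≤ g D n}) n
    have hD : ∀ n, D (n + 1) = D n ∩ {x | x n ≤ g (D n) n} := fun n => rfl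
    have hr' : ∀ n, r < μ (F '' D n) := by
      intro n
      induction n with
      | zero => simpa [D] using hr
      | succ n ih => rw [hD]; exact hg _ ih _
    refine ⟨fun n => g (D n) n, fun n => ?_⟩
    suffices boundedSeq (fun n => g (D n) n) n = D n from this ▸ hr' n
    induction n with
    | zero => ext x; simp [boundedSeq, D]
    | succ n ih =>
      have hx0 : ∀ x, x ∈ D n ↔ x ∈ boundedSeq (fun n => g (D n) n) n := fun x => by rw [ih]
      rw [hD]
      ext x
      rw [mem_inter_iff, hx0]
      exact ⟨fun hx => ⟨fun i hi => hx i (by omega), hx n (by omega)⟩, fun hx i hi => by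
        rcases Nat.lt_succ_iff_lt_or_eq.1 hi with h | rfl
        · exact hx.1 i h
        · exact hx.2⟩
  obtain ⟨a, ha⟩ := hb
  refine ⟨_, isCompact_Iic_seq a, ?_⟩
  rw [image_Iic_seq_eq_iInter a hF]
  have h1 := tendsto_measure_iInter_atTop (μ := μ)
    (s := fun n => closure (F '' boundedSeq a n))
    (fun n => isClosed_closure.measurableSet.nullMeasurableSet)
    (fun n m hnm => closure_mono (image_mono fun x hx i hi => hx i (hi.trans_le hnm)))
    ⟨0, measure_ne_top _ _⟩
  have h2 : r ≤ μ (⋂ n, closure (F '' boundedSeq a n)) :=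
    ge_of_tendsto' h1 fun n => (ha n).le.trans (measure_mono subset_closure)
  exact (hr0.trans_le h2).ne'

end Selection

/-- A measurable map restricts to an injective map on some measurable subset of any measurable set
with non-null image. -/
theorem exists_injOn_subset {G X : Type*} [MeasurableSpace G] [MeasurableSpace X]
    [StandardBorelSpace G] [StandardBorelSpace X] (μ : Measure X) [IsFiniteMeasure μ]
    {f : G → X} (hf : Measurable f) {S : Set G} (hS : MeasurableSet S) (h : μ (f '' S) ≠ 0) :
    ∃ T ⊆ S, MeasurableSet T ∧ InjOn f T ∧ μ (f '' T) ≠ 0 := by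
  let := upgradeStandardBorel X
  -- A finer Polish topology with the same Borel sets makes f continuous.
  obtain ⟨tG, hp, hb, hfc⟩ : ∃ tG : TopologicalSpace G, PolishSpace G ∧ BorelSpace G ∧
      Continuous f := by
    let := upgradeStandardBorel G
    have hp0 : PolishSpace G := inferInstance
    obtain ⟨t', ht', hfc, hp⟩ := hf.exists_continuous
    refine ⟨t', hp, ⟨?_⟩, hfc⟩
    rw [eq_borel_upgradeStandardBorel G]
    exact (borel_eq_borel_of_le hp hp0 ht').symm
  -- S is now a continuous image of Baire space under some g. The selection is made there for f ∘ g
  -- and pushed forward by g, which is injective wherever f ∘ g is.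
  have hSan := hS.analyticSet
  rw [AnalyticSet] at hSan
  rcases hSan with rfl | ⟨g, hg, rfl⟩
  · simp at h
  have hF : Continuous (f ∘ g) := hfc.comp hg
  rw [← range_comp] at h
  obtain ⟨K, hK, hK0⟩ := exists_isCompact_image_ne_zero μ hF h
  obtain ⟨T, hTK, hTm, hTi, hTe⟩ := exists_measurable_injOn_image_eq hF hK
  refine ⟨g '' T, image_subset_range _ _, ?_, ?_, ?_⟩
  · exact hTm.image_of_continuousOn_injOn hg.continuousOn hTi.of_comp
  · rintro _ ⟨x, hx, rfl⟩ _ ⟨y, hy, rfl⟩ e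
    exact congrArg g (hTi hx hy e)
  · rw [← image_comp, hTe]; exact hK0

end Sofic

/-! ### Algebra of the groupoid and of its full inverse semigroup -/

namespace DiscreteBorelGroupoid

variable {X : Type u} {G : Type v} [MeasurableSpace X] [MeasurableSpace G]
  (𝒢 : DiscreteBorelGroupoid X G)

theorem mul_congr {g g' h h' : G} (hg : g = g') (hh : h = h') (e : 𝒢.src g = 𝒢.rng h) :
    𝒢.mul g h e = 𝒢.mul g' h' (hg ▸ hh ▸ e) := by
  subst hg hh; rfl

theorem one_mul' {x : X} {h : G} (e : 𝒢.src (𝒢.one x) = 𝒢.rng h) : 𝒢.mul (𝒢.one x) h e = h := by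
  have : x = 𝒢.rng h := (𝒢.src_one x).symm.trans e
  subst this
  exact 𝒢.one_mul h

theorem mul_one' {x : X} {h : G} (e : 𝒢.src h = 𝒢.rng (𝒢.one x)) : 𝒢.mul h (𝒢.one x) e = h := by
  have : x = 𝒢.src h := (𝒢.rng_one x).symm.trans e.symm
  subst this
  exact 𝒢.mul_one h

theorem inv_mul_cancel_left {g h : G} (e : 𝒢.src g = 𝒢.rng h) :
    𝒢.mul (𝒢.inv g) (𝒢.mul g h e) ((𝒢.src_inv g).trans (𝒢.rng_mul g h e).symm) = h := by
  rw [← 𝒢.mul_assoc (𝒢.inv g) g h (𝒢.src_inv g) e, 𝒢.mul_congr (𝒢.inv_mul g) rfl, 𝒢.one_mul']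

theorem mul_left_cancel {g h h' : G} {e : 𝒢.src g = 𝒢.rng h} {e' : 𝒢.src g = 𝒢.rng h'}
    (H : 𝒢.mul g h e = 𝒢.mul g h' e') : h = h' := by
  rw [← 𝒢.inv_mul_cancel_left e, ← 𝒢.inv_mul_cancel_left e']
  exact 𝒢.mul_congr rfl H _

theorem eq_inv_of_mul_eq_one {g h : G} (e : 𝒢.src g = 𝒢.rng h)
    (H : 𝒢.mul g h e = 𝒢.one (𝒢.rng g)) : h = 𝒢.inv g :=
  𝒢.mul_left_cancel (H.trans (𝒢.mul_inv g).symm)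

@[simp] theorem inv_inv (g : G) : 𝒢.inv (𝒢.inv g) = g :=
  (𝒢.eq_inv_of_mul_eq_one (𝒢.src_inv g) (by rw [𝒢.inv_mul, 𝒢.rng_inv])).symm

theorem inv_mul_rev {g h : G} (e : 𝒢.src g = 𝒢.rng h) :
    𝒢.inv (𝒢.mul g h e) = 𝒢.mul (𝒢.inv h) (𝒢.inv g)
      ((𝒢.src_inv h).trans (e.symm.trans (𝒢.rng_inv g).symm)) := by
  symm
  refine 𝒢.eq_inv_of_mul_eq_one (by rw [𝒢.src_mul, 𝒢.rng_mul, 𝒢.rng_inv]) ?_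
  rw [𝒢.mul_assoc g h _ e (by rw [𝒢.rng_mul, 𝒢.rng_inv])]
  rw [𝒢.mul_congr rfl (𝒢.mul_assoc h (𝒢.inv h) (𝒢.inv g) (𝒢.rng_inv h).symm
    (by rw [𝒢.src_inv, 𝒢.rng_inv, e])).symm]
  rw [𝒢.mul_congr rfl (𝒢.mul_congr (𝒢.mul_inv h) rfl _)]
  rw [𝒢.mul_congr rfl (𝒢.one_mul' _), 𝒢.mul_inv, 𝒢.rng_mul]

end DiscreteBorelGroupoid

namespace PmpGroupoid

variable {X : Type u} {G : Type v} [MeasurableSpace X] [MeasurableSpace G] (𝒢 : PmpGroupoid X G)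

/-- The idempotent of `[[G]]` carried by a set of objects. -/
def unitSet (B : Set X) : Set G := 𝒢.one '' B

variable {𝒢} {s t r : Set G} {B C : Set X}

theorem one_injective : Function.Injective 𝒢.one := fun x y h => by
  rw [← 𝒢.src_one x, h, 𝒢.src_one]

@[simp] theorem one_mem_unitSet {x : X} : 𝒢.one x ∈ 𝒢.unitSet B ↔ x ∈ B :=
  one_injective.mem_set_image

theorem mem_unitSet {g : G} : g ∈ 𝒢.unitSet B ↔ 𝒢.src g ∈ B ∧ g = 𝒢.one (𝒢.src g) := by
  constructor
  · rintro ⟨x, hx, rfl⟩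
    rw [𝒢.src_one]; exact ⟨hx, rfl⟩
  · rintro ⟨h, e⟩
    rw [e]; exact mem_image_of_mem _ h

theorem setMul_assoc (s t r : Set G) :
    𝒢.setMul (𝒢.setMul s t) r = 𝒢.setMul s (𝒢.setMul t r) := by
  ext k
  constructor
  · rintro ⟨_, ⟨g, hg, h, hh, e, rfl⟩, x, hx, e', rfl⟩
    rw [𝒢.src_mul] at e'
    exact ⟨g, hg, 𝒢.mul h x e', ⟨h, hh, x, hx, e', rfl⟩, by rw [𝒢.rng_mul, e],
      𝒢.mul_assoc g h x e e'⟩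
  · rintro ⟨g, hg, _, ⟨h, hh, x, hx, e', rfl⟩, e, rfl⟩
    rw [𝒢.rng_mul] at e
    exact ⟨𝒢.mul g h e, ⟨g, hg, h, hh, e, rfl⟩, x, hx, by rw [𝒢.src_mul, e'],
      (𝒢.mul_assoc g h x e e').symm⟩

theorem mem_setInv {g : G} : g ∈ 𝒢.setInv s ↔ 𝒢.inv g ∈ s := by
  constructor
  · rintro ⟨h, hh, rfl⟩; simpa using hh
  · intro h; exact ⟨_, h, by simp⟩

@[simp] theorem setInv_setInv (s : Set G) : 𝒢.setInv (𝒢.setInv s) = s := by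
  ext g; simp [mem_setInv]

theorem setInv_setMul (s t : Set G) :
    𝒢.setInv (𝒢.setMul s t) = 𝒢.setMul (𝒢.setInv t) (𝒢.setInv s) := by
  have key : ∀ s t : Set G, 𝒢.setInv (𝒢.setMul s t) ⊆ 𝒢.setMul (𝒢.setInv t) (𝒢.setInv s) := by
    rintro s t _ ⟨_, ⟨g, hg, h, hh, e, rfl⟩, rfl⟩
    exact ⟨_, mem_image_of_mem _ hh, _, mem_image_of_mem _ hg, _, 𝒢.inv_mul_rev e⟩
  refine (key s t).antisymm fun k hk => ?_
  have h1 : 𝒢.inv k ∈ 𝒢.setInv (𝒢.setMul (𝒢.setInv t) (𝒢.setInv s)) := mem_image_of_mem _ hk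
  have h2 := key _ _ h1
  rw [setInv_setInv, setInv_setInv] at h2
  exact mem_setInv.2 h2

theorem setMul_unitSet : 𝒢.setMul s (𝒢.unitSet B) = {g | g ∈ s ∧ 𝒢.src g ∈ B} := by
  ext k
  constructor
  · rintro ⟨g, hg, _, ⟨x, hx, rfl⟩, e, rfl⟩
    rw [𝒢.mul_one']
    rw [𝒢.rng_one] at e
    exact ⟨hg, e ▸ hx⟩
  · rintro ⟨hk, hB⟩
    exact ⟨k, hk, _, mem_image_of_mem _ hB, (𝒢.rng_one _).symm, (𝒢.mul_one k).symm⟩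

theorem unitSet_setMul : 𝒢.setMul (𝒢.unitSet B) s = {g | g ∈ s ∧ 𝒢.rng g ∈ B} := by
  ext k
  constructor
  · rintro ⟨_, ⟨x, hx, rfl⟩, g, hg, e, rfl⟩
    rw [𝒢.one_mul']
    rw [𝒢.src_one] at e
    exact ⟨hg, e ▸ hx⟩
  · rintro ⟨hk, hB⟩
    exact ⟨_, mem_image_of_mem _ hB, k, hk, 𝒢.src_one _, (𝒢.one_mul k).symm⟩

theorem unitSet_setMul_unitSet : 𝒢.setMul (𝒢.unitSet B) (𝒢.unitSet C) = 𝒢.unitSet (B ∩ C) := by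
  rw [setMul_unitSet]
  ext g
  simp only [mem_unitSet, mem_inter_iff]
  exact ⟨fun h => ⟨⟨h.1.1, h.2⟩, h.1.2⟩, fun h => ⟨⟨h.1.1, h.2⟩, h.1.2⟩⟩

theorem setInv_setMul_self (hs : InjOn 𝒢.rng s) :
    𝒢.setMul (𝒢.setInv s) s = 𝒢.unitSet (𝒢.src '' s) := by
  ext k
  constructor
  · rintro ⟨_, ⟨g, hg, rfl⟩, h, hh, e, rfl⟩
    rw [𝒢.src_inv] at e
    obtain rfl := hs hg hh e
    rw [𝒢.inv_mul]
    exact mem_image_of_mem _ (mem_image_of_mem _ hg)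
  · rintro ⟨_, ⟨g, hg, rfl⟩, rfl⟩
    exact ⟨_, mem_image_of_mem _ hg, g, hg, 𝒢.src_inv g, (𝒢.inv_mul g).symm⟩

theorem setMul_setInv_self (hs : InjOn 𝒢.src s) :
    𝒢.setMul s (𝒢.setInv s) = 𝒢.unitSet (𝒢.rng '' s) := by
  ext k
  constructor
  · rintro ⟨g, hg, _, ⟨h, hh, rfl⟩, e, rfl⟩
    rw [𝒢.rng_inv] at e
    obtain rfl := hs hg hh e
    rw [𝒢.mul_inv]
    exact mem_image_of_mem _ (mem_image_of_mem _ hg)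
  · rintro ⟨_, ⟨g, hg, rfl⟩, rfl⟩
    exact ⟨g, hg, _, mem_image_of_mem _ hg, (𝒢.rng_inv g).symm, (𝒢.mul_inv g).symm⟩

theorem src_image_setInv : 𝒢.src '' 𝒢.setInv s = 𝒢.rng '' s := by
  simp only [setInv, image_image, 𝒢.src_inv]

theorem rng_image_setInv : 𝒢.rng '' 𝒢.setInv s = 𝒢.src '' s := by
  simp only [setInv, image_image, 𝒢.rng_inv]

theorem src_image_setMul :
    𝒢.src '' 𝒢.setMul s t = 𝒢.src '' (t ∩ 𝒢.rng ⁻¹' (𝒢.src '' s)) := by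
  ext x
  constructor
  · rintro ⟨_, ⟨g, hg, h, hh, e, rfl⟩, rfl⟩
    rw [𝒢.src_mul]
    exact ⟨h, ⟨hh, g, hg, e⟩, rfl⟩
  · rintro ⟨h, ⟨hh, g, hg, e⟩, rfl⟩
    exact ⟨_, ⟨g, hg, h, hh, e, rfl⟩, 𝒢.src_mul g h e⟩

theorem setMul_mono {s' t' : Set G} (hs : s ⊆ s') (ht : t ⊆ t') :
    𝒢.setMul s t ⊆ 𝒢.setMul s' t' := by
  rintro _ ⟨g, hg, h, hh, e, rfl⟩
  exact ⟨g, hs hg, h, ht hh, e, rfl⟩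

theorem measurableSet_src_image (hs : s ∈ 𝒢.fullInverseSemigroup) :
    MeasurableSet (𝒢.src '' s) := by
  have := 𝒢.standardBorel_obj
  have := 𝒢.standardBorel_arr
  exact hs.1.image_of_measurable_injOn 𝒢.measurable_src hs.2.1

theorem measurableSet_rng_image (hs : s ∈ 𝒢.fullInverseSemigroup) :
    MeasurableSet (𝒢.rng '' s) := by
  have := 𝒢.standardBorel_obj
  have := 𝒢.standardBorel_arr
  exact hs.1.image_of_measurable_injOn 𝒢.measurable_rng hs.2.2

theorem setInv_mem (hs : s ∈ 𝒢.fullInverseSemigroup) : 𝒢.setInv s ∈ 𝒢.fullInverseSemigroup := by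
  refine ⟨?_, ?_, ?_⟩
  · have : 𝒢.setInv s = 𝒢.inv ⁻¹' s := by ext g; exact mem_setInv
    rw [this]; exact 𝒢.measurable_inv hs.1
  · rintro _ ⟨g, hg, rfl⟩ _ ⟨h, hh, rfl⟩ e
    rw [𝒢.src_inv, 𝒢.src_inv] at e
    rw [hs.2.2 hg hh e]
  · rintro _ ⟨g, hg, rfl⟩ _ ⟨h, hh, rfl⟩ e
    rw [𝒢.rng_inv, 𝒢.rng_inv] at e
    rw [hs.2.1 hg hh e]

theorem setMul_mem (hs : s ∈ 𝒢.fullInverseSemigroup) (ht : t ∈ 𝒢.fullInverseSemigroup) :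
    𝒢.setMul s t ∈ 𝒢.fullInverseSemigroup := by
  have := 𝒢.standardBorel_obj
  have := 𝒢.standardBorel_arr
  refine ⟨?_, ?_, ?_⟩
  · have hD : MeasurableSet {p : G × G | 𝒢.src p.1 = 𝒢.rng p.2} :=
      measurableSet_eq_fun (𝒢.measurable_src.comp measurable_fst)
        (𝒢.measurable_rng.comp measurable_snd)
    have : StandardBorelSpace {p : G × G // 𝒢.src p.1 = 𝒢.rng p.2} := hD.standardBorel
    have hS : MeasurableSet {p : {p : G × G // 𝒢.src p.1 = 𝒢.rng p.2} |
        p.1.1 ∈ s ∧ p.1.2 ∈ t} :=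
      ((measurable_fst.comp measurable_subtype_coe) hs.1).inter
        ((measurable_snd.comp measurable_subtype_coe) ht.1)
    have h1 := hS.image_of_measurable_injOn 𝒢.measurable_mul ?_
    · convert h1 using 1
      ext k
      constructor
      · rintro ⟨g, hg, h, hh, e, rfl⟩
        exact ⟨⟨(g, h), e⟩, ⟨hg, hh⟩, rfl⟩
      · rintro ⟨⟨⟨g, h⟩, e⟩, ⟨hg, hh⟩, rfl⟩
        exact ⟨g, hg, h, hh, e, rfl⟩
    · rintro ⟨⟨g, h⟩, e⟩ ⟨hg, hh⟩ ⟨⟨g', h'⟩, e'⟩ ⟨hg', hh'⟩ H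
      have H : 𝒢.mul g h e = 𝒢.mul g' h' e' := H
      obtain rfl : g = g' := hs.2.2 hg hg' (by rw [← 𝒢.rng_mul g h e, H, 𝒢.rng_mul])
      obtain rfl : h = h' := 𝒢.mul_left_cancel H
      rfl
  · rintro _ ⟨g, hg, h, hh, e, rfl⟩ _ ⟨g', hg', h', hh', e', rfl⟩ H
    rw [𝒢.src_mul, 𝒢.src_mul] at H
    obtain rfl := ht.2.1 hh hh' H
    obtain rfl := hs.2.1 hg hg' (e.trans e'.symm)
    rfl
  · rintro _ ⟨g, hg, h, hh, e, rfl⟩ _ ⟨g', hg', h', hh', e', rfl⟩ H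
    rw [𝒢.rng_mul, 𝒢.rng_mul] at H
    obtain rfl := hs.2.2 hg hg' H
    obtain rfl := ht.2.2 hh hh' (e.symm.trans e')
    rfl

theorem unitSet_mem (hB : MeasurableSet B) : 𝒢.unitSet B ∈ 𝒢.fullInverseSemigroup := by
  have := 𝒢.standardBorel_obj
  have := 𝒢.standardBorel_arr
  refine ⟨hB.image_of_measurable_injOn 𝒢.measurable_one one_injective.injOn, ?_, ?_⟩
  · rintro _ ⟨x, -, rfl⟩ _ ⟨y, -, rfl⟩ e
    rw [𝒢.src_one, 𝒢.src_one] at e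
    rw [e]
  · rintro _ ⟨x, -, rfl⟩ _ ⟨y, -, rfl⟩ e
    rw [𝒢.rng_one, 𝒢.rng_one] at e
    rw [e]

theorem setOne_eq : 𝒢.setOne = 𝒢.unitSet univ := image_univ.symm

theorem setOne_mem : 𝒢.setOne ∈ 𝒢.fullInverseSemigroup := by
  rw [setOne_eq]; exact unitSet_mem MeasurableSet.univ

@[simp] theorem setOne_setMul (s : Set G) : 𝒢.setMul 𝒢.setOne s = s := by
  rw [setOne_eq, unitSet_setMul]; simp

theorem mem_of_subset (hs : s ∈ 𝒢.fullInverseSemigroup) (hts : t ⊆ s) (ht : MeasurableSet t) :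
    t ∈ 𝒢.fullInverseSemigroup := ⟨ht, hs.2.1.mono hts, hs.2.2.mono hts⟩

theorem inter_src_mem (hs : s ∈ 𝒢.fullInverseSemigroup) (hB : MeasurableSet B) :
    s ∩ 𝒢.src ⁻¹' B ∈ 𝒢.fullInverseSemigroup :=
  mem_of_subset hs inter_subset_left (hs.1.inter (𝒢.measurable_src hB))

theorem inter_rng_mem (hs : s ∈ 𝒢.fullInverseSemigroup) (hB : MeasurableSet B) :
    s ∩ 𝒢.rng ⁻¹' B ∈ 𝒢.fullInverseSemigroup :=
  mem_of_subset hs inter_subset_left (hs.1.inter (𝒢.measurable_rng hB))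

theorem lintegral_encard_of_injOn {f : G → X} (hs : InjOn f s) (hm : MeasurableSet (f '' s)) :
    ∫⁻ e, ((s ∩ f ⁻¹' {e}).encard : ℝ≥0∞) ∂𝒢.μ = 𝒢.μ (f '' s) := by
  rw [← lintegral_indicator_one hm]
  refine lintegral_congr fun e => ?_
  by_cases he : e ∈ f '' s
  · obtain ⟨g, hg, rfl⟩ := he
    have : s ∩ f ⁻¹' {f g} = {g} := by
      ext h
      constructor
      · rintro ⟨h1, h2⟩; exact hs h1 hg h2
      · rintro rfl; exact ⟨hg, rfl⟩
    rw [this, indicator_of_mem (mem_image_of_mem _ hg)]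
    simp
  · have : s ∩ f ⁻¹' {e} = ∅ := by
      ext h
      simp only [mem_inter_iff, mem_preimage, mem_singleton_iff, mem_empty_iff_false, iff_false]
      rintro ⟨h1, rfl⟩
      exact he (mem_image_of_mem _ h1)
    rw [this, indicator_of_notMem he]
    simp

/-- Elements of `[[G]]` preserve the measure. -/
theorem measure_src_eq_rng (hs : s ∈ 𝒢.fullInverseSemigroup) :
    𝒢.μ (𝒢.src '' s) = 𝒢.μ (𝒢.rng '' s) := by
  have := 𝒢.haar_eq s hs.1
  rw [lintegral_encard_of_injOn hs.2.1 (measurableSet_src_image hs),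
    lintegral_encard_of_injOn hs.2.2 (measurableSet_rng_image hs)] at this
  exact this.symm

theorem trace_unitSet : 𝒢.trace (𝒢.unitSet B) = 𝒢.μ.real B := by
  unfold trace
  congr 1
  ext x; simp

/-- The measure of the domain of a product. -/
theorem measure_src_setMul (hs : s ∈ 𝒢.fullInverseSemigroup) (ht : t ∈ 𝒢.fullInverseSemigroup) :
    𝒢.μ (𝒢.src '' 𝒢.setMul s t) = 𝒢.μ (𝒢.rng '' t ∩ 𝒢.src '' s) := by
  rw [src_image_setMul, measure_src_eq_rng (inter_rng_mem ht (measurableSet_src_image hs)),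
    image_inter_preimage]

/-- The trace of `v⁻¹ s v`. -/
theorem trace_conj {w : Set G} (hw : w ∈ 𝒢.fullInverseSemigroup)
    (hs : s ∈ 𝒢.fullInverseSemigroup) :
    𝒢.trace (𝒢.setMul (𝒢.setInv w) (𝒢.setMul s w)) =
      𝒢.μ.real (𝒢.rng '' w ∩ {x | 𝒢.one x ∈ s}) := by
  have hm : MeasurableSet {x | 𝒢.one x ∈ s} := 𝒢.measurable_one hs.1
  have h1 := measure_src_eq_rng (inter_rng_mem hw hm)
  rw [image_inter_preimage] at h1
  unfold trace Measure.real
  rw [← h1]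
  congr 2
  ext x
  constructor
  · rintro ⟨_, ⟨g, hg, rfl⟩, _, ⟨k, hk, h, hh, e', rfl⟩, e, H⟩
    have hr : 𝒢.src g = x := by
      have := congrArg 𝒢.rng H
      rwa [𝒢.rng_one, 𝒢.rng_mul, 𝒢.rng_inv, eq_comm] at this
    have hx : 𝒢.src h = x := by
      have := congrArg 𝒢.src H
      rwa [𝒢.src_one, 𝒢.src_mul, 𝒢.src_mul, eq_comm] at this
    obtain rfl := hw.2.1 hg hh (hr.trans hx.symm)
    refine ⟨g, ⟨hg, ?_⟩, hr⟩
    have h2 : 𝒢.mul (𝒢.inv g) (𝒢.mul k g e') e = 𝒢.mul (𝒢.inv g) g (𝒢.src_inv g) := by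
      rw [← H, 𝒢.inv_mul, hr]
    have h3 : 𝒢.mul k g e' = g := 𝒢.mul_left_cancel h2
    -- From k g = g, pass to inverses to obtain g⁻¹ k⁻¹ = g⁻¹, where left cancellation applies.
    have h4 : k = 𝒢.one (𝒢.rng g) := by
      have e1 : 𝒢.src k = 𝒢.rng k := by
        rw [e', ← 𝒢.rng_mul k g e', h3]
      have h5 : 𝒢.inv (𝒢.mul k g e') = 𝒢.inv g := by rw [h3]
      rw [𝒢.inv_mul_rev] at h5
      have h6 : 𝒢.mul (𝒢.inv g) (𝒢.inv k) ((𝒢.src_inv g).trans (e'.symm.trans (𝒢.rng_inv k).symm)) =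
          𝒢.mul (𝒢.inv g) (𝒢.one (𝒢.rng g)) (by rw [𝒢.src_inv, 𝒢.rng_one]) := by
        rw [h5, 𝒢.mul_one']
      have h7 : 𝒢.inv k = 𝒢.one (𝒢.rng g) := 𝒢.mul_left_cancel h6
      have h8 : 𝒢.one (𝒢.rng g) = 𝒢.inv (𝒢.one (𝒢.rng g)) :=
        𝒢.eq_inv_of_mul_eq_one (by rw [𝒢.src_one, 𝒢.rng_one])
          (by rw [𝒢.one_mul', 𝒢.rng_one])
      rw [← 𝒢.inv_inv k, h7, ← h8]
    change 𝒢.one (𝒢.rng g) ∈ s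
    rw [← h4]
    exact hk
  · rintro ⟨g, ⟨hg, hgs⟩, rfl⟩
    exact ⟨_, mem_image_of_mem _ hg, g, ⟨_, hgs, g, hg, 𝒢.src_one _, (𝒢.one_mul g).symm⟩,
      𝒢.src_inv g, (𝒢.inv_mul g).symm⟩

end PmpGroupoid

/-! ### Comparison of sets in an ergodic groupoid -/

namespace PmpGroupoid

variable {X : Type u} {G : Type v} [MeasurableSpace X] [MeasurableSpace G] {𝒢 : PmpGroupoid X G}
  {s t : Set G} {B C A : Set X}

/-- Select twice. On a first subset the range map is injective with non-null image; equality of the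
two Haar measures makes its source image non-null as well, and a second selection makes the source
map injective too. -/
theorem exists_bisection_of_rng_image_ne_zero (hs : MeasurableSet s)
    (h : 𝒢.μ (𝒢.rng '' s) ≠ 0) :
    ∃ w ∈ 𝒢.fullInverseSemigroup, w ⊆ s ∧ 𝒢.μ (𝒢.src '' w) ≠ 0 := by
  have := 𝒢.standardBorel_obj
  have := 𝒢.standardBorel_arr
  have := 𝒢.isProbabilityMeasure
  obtain ⟨T, hT, hTm, hTi, hT0⟩ := Sofic.exists_injOn_subset 𝒢.μ 𝒢.measurable_rng hs h
  have h1 : 𝒢.μ (𝒢.src '' T) ≠ 0 := by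
    intro h0
    apply hT0
    rw [← lintegral_encard_of_injOn hTi
      (hTm.image_of_measurable_injOn 𝒢.measurable_rng hTi), 𝒢.haar_eq T hTm]
    rw [← lintegral_zero (μ := 𝒢.μ)]
    refine lintegral_congr_ae ?_
    filter_upwards [measure_eq_zero_iff_ae_notMem.1 h0] with e he
    have : T ∩ 𝒢.src ⁻¹' {e} = ∅ := by
      ext g
      simp only [mem_inter_iff, mem_preimage, mem_singleton_iff, mem_empty_iff_false, iff_false]
      rintro ⟨hg, rfl⟩
      exact he (mem_image_of_mem _ hg)
    rw [this]; simp
  obtain ⟨w, hw, hwm, hwi, hw0⟩ := Sofic.exists_injOn_subset 𝒢.μ 𝒢.measurable_src hTm h1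
  exact ⟨w, ⟨hwm, hwi, hTi.mono hw⟩, hw.trans hT, hw0⟩

/-- The saturation of a set of objects. -/
def saturation (𝒢 : PmpGroupoid X G) (B : Set X) : Set X := 𝒢.rng '' (𝒢.src ⁻¹' B)

theorem subset_saturation : B ⊆ 𝒢.saturation B := fun x hx =>
  ⟨𝒢.one x, by simpa [𝒢.src_one] using hx, 𝒢.rng_one x⟩

theorem saturation_saturation_subset : 𝒢.saturation (𝒢.saturation B) ⊆ 𝒢.saturation B := by
  rintro _ ⟨g, ⟨h, hh, e⟩, rfl⟩
  exact ⟨𝒢.mul g h e.symm, by rw [mem_preimage, 𝒢.src_mul]; exact hh, 𝒢.rng_mul _ _ _⟩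

theorem disjoint_saturation (h : Disjoint (𝒢.saturation B) C) :
    Disjoint B (𝒢.saturation C) := by
  rw [disjoint_left] at h ⊢
  rintro _ hx ⟨g, hg, rfl⟩
  refine h ⟨𝒢.inv g, ?_, 𝒢.rng_inv g⟩ hg
  rw [mem_preimage, 𝒢.src_inv]
  exact hx

/-- Saturations are only known to be analytic here. Separating the saturation of B from that of C by
a Borel set and repeating with the Borel set obtained gives a sequence, each term containing the
saturation of its predecessor, so that the union is both Borel and invariant. -/
theorem exists_measurable_invariant_of_disjoint (hB : MeasurableSet B) (hC : MeasurableSet C)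
    (h : Disjoint (𝒢.saturation B) C) :
    ∃ J, MeasurableSet J ∧ (∀ g, 𝒢.src g ∈ J ↔ 𝒢.rng g ∈ J) ∧ B ⊆ J ∧ Disjoint J C := by
  have := 𝒢.standardBorel_obj
  have := 𝒢.standardBorel_arr
  let := upgradeStandardBorel X
  have han : ∀ B, MeasurableSet B → AnalyticSet (𝒢.saturation B) := fun B hB =>
    (𝒢.measurable_src hB).analyticSet_image 𝒢.measurable_rng
  have step : ∀ J : Set X, MeasurableSet J → Disjoint J (𝒢.saturation C) →
      ∃ J', MeasurableSet J' ∧ 𝒢.saturation J ⊆ J' ∧ Disjoint J' (𝒢.saturation C) := by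
    intro J hJ hd
    have hd' : Disjoint (𝒢.saturation J) (𝒢.saturation C) := by
      have : Disjoint (𝒢.saturation C) J := hd.symm
      exact (disjoint_saturation (this.mono_left saturation_saturation_subset)).symm
    obtain ⟨J', h1, h2, h3⟩ := (han J hJ).measurablySeparable (han C hC) hd'
    exact ⟨J', h3, h1, h2.symm⟩
  choose! F hF1 hF2 hF3 using step
  have hP : ∀ n, MeasurableSet (F^[n] B) ∧ Disjoint (F^[n] B) (𝒢.saturation C) := by
    intro n
    induction n with
    | zero => exact ⟨hB, disjoint_saturation h⟩
    | succ n ih =>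
      rw [Function.iterate_succ_apply']
      exact ⟨hF1 _ ih.1 ih.2, hF3 _ ih.1 ih.2⟩
  have hinv : ∀ g, 𝒢.src g ∈ ⋃ n, F^[n] B → 𝒢.rng g ∈ ⋃ n, F^[n] B := by
    intro g hg
    obtain ⟨n, hn⟩ := mem_iUnion.1 hg
    refine mem_iUnion.2 ⟨n + 1, ?_⟩
    rw [Function.iterate_succ_apply']
    exact hF2 _ (hP n).1 (hP n).2 ⟨g, hn, rfl⟩
  refine ⟨⋃ n, F^[n] B, MeasurableSet.iUnion fun n => (hP n).1, fun g => ⟨hinv g, fun hg => ?_⟩,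
    subset_iUnion (fun n => F^[n] B) 0, ?_⟩
  · have := hinv (𝒢.inv g)
    rw [𝒢.src_inv, 𝒢.rng_inv] at this
    exact this hg
  · exact disjoint_iUnion_left.2 fun n => (hP n).2.mono_right subset_saturation

/-- If almost no arrow led from B into C, then after removal of a null Borel set from C an invariant
Borel set would contain B and miss the rest of C. Being neither null nor conull, it would contradict
ergodicity. -/
theorem IsErgodic.exists_bisection (hG : 𝒢.IsErgodic) (hB : MeasurableSet B)
    (hC : MeasurableSet C) (hB0 : 𝒢.μ B ≠ 0) (hC0 : 𝒢.μ C ≠ 0) :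
    ∃ w ∈ 𝒢.fullInverseSemigroup, 𝒢.src '' w ⊆ B ∧ 𝒢.rng '' w ⊆ C ∧ 𝒢.μ (𝒢.src '' w) ≠ 0 := by
  have := 𝒢.isProbabilityMeasure
  have key : 𝒢.μ (𝒢.rng '' (𝒢.src ⁻¹' B ∩ 𝒢.rng ⁻¹' C)) ≠ 0 := by
    intro h0
    rw [image_inter_preimage] at h0
    set N := toMeasurable 𝒢.μ (𝒢.rng '' (𝒢.src ⁻¹' B) ∩ C) with hN
    have hNm : MeasurableSet N := measurableSet_toMeasurable _ _
    have hN0 : 𝒢.μ N = 0 := by rw [hN, measure_toMeasurable, h0]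
    have hd : Disjoint (𝒢.saturation B) (C \ N) := disjoint_left.2 fun x hx hx' =>
      hx'.2 (subset_toMeasurable _ _ ⟨hx, hx'.1⟩)
    obtain ⟨J, hJ, hinv, hBJ, hJC⟩ :=
      exists_measurable_invariant_of_disjoint hB (hC.diff hNm) hd
    rcases hG J hJ hinv with h | h
    · exact hB0 (measure_mono_null hBJ h)
    · have h2 : 𝒢.μ Jᶜ = 0 := by rw [prob_compl_eq_zero_iff hJ]; exact h
      apply hC0
      have h3 : 𝒢.μ (C \ N) = 0 :=
        measure_mono_null (fun x hx hxJ => disjoint_left.1 hJC hxJ hx) h2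
      rwa [measure_sdiff_null hN0] at h3
  obtain ⟨w, hw, hws, hw0⟩ := exists_bisection_of_rng_image_ne_zero
    ((𝒢.measurable_src hB).inter (𝒢.measurable_rng hC)) key
  exact ⟨w, hw, image_subset_iff.2 fun g hg => (hws hg).1,
    image_subset_iff.2 fun g hg => (hws hg).2, hw0⟩

/-- Greedy exhaustion along a sequence: each step realizes at least half of the gain still possible,
which is what `f u ≤ 2 * f w - f v` says. Since f converges along the sequence, no gain is left at
the union. -/
theorem _root_.Sofic.exists_maximal_of_bounded {α : Type*} (P : Set α → Prop) (f : Set α → ℝ) (b : ℝ)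
    (hf : ∀ u, P u → f u ≤ b) (hmono : ∀ u w, P u → P w → u ⊆ w → f u ≤ f w)
    (hU : ∀ w : ℕ → Set α, Monotone w → (∀ n, P (w n)) → P (⋃ n, w n)) {v₀ : Set α}
    (h₀ : P v₀) : ∃ v, P v ∧ ∀ u, P u → v ⊆ u → f u ≤ f v := by
  have step : ∀ v, P v → ∃ w, P w ∧ v ⊆ w ∧ ∀ u, P u → v ⊆ u → f u ≤ 2 * f w - f v := by
    intro v hv
    let S := f '' {u | P u ∧ v ⊆ u}
    have hS : BddAbove S := ⟨b, by rintro _ ⟨u, hu, rfl⟩; exact hf u hu.1⟩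
    have hvS : f v ≤ sSup S := le_csSup hS ⟨v, ⟨hv, Subset.rfl⟩, rfl⟩
    rcases hvS.eq_or_lt with h | h
    · refine ⟨v, hv, Subset.rfl, fun u hu hvu => ?_⟩
      have : f u ≤ sSup S := le_csSup hS ⟨u, ⟨hu, hvu⟩, rfl⟩
      linarith
    · obtain ⟨_, ⟨w, hw, rfl⟩, hlt⟩ := exists_lt_of_lt_csSup (s := S) (b := (f v + sSup S) / 2)
        ⟨f v, v, ⟨hv, Subset.rfl⟩, rfl⟩ (by linarith)
      refine ⟨w, hw.1, hw.2, fun u hu hvu => ?_⟩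
      have : f u ≤ sSup S := le_csSup hS ⟨u, ⟨hu, hvu⟩, rfl⟩
      linarith
  choose! g hg1 hg2 hg3 using step
  have hP : ∀ n, P (g^[n] v₀) := by
    intro n
    induction n with
    | zero => exact h₀
    | succ n ih => rw [Function.iterate_succ_apply']; exact hg1 _ ih
  have hm : Monotone fun n => g^[n] v₀ := monotone_nat_of_le_succ fun n => by
    rw [Function.iterate_succ_apply']; exact hg2 _ (hP n)
  have hPU := hU _ hm hP
  refine ⟨_, hPU, fun u hu hvu => ?_⟩
  have hfm : Monotone fun n => f (g^[n] v₀) := fun n m hnm => hmono _ _ (hP n) (hP m) (hm hnm)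
  have hlim := tendsto_atTop_ciSup hfm ⟨b, by rintro _ ⟨n, rfl⟩; exact hf _ (hP n)⟩
  set L := ⨆ n, f (g^[n] v₀)
  have hL : L ≤ f (⋃ n, g^[n] v₀) := ciSup_le fun n =>
    hmono _ _ (hP n) hPU (subset_iUnion (fun n => g^[n] v₀) n)
  have h1 : Tendsto (fun n => 2 * f (g^[n + 1] v₀) - f (g^[n] v₀)) atTop (𝓝 (2 * L - L)) :=
    ((hlim.comp (tendsto_add_atTop_nat 1)).const_mul 2).sub hlim
  have h2 : f u ≤ 2 * L - L := ge_of_tendsto' h1 fun n => by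
    rw [Function.iterate_succ_apply']
    exact hg3 _ (hP n) u hu ((subset_iUnion (fun n => g^[n] v₀) n).trans hvu)
  linarith

theorem iUnion_mem_of_monotone {w : ℕ → Set G} (hw : Monotone w)
    (h : ∀ n, w n ∈ 𝒢.fullInverseSemigroup) : (⋃ n, w n) ∈ 𝒢.fullInverseSemigroup :=
  ⟨MeasurableSet.iUnion fun n => (h n).1,
    inj_on_iUnion_of_directed hw.directed_le fun n => (h n).2.1,
    inj_on_iUnion_of_directed hw.directed_le fun n => (h n).2.2⟩

theorem union_mem (hs : s ∈ 𝒢.fullInverseSemigroup) (ht : t ∈ 𝒢.fullInverseSemigroup)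
    (h1 : Disjoint (𝒢.src '' s) (𝒢.src '' t)) (h2 : Disjoint (𝒢.rng '' s) (𝒢.rng '' t)) :
    s ∪ t ∈ 𝒢.fullInverseSemigroup := by
  have hd : Disjoint s t := disjoint_left.2 fun g hg hg' =>
    disjoint_left.1 h1 (mem_image_of_mem _ hg) (mem_image_of_mem _ hg')
  refine ⟨hs.1.union ht.1, (injOn_union hd).2 ⟨hs.2.1, ht.2.1, fun a ha b hb e => ?_⟩,
    (injOn_union hd).2 ⟨hs.2.2, ht.2.2, fun a ha b hb e => ?_⟩⟩
  · exact disjoint_left.1 h1 (mem_image_of_mem _ ha) (e ▸ mem_image_of_mem _ hb)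
  · exact disjoint_left.1 h2 (mem_image_of_mem _ ha) (e ▸ mem_image_of_mem _ hb)

/-- Comparison of two sets of objects in an ergodic groupoid. -/
theorem IsErgodic.comparison (hG : 𝒢.IsErgodic) (hB : MeasurableSet B) (hC : MeasurableSet C) :
    ∃ w ∈ 𝒢.fullInverseSemigroup, 𝒢.src '' w ⊆ B ∧ 𝒢.rng '' w ⊆ C ∧
      (𝒢.μ (B \ 𝒢.src '' w) = 0 ∨ 𝒢.μ (C \ 𝒢.rng '' w) = 0) := by
  have := 𝒢.isProbabilityMeasure
  obtain ⟨w, ⟨hw, hwB, hwC⟩, hmax⟩ := Sofic.exists_maximal_of_bounded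
    (fun w => w ∈ 𝒢.fullInverseSemigroup ∧ 𝒢.src '' w ⊆ B ∧ 𝒢.rng '' w ⊆ C)
    (fun w => 𝒢.μ.real (𝒢.src '' w)) 1 (fun _ _ => measureReal_le_one)
    (fun u w _ _ h => measureReal_mono (image_mono h))
    (fun w hw h => ⟨iUnion_mem_of_monotone hw fun n => (h n).1, by
      rw [image_iUnion]; exact iUnion_subset fun n => (h n).2.1, by
      rw [image_iUnion]; exact iUnion_subset fun n => (h n).2.2⟩)
    (v₀ := ∅) (by simp [fullInverseSemigroup])
  refine ⟨w, hw, hwB, hwC, ?_⟩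
  by_contra! h
  obtain ⟨u, hu, huB, huC, hu0⟩ := hG.exists_bisection (hB.diff (measurableSet_src_image hw))
    (hC.diff (measurableSet_rng_image hw)) h.1 h.2
  have hd1 : Disjoint (𝒢.src '' w) (𝒢.src '' u) :=
    disjoint_left.2 fun x hx hx' => (huB hx').2 hx
  have hd2 : Disjoint (𝒢.rng '' w) (𝒢.rng '' u) :=
    disjoint_left.2 fun x hx hx' => (huC hx').2 hx
  have h1 := hmax (w ∪ u) ⟨union_mem hw hu hd1 hd2, by
    rw [image_union]; exact union_subset hwB (huB.trans sdiff_subset), by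
    rw [image_union]; exact union_subset hwC (huC.trans sdiff_subset)⟩ subset_union_left
  simp only [image_union] at h1
  rw [measureReal_union hd1 (measurableSet_src_image hu)] at h1
  have h2 : 0 < 𝒢.μ.real (𝒢.src '' u) := by
    rw [Measure.real, ENNReal.toReal_pos_iff]
    exact ⟨pos_iff_ne_zero.2 hu0, measure_lt_top _ _⟩
  linarith

/-- Each comparison of A with the remaining part of C either uses up A, and then removes exactly the
measure of A from C, or finishes C up to a null set. Hence the induction on a bound for the ratio of
the measures. -/
theorem IsErgodic.exists_cover (hG : 𝒢.IsErgodic) (hA : MeasurableSet A) (n : ℕ) :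
    ∀ C : Set X, MeasurableSet C → 𝒢.μ.real C ≤ n * 𝒢.μ.real A →
    ∃ k, ∃ w : Fin k → Set G, (∀ a, w a ∈ 𝒢.fullInverseSemigroup ∧ 𝒢.src '' w a ⊆ A ∧
      𝒢.rng '' w a ⊆ C) ∧ Pairwise (fun a b => Disjoint (𝒢.rng '' w a) (𝒢.rng '' w b)) ∧
      𝒢.μ (C \ ⋃ a, 𝒢.rng '' w a) = 0 := by
  have := 𝒢.isProbabilityMeasure
  induction n with
  | zero =>
    intro C hC h
    refine ⟨0, fun a => ∅, fun a => a.elim0, fun a => a.elim0, ?_⟩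
    have h0 : 𝒢.μ.real C = 0 := le_antisymm (by simpa using h) measureReal_nonneg
    rw [measureReal_eq_zero_iff] at h0
    exact measure_mono_null sdiff_subset h0
  | succ n ih =>
    intro C hC h
    obtain ⟨w, hw, hwA, hwC, h0 | h0⟩ := hG.comparison hA hC
    · have hwm := measurableSet_rng_image hw
      obtain ⟨k, v, hv, hvd, hv0⟩ := ih (C \ 𝒢.rng '' w) (hC.diff hwm) (by
        rw [measureReal_sdiff hwC hwm]
        have h1 : 𝒢.μ.real A = 𝒢.μ.real (𝒢.rng '' w) := by
          rw [Measure.real, Measure.real, ← measure_src_eq_rng hw]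
          congr 1
          refine le_antisymm ?_ (measure_mono hwA)
          calc 𝒢.μ A ≤ 𝒢.μ (𝒢.src '' w ∪ A \ 𝒢.src '' w) := measure_mono fun x hx => by
                by_cases h : x ∈ 𝒢.src '' w
                · exact Or.inl h
                · exact Or.inr ⟨hx, h⟩
            _ ≤ _ := measure_union_le _ _
            _ = 𝒢.μ (𝒢.src '' w) := by rw [h0, add_zero]
        push_cast at h
        linarith)
      refine ⟨k + 1, Fin.cons w v, ?_, ?_, ?_⟩
      · intro a
        refine Fin.cases ⟨hw, hwA, hwC⟩ (fun a => ?_) a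
        exact ⟨(hv a).1, (hv a).2.1, (hv a).2.2.trans sdiff_subset⟩
      · intro a b
        refine Fin.cases ?_ (fun a => ?_) a <;> refine Fin.cases ?_ (fun b => ?_) b
        · intro h; exact absurd rfl h
        · intro _
          exact disjoint_left.2 fun x hx hx' => ((hv b).2.2 hx').2 hx
        · intro _
          exact disjoint_left.2 fun x hx hx' => ((hv a).2.2 hx).2 hx'
        · intro hab
          exact @hvd a b fun e => hab (congrArg Fin.succ e)
      · convert hv0 using 2
        ext x
        simp [Fin.exists_fin_succ, not_or, and_assoc]
    · refine ⟨1, fun _ => w, fun a => ⟨hw, hwA, hwC⟩, fun a b hab => ?_, ?_⟩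
      · exact absurd (Subsingleton.elim a b) hab
      · rwa [iUnion_const]

/-- Partial isometries with domains in `A` and ranges a partition of the object space, up to null
sets; the first one is the identity of `A`. -/
structure IsTransversal (𝒢 : PmpGroupoid X G) (A : Set X) {k : ℕ} (w : Fin (k + 1) → Set G) :
    Prop where
  zero : w 0 = 𝒢.unitSet A
  mem : ∀ a, w a ∈ 𝒢.fullInverseSemigroup
  src_subset : ∀ a, 𝒢.src '' w a ⊆ A
  disjoint : Pairwise fun a b => Disjoint (𝒢.rng '' w a) (𝒢.rng '' w b)
  cover : 𝒢.μ (⋃ a, 𝒢.rng '' w a)ᶜ = 0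

theorem src_image_unitSet : 𝒢.src '' 𝒢.unitSet B = B := by
  simp [unitSet, image_image, 𝒢.src_one]

theorem rng_image_unitSet : 𝒢.rng '' 𝒢.unitSet B = B := by
  simp [unitSet, image_image, 𝒢.rng_one]

/-- Only the complement of A needs covering, because the unit over A serves as the zeroth element.
-/
theorem IsErgodic.exists_isTransversal (hG : 𝒢.IsErgodic) (hA : MeasurableSet A)
    (h0 : 𝒢.μ A ≠ 0) : ∃ k, ∃ w : Fin (k + 1) → Set G, 𝒢.IsTransversal A w := by
  have := 𝒢.isProbabilityMeasure
  have hpos : 0 < 𝒢.μ.real A := by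
    rw [Measure.real, ENNReal.toReal_pos_iff]
    exact ⟨pos_iff_ne_zero.2 h0, measure_lt_top _ _⟩
  obtain ⟨n, hn⟩ := exists_nat_ge (1 / 𝒢.μ.real A)
  obtain ⟨k, v, hv, hvd, hv0⟩ := hG.exists_cover hA n Aᶜ hA.compl
    (measureReal_le_one.trans ((div_le_iff₀ hpos).1 hn))
  refine ⟨k, Fin.cons (𝒢.unitSet A) v, rfl, ?_, ?_, ?_, ?_⟩
  · exact fun a => Fin.cases (unitSet_mem hA) (fun a => (hv a).1) a
  · exact fun a => Fin.cases src_image_unitSet.subset (fun a => (hv a).2.1) a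
  · intro a b
    refine Fin.cases ?_ (fun a => ?_) a <;> refine Fin.cases ?_ (fun b => ?_) b
    · intro h; exact absurd rfl h
    · intro _
      exact disjoint_left.2 fun x hx hx' => (hv b).2.2 hx' (rng_image_unitSet.subset hx)
    · intro _
      exact disjoint_left.2 fun x hx hx' => (hv a).2.2 hx (rng_image_unitSet.subset hx')
    · intro hab
      exact @hvd a b fun e => hab (congrArg Fin.succ e)
  · convert hv0 using 2
    ext x
    have : (∃ x_1, x_1 ∈ 𝒢.unitSet A ∧ 𝒢.rng x_1 = x) ↔ x ∈ A := by
      rw [← mem_image, rng_image_unitSet]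
    simp [Fin.forall_fin_succ, ← this]

end PmpGroupoid

/-! ### Pointwise consequences of asymptotic multiplicativity and trace preservation -/

namespace PmpGroupoid

variable {X : Type u} {G : Type v} [MeasurableSpace X] [MeasurableSpace G] {𝒢 : PmpGroupoid X G}

/-- An inverse subsemigroup of `[[G]]`. -/
structure IsInvSubsemigroup (𝒢 : PmpGroupoid X G) (K : Set (Set G)) : Prop where
  subset : K ⊆ 𝒢.fullInverseSemigroup
  mul : ∀ s ∈ K, ∀ t ∈ K, 𝒢.setMul s t ∈ K
  inv : ∀ s ∈ K, 𝒢.setInv s ∈ K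

open Sofic

variable {ι : Type*} {l : Filter ι} {N : ι → ℕ} {Y Z : ι → Type} [∀ i, Finite (Y i)]
  [∀ i, Finite (Z i)] {K : Set (Set G)} {σ : ∀ i, Set G → Y i ≃. Y i}

/-- A family of maps from `K` to partial permutations of finite sets that is asymptotically
multiplicative and trace preserving. -/
structure IsSofic (𝒢 : PmpGroupoid X G) (K : Set (Set G)) (l : Filter ι) (N : ι → ℕ)
    (σ : ∀ i, Set G → Y i ≃. Y i) : Prop where
  mul : ∀ s ∈ K, ∀ t ∈ K, ∀ᶠ z in ae l N Y,
    σ z.1 (𝒢.setMul s t) z.2 = (σ z.1 t z.2).bind (σ z.1 s)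
  tr : ∀ s ∈ K, Tendsto (dens N {z : Σ i, Y i | σ z.1 s z.2 = some z.2}) l (𝓝 (𝒢.trace s))

namespace IsSofic

variable {s t : Set G} {B C : Set X}

theorem mul_iff (h : 𝒢.IsSofic K l N σ) (hs : s ∈ K) (ht : t ∈ K) :
    ∀ᶠ z in ae l N Y, ∀ y, σ z.1 (𝒢.setMul s t) z.2 = some y ↔
      ∃ x, σ z.1 t z.2 = some x ∧ σ z.1 s x = some y := by
  filter_upwards [h.mul s hs t ht] with z hz y
  rw [hz, Option.bind_eq_some_iff]

/-- If z goes to y, multiplicativity for the idempotent forces y to go to y as well, and injectivity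
gives z = y. -/
theorem idem (h : 𝒢.IsSofic K l N σ) (hB : 𝒢.unitSet B ∈ K) :
    ∀ᶠ z in ae l N Y, ∀ y, σ z.1 (𝒢.unitSet B) z.2 = some y → y = z.2 := by
  have := h.mul_iff hB hB
  rw [unitSet_setMul_unitSet, inter_self] at this
  filter_upwards [this] with z hz y hy
  obtain ⟨x, hx, hxy⟩ := (hz y).1 hy
  have e : x = y := Option.some_injective _ (hx.symm.trans hy)
  subst e
  exact (σ z.1 _).inj hxy hx

theorem setInv_setMul_mem (hK : 𝒢.IsInvSubsemigroup K) (hs : s ∈ K) :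
    𝒢.unitSet (𝒢.src '' s) ∈ K := by
  rw [← setInv_setMul_self (hK.subset hs).2.2]
  exact hK.mul _ (hK.inv _ hs) _ hs

theorem setMul_setInv_mem (hK : 𝒢.IsInvSubsemigroup K) (hs : s ∈ K) :
    𝒢.unitSet (𝒢.rng '' s) ∈ K := by
  rw [← setMul_setInv_self (hK.subset hs).2.1]
  exact hK.mul _ hs _ (hK.inv _ hs)

/-- If `σ s` is defined at a point then so is the idempotent of the domain of `s`. -/
theorem unit_of_eq_some (h : 𝒢.IsSofic K l N σ) (hs : s ∈ K) (hB : 𝒢.unitSet B ∈ K)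
    (hsB : 𝒢.src '' s ⊆ B) : ∀ᶠ z in ae l N Y, ∀ y, σ z.1 s z.2 = some y →
      σ z.1 (𝒢.unitSet B) z.2 = some z.2 := by
  have e : 𝒢.setMul s (𝒢.unitSet B) = s := by
    rw [setMul_unitSet]
    ext g
    exact ⟨fun hg => hg.1, fun hg => ⟨hg, hsB (mem_image_of_mem _ hg)⟩⟩
  have := h.mul_iff hs hB
  rw [e] at this
  filter_upwards [this, h.idem hB] with z hz hi y hy
  obtain ⟨x, hx, -⟩ := (hz y).1 hy
  rw [hx, hi x hx]

/-- Inverses are not part of the hypotheses on σ. They come from s s⁻¹ being an idempotent whose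
image under σ fixes almost every point where the image of s⁻¹ is defined. -/
theorem inv_left (h : 𝒢.IsSofic K l N σ) (hK : 𝒢.IsInvSubsemigroup K) (hs : s ∈ K) :
    ∀ᶠ z in ae l N Y, ∀ y, σ z.1 (𝒢.setInv s) z.2 = some y → σ z.1 s y = some z.2 := by
  have hB := setMul_setInv_mem hK hs
  have h1 := h.unit_of_eq_some (hK.inv _ hs) hB (src_image_setInv).subset
  have h2 := h.mul_iff hs (hK.inv _ hs)
  rw [setMul_setInv_self (hK.subset hs).2.1] at h2
  filter_upwards [h1, h2] with z h1 h2 y hy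
  obtain ⟨x, hx, hxz⟩ := (h2 z.2).1 (h1 y hy)
  obtain rfl : x = y := Option.some_injective _ (hx.symm.trans hy)
  exact hxz

theorem inv_iff (h : 𝒢.IsSofic K l N σ) (hK : 𝒢.IsInvSubsemigroup K) (hs : s ∈ K) :
    ∀ᶠ z in ae l N Y, ∀ y, σ z.1 (𝒢.setInv s) z.2 = some y ↔ σ z.1 s y = some z.2 := by
  have h1 := h.inv_left hK (hK.inv _ hs)
  rw [setInv_setInv] at h1
  -- The converse is the same statement for s⁻¹, read at the preimage of z; pulling back along a
  -- partial bijection preserves negligible sets.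
  filter_upwards [h.inv_left hK hs, ae_pull (fun i => (σ i s).symm) h1] with z hz hz' y
  exact ⟨hz y, fun hy => hz' y ((σ z.1 s).eq_some_iff.2 hy) _ hy⟩

theorem unit_iff_isSome (h : 𝒢.IsSofic K l N σ) (hK : 𝒢.IsInvSubsemigroup K) (hs : s ∈ K) :
    ∀ᶠ z in ae l N Y, σ z.1 (𝒢.unitSet (𝒢.src '' s)) z.2 = some z.2 ↔
      ∃ y, σ z.1 s z.2 = some y := by
  have h1 := h.unit_of_eq_some hs (setInv_setMul_mem hK hs) Subset.rfl
  have h2 := h.mul_iff (hK.inv _ hs) hs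
  rw [setInv_setMul_self (hK.subset hs).2.2] at h2
  filter_upwards [h1, h2] with z h1 h2
  refine ⟨fun hz => ?_, fun ⟨y, hy⟩ => h1 y hy⟩
  obtain ⟨x, hx, -⟩ := (h2 _).1 hz
  exact ⟨x, hx⟩

/-- Trace preservation controls the fixed points of the idempotent s⁻¹ s, and these are almost
exactly the points where the image of s is defined. -/
theorem dens_dom (h : 𝒢.IsSofic K l N σ) (hK : 𝒢.IsInvSubsemigroup K) (hs : s ∈ K) :
    Tendsto (dens N {z : Σ i, Y i | ∃ y, σ z.1 s z.2 = some y}) l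
      (𝓝 (𝒢.μ.real (𝒢.src '' s))) := by
  have h1 := h.tr _ (setInv_setMul_mem hK hs)
  rw [trace_unitSet] at h1
  exact dens_tendsto_of_ae_iff (h.unit_iff_isSome hK hs) h1

theorem null (h : 𝒢.IsSofic K l N σ) (hK : 𝒢.IsInvSubsemigroup K) (hs : s ∈ K)
    (h0 : 𝒢.μ (𝒢.src '' s) = 0) : ∀ᶠ z in ae l N Y, ∀ y, σ z.1 s z.2 ≠ some y := by
  have h1 := h.dens_dom hK hs
  rw [Measure.real, h0, ENNReal.toReal_zero, ← ae_not_mem_iff] at h1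
  filter_upwards [h1] with z hz y hy
  exact hz ⟨y, hy⟩

/-- A subset t of s is the product of s with the idempotent of the domain of t. -/
theorem of_subset (h : 𝒢.IsSofic K l N σ) (hK : 𝒢.IsInvSubsemigroup K) (hs : s ∈ K) (ht : t ∈ K)
    (hts : t ⊆ s) : ∀ᶠ z in ae l N Y, ∀ y, σ z.1 t z.2 = some y → σ z.1 s z.2 = some y := by
  have hB := setInv_setMul_mem hK ht
  have e : 𝒢.setMul s (𝒢.unitSet (𝒢.src '' t)) = t := by
    rw [setMul_unitSet]
    ext g
    constructor
    · rintro ⟨hg, g', hg', e⟩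
      rwa [← (hK.subset hs).2.1 (hts hg') hg e]
    · exact fun hg => ⟨hts hg, mem_image_of_mem _ hg⟩
  have h1 := h.mul_iff hs hB
  rw [e] at h1
  filter_upwards [h1, h.idem hB] with z h1 h2 y hy
  obtain ⟨x, hx, hxy⟩ := (h1 y).1 hy
  rwa [h2 x hx] at hxy

theorem disjoint_src (h : 𝒢.IsSofic K l N σ) (hK : 𝒢.IsInvSubsemigroup K) (hs : s ∈ K)
    (ht : t ∈ K) (hd : Disjoint (𝒢.src '' s) (𝒢.src '' t)) :
    ∀ᶠ z in ae l N Y, ∀ y y', σ z.1 s z.2 = some y → σ z.1 t z.2 ≠ some y' := by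
  have hs' := setInv_setMul_mem hK hs
  have ht' := setInv_setMul_mem hK ht
  have h1 := h.mul_iff hs' ht'
  have h2 := h.null hK (hK.mul _ hs' _ ht') (by
    rw [unitSet_setMul_unitSet, disjoint_iff_inter_eq_empty.1 hd]; simp [unitSet])
  filter_upwards [h1, h2, h.unit_of_eq_some hs hs' Subset.rfl,
    h.unit_of_eq_some ht ht' Subset.rfl] with z h1 h2 h3 h4 y y' hy hy'
  exact h2 z.2 ((h1 z.2).2 ⟨z.2, h4 y' hy', h3 y hy⟩)

theorem disjoint_rng (h : 𝒢.IsSofic K l N σ) (hK : 𝒢.IsInvSubsemigroup K) (hs : s ∈ K)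
    (ht : t ∈ K) (hd : Disjoint (𝒢.rng '' s) (𝒢.rng '' t)) :
    ∀ᶠ z in ae l N Y, ∀ y y', σ z.1 s y = some z.2 → σ z.1 t y' ≠ some z.2 := by
  filter_upwards [h.inv_iff hK hs, h.inv_iff hK ht, h.disjoint_src hK (hK.inv _ hs) (hK.inv _ ht)
    (by rwa [src_image_setInv, src_image_setInv])] with z h1 h2 h3 y y' hy hy'
  exact h3 y y' ((h1 y).2 hy) ((h2 y').2 hy')

/-- A decomposition of an element of `K`, up to null sets, is respected by `σ`. -/
theorem decomp (h : 𝒢.IsSofic K l N σ) (hK : 𝒢.IsInvSubsemigroup K) (hs : s ∈ K)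
    {κ : Type*} [Fintype κ] {p : κ → Set G} (hp : ∀ k, p k ∈ K) (hps : ∀ k, p k ⊆ s)
    (hd : Pairwise fun k k' => Disjoint (𝒢.src '' p k) (𝒢.src '' p k'))
    (hsum : ∑ k, 𝒢.μ.real (𝒢.src '' p k) = 𝒢.μ.real (𝒢.src '' s)) :
    ∀ᶠ z in ae l N Y, ∀ y, σ z.1 s z.2 = some y ↔ ∃ k, σ z.1 (p k) z.2 = some y := by
  have h1 := dens_iUnion_tendsto (N := N) (l := l)
    (fun k => {z : Σ i, Y i | ∃ y, σ z.1 (p k) z.2 = some y}) _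
    (fun k => h.dens_dom hK (hp k)) (fun k k' hkk' => by
      filter_upwards [h.disjoint_src hK (hp k) (hp k') (hd hkk')] with z hz
      rintro ⟨y, hy⟩ ⟨y', hy'⟩
      exact hz y y' hy hy')
  rw [hsum] at h1
  have h2 : ∀ᶠ z in ae l N Y, ∀ k, ∀ y, σ z.1 (p k) z.2 = some y → σ z.1 s z.2 = some y :=
    Filter.eventually_all.2 fun k => h.of_subset hK hs (hp k) (hps k)
  -- The domains of the pieces lie in the domain of s, are almost disjoint and have the same total
  -- density, so they leave only a negligible remainder.
  have h3 := ae_of_dens_eq (by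
    filter_upwards [h2] with z hz hz'
    obtain ⟨k, y, hy⟩ := mem_iUnion.1 hz'
    exact ⟨y, hz k y hy⟩) h1 (h.dens_dom hK hs)
  filter_upwards [h2, h3] with z h2 h3 y
  refine ⟨fun hy => ?_, fun ⟨k, hk⟩ => h2 k y hk⟩
  obtain ⟨k, y', hy'⟩ := mem_iUnion.1 (h3 ⟨y, hy⟩)
  have := h2 k y' hy'
  rw [hy] at this
  exact ⟨k, hy'.trans this.symm⟩

/-- Transport along a family of partial bijections whose ranges almost contain the support. -/
theorem transport (h : 𝒢.IsSofic K l N σ) (hK : 𝒢.IsInvSubsemigroup K) (j : ∀ i, Z i ≃. Y i)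
    (hj : ∀ s ∈ K, ∀ᶠ z in ae l N Y, ∀ y, σ z.1 s z.2 = some y → ∃ x, j z.1 x = some z.2) :
    𝒢.IsSofic K l N (fun i s => (j i).trans ((σ i s).trans (j i).symm)) := by
  -- The hypothesis speaks of domains; applied to s⁻¹ it covers ranges.
  have hj' : ∀ s ∈ K, ∀ᶠ z in ae l N Y, ∀ y, σ z.1 s z.2 = some y → ∃ x, j z.1 x = some y := by
    intro s hs
    filter_upwards [ae_pull (fun i => σ i s) (hj _ (hK.inv _ hs)),
      ae_pull (fun i => σ i s) (h.inv_iff hK hs)] with z h1 h2 y hy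
    exact h1 y hy z.2 ((h2 y hy z.2).2 hy)
  refine ⟨fun s hs t ht => ?_, fun s hs => ?_⟩
  · filter_upwards [ae_pull j (h.mul_iff hs ht), ae_pull j (hj' t ht)] with x h1 h2
    ext y
    simp only [PEquiv.trans_eq_some, Option.bind_eq_some_iff, PEquiv.eq_some_iff]
    constructor
    · rintro ⟨z, hz, w, hw, hwy⟩
      obtain ⟨v, hv, hvw⟩ := (h1 z hz w).1 hw
      obtain ⟨u, hu⟩ := h2 z hz v hv
      exact ⟨u, ⟨z, hz, v, hv, hu⟩, v, hu, w, hvw, hwy⟩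
    · rintro ⟨u, ⟨z, hz, v, hv, hu⟩, v', hv', w, hw, hwy⟩
      obtain rfl : v' = v := Option.some_injective _ (hv'.symm.trans hu)
      exact ⟨z, hz, w, (h1 z hz w).2 ⟨v', hv, hw⟩, hwy⟩
  · have h1 := dens_transfer j (h.tr s hs) (by
      filter_upwards [hj s hs] with z hz hz'
      exact hz _ hz')
    convert h1 using 2
    ext x
    simp only [PEquiv.trans_eq_some, PEquiv.eq_some_iff]
    constructor
    · rintro ⟨z, hz, w, hw, hwx⟩
      obtain rfl : z = w := Option.some_injective _ (hz.symm.trans hwx)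
      exact ⟨z, hz, hw⟩
    · rintro ⟨z, hz, hw⟩
      exact ⟨z, hz, z, hw, hz⟩

end IsSofic

end PmpGroupoid

/-! ### Matrix entries over a transversal -/

namespace PmpGroupoid

variable {X : Type u} {G : Type v} [MeasurableSpace X] [MeasurableSpace G] {𝒢 : PmpGroupoid X G}
  {A : Set X} {k : ℕ} {w : Fin (k + 1) → Set G} {s t : Set G}

theorem IsInvSubsemigroup.fullInverseSemigroup :
    𝒢.IsInvSubsemigroup 𝒢.fullInverseSemigroup :=
  ⟨Subset.rfl, fun _ hs _ ht => setMul_mem hs ht, fun _ hs => setInv_mem hs⟩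

/-- The elements of `[[G]]` supported in the corner over `A`. -/
def cornerSemigroup (𝒢 : PmpGroupoid X G) (A : Set X) : Set (Set G) :=
  {s | s ∈ 𝒢.fullInverseSemigroup ∧ 𝒢.src '' s ⊆ A ∧ 𝒢.rng '' s ⊆ A}

theorem IsInvSubsemigroup.cornerSemigroup : 𝒢.IsInvSubsemigroup (𝒢.cornerSemigroup A) := by
  refine ⟨fun s hs => hs.1, fun s hs t ht => ⟨setMul_mem hs.1 ht.1, ?_, ?_⟩, fun s hs => ⟨setInv_mem hs.1, ?_, ?_⟩⟩
  · rintro _ ⟨_, ⟨g, hg, h, hh, e, rfl⟩, rfl⟩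
    rw [𝒢.src_mul]
    exact ht.2.1 (mem_image_of_mem _ hh)
  · rintro _ ⟨_, ⟨g, hg, h, hh, e, rfl⟩, rfl⟩
    rw [𝒢.rng_mul]
    exact hs.2.2 (mem_image_of_mem _ hg)
  · rw [src_image_setInv]; exact hs.2.2
  · rw [rng_image_setInv]; exact hs.2.1

/-- The `(a, b)` entry of `s` with respect to a family of partial isometries. -/
def block (𝒢 : PmpGroupoid X G) (w : Fin (k + 1) → Set G) (s : Set G) (a b : Fin (k + 1)) : Set G :=
  𝒢.setMul (𝒢.setInv (w a)) (𝒢.setMul s (w b))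

namespace IsTransversal

theorem block_mem (hw : 𝒢.IsTransversal A w) (hs : s ∈ 𝒢.fullInverseSemigroup)
    (a b : Fin (k + 1)) : 𝒢.block w s a b ∈ 𝒢.cornerSemigroup A := by
  refine ⟨setMul_mem (setInv_mem (hw.mem a)) (setMul_mem hs (hw.mem b)), ?_, ?_⟩
  · rintro _ ⟨_, ⟨g, hg, _, ⟨h', hh', h, hh, e', rfl⟩, e, rfl⟩, rfl⟩
    rw [𝒢.src_mul, 𝒢.src_mul]
    exact hw.src_subset b (mem_image_of_mem _ hh)
  · rintro _ ⟨_, ⟨_, ⟨g, hg, rfl⟩, h, hh, e, rfl⟩, rfl⟩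
    rw [𝒢.rng_mul, 𝒢.rng_inv]
    exact hw.src_subset a (mem_image_of_mem _ hg)

theorem sum_measure_inter (hw : 𝒢.IsTransversal A w) (D : Set X) :
    ∑ a, 𝒢.μ.real (D ∩ 𝒢.rng '' w a) = 𝒢.μ.real D := by
  have := 𝒢.isProbabilityMeasure
  have h1 : 𝒢.μ (D ∩ ⋃ a, 𝒢.rng '' w a) = 𝒢.μ D :=
    measure_inter_conull' (measure_mono_null (fun x hx => hx.2) hw.cover)
  have h2 : 𝒢.μ (D ∩ ⋃ a, 𝒢.rng '' w a) = ∑ a, 𝒢.μ (D ∩ 𝒢.rng '' w a) := by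
    have hm := fun a => measurableSet_rng_image (hw.mem a)
    rw [inter_comm, ← Measure.restrict_apply (MeasurableSet.iUnion hm),
      measure_iUnion hw.disjoint hm, tsum_fintype]
    exact Finset.sum_congr rfl fun a _ => by rw [Measure.restrict_apply (hm a), inter_comm]
  rw [Measure.real, ← h1, h2, ENNReal.toReal_sum fun a _ => measure_ne_top _ _]
  rfl

theorem measure_src (hw : 𝒢.IsTransversal A w) (a : Fin (k + 1)) :
    𝒢.μ.real (𝒢.src '' w a) = 𝒢.μ.real (𝒢.rng '' w a) := by
  rw [Measure.real, measure_src_eq_rng (hw.mem a), Measure.real]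

theorem sum_measure_src (hw : 𝒢.IsTransversal A w) : ∑ a, 𝒢.μ.real (𝒢.src '' w a) = 1 := by
  have := 𝒢.isProbabilityMeasure
  have := hw.sum_measure_inter univ
  simp only [univ_inter, probReal_univ] at this
  rw [← this]
  exact Finset.sum_congr rfl fun a _ => hw.measure_src a

theorem setMul_setInv (hw : 𝒢.IsTransversal A w) (a : Fin (k + 1)) :
    𝒢.setMul (w a) (𝒢.setInv (w a)) = 𝒢.unitSet (𝒢.rng '' w a) :=
  setMul_setInv_self (hw.mem a).2.1

theorem setInv_setMul (hw : 𝒢.IsTransversal A w) (a : Fin (k + 1)) :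
    𝒢.setMul (𝒢.setInv (w a)) (w a) = 𝒢.unitSet (𝒢.src '' w a) :=
  setInv_setMul_self (hw.mem a).2.2

/-- Reassembling `s` from its entries. -/
theorem setMul_block_setMul (hw : 𝒢.IsTransversal A w) (s : Set G) (a b : Fin (k + 1)) :
    𝒢.setMul (w a) (𝒢.setMul (𝒢.block w s a b) (𝒢.setInv (w b))) =
      (s ∩ 𝒢.src ⁻¹' (𝒢.rng '' w b)) ∩ 𝒢.rng ⁻¹' (𝒢.rng '' w a) := by
  have : 𝒢.setMul (w a) (𝒢.setMul (𝒢.block w s a b) (𝒢.setInv (w b))) =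
      𝒢.setMul (𝒢.setMul (w a) (𝒢.setInv (w a)))
        (𝒢.setMul s (𝒢.setMul (w b) (𝒢.setInv (w b)))) := by
    simp only [block, setMul_assoc]
  rw [this, hw.setMul_setInv, hw.setMul_setInv, unitSet_setMul, setMul_unitSet]
  rfl

/-- Cut the domain of s along the ranges of the w_b, move to ranges by invariance of the measure,
and cut again along the ranges of the w_a. -/
theorem sum_measure_piece (hw : 𝒢.IsTransversal A w) (hs : s ∈ 𝒢.fullInverseSemigroup) :
    ∑ p : Fin (k + 1) × Fin (k + 1), 𝒢.μ.real (𝒢.src ''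
      ((s ∩ 𝒢.src ⁻¹' (𝒢.rng '' w p.2)) ∩ 𝒢.rng ⁻¹' (𝒢.rng '' w p.1))) =
      𝒢.μ.real (𝒢.src '' s) := by
  have hm := fun a => measurableSet_rng_image (hw.mem a)
  rw [Fintype.sum_prod_type_right, ← hw.sum_measure_inter (𝒢.src '' s)]
  refine Finset.sum_congr rfl fun b _ => ?_
  have hsb := inter_src_mem hs (hm b)
  have : 𝒢.μ.real (𝒢.src '' s ∩ 𝒢.rng '' w b) =
      𝒢.μ.real (𝒢.rng '' (s ∩ 𝒢.src ⁻¹' (𝒢.rng '' w b))) := by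
    rw [← image_inter_preimage, Measure.real, measure_src_eq_rng hsb, Measure.real]
  rw [this, ← hw.sum_measure_inter]
  refine Finset.sum_congr rfl fun a _ => ?_
  rw [Measure.real, measure_src_eq_rng (inter_rng_mem hsb (hm a)), image_inter_preimage,
    Measure.real]

theorem disjoint_piece (hw : 𝒢.IsTransversal A w) (hs : s ∈ 𝒢.fullInverseSemigroup) :
    Pairwise fun p q : Fin (k + 1) × Fin (k + 1) => Disjoint
      (𝒢.src '' ((s ∩ 𝒢.src ⁻¹' (𝒢.rng '' w p.2)) ∩ 𝒢.rng ⁻¹' (𝒢.rng '' w p.1)))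
      (𝒢.src '' ((s ∩ 𝒢.src ⁻¹' (𝒢.rng '' w q.2)) ∩ 𝒢.rng ⁻¹' (𝒢.rng '' w q.1))) := by
  rintro ⟨a, b⟩ ⟨a', b'⟩ hne
  rw [disjoint_left]
  rintro _ ⟨g, ⟨⟨hg, hgb⟩, hga⟩, rfl⟩ ⟨g', ⟨⟨hg', hgb'⟩, hga'⟩, e⟩
  obtain rfl := hs.2.1 hg' hg e
  apply hne
  congr 1
  · by_contra h
    exact disjoint_left.1 (hw.disjoint h) hga hga'
  · by_contra h
    exact disjoint_left.1 (hw.disjoint h) hgb hgb'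

/-- The entries of a product. -/
theorem block_setMul_block (hw : 𝒢.IsTransversal A w) (s t : Set G) (a b c : Fin (k + 1)) :
    𝒢.setMul (𝒢.block w s a c) (𝒢.block w t c b) =
      𝒢.setMul (𝒢.setMul (𝒢.setInv (w a)) s)
        (𝒢.setMul t (w b) ∩ 𝒢.rng ⁻¹' (𝒢.rng '' w c)) := by
  have : 𝒢.setMul (𝒢.block w s a c) (𝒢.block w t c b) =
      𝒢.setMul (𝒢.setMul (𝒢.setInv (w a)) s)
        (𝒢.setMul (𝒢.setMul (w c) (𝒢.setInv (w c))) (𝒢.setMul t (w b))) := by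
    simp only [block, setMul_assoc]
  rw [this, hw.setMul_setInv, unitSet_setMul]
  rfl

theorem block_setMul_block_subset (hw : 𝒢.IsTransversal A w) (s t : Set G)
    (a b c : Fin (k + 1)) :
    𝒢.setMul (𝒢.block w s a c) (𝒢.block w t c b) ⊆ 𝒢.block w (𝒢.setMul s t) a b := by
  rw [hw.block_setMul_block]
  refine (setMul_mono Subset.rfl inter_subset_left).trans ?_
  simp only [block, setMul_assoc]
  exact Subset.rfl

theorem disjoint_block_setMul_block (hw : 𝒢.IsTransversal A w)
    (ht : t ∈ 𝒢.fullInverseSemigroup) (a b : Fin (k + 1)) :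
    Pairwise fun c c' => Disjoint
      (𝒢.src '' 𝒢.setMul (𝒢.block w s a c) (𝒢.block w t c b))
      (𝒢.src '' 𝒢.setMul (𝒢.block w s a c') (𝒢.block w t c' b)) := by
  intro c c' hc
  have key : ∀ c, 𝒢.src '' 𝒢.setMul (𝒢.block w s a c) (𝒢.block w t c b) ⊆
      𝒢.src '' (𝒢.setMul t (w b) ∩ 𝒢.rng ⁻¹' (𝒢.rng '' w c)) := fun c => by
    rw [hw.block_setMul_block, src_image_setMul]
    exact image_mono inter_subset_left
  refine Disjoint.mono (key c) (key c') (disjoint_left.2 ?_)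
  rintro _ ⟨g, ⟨hg, hgc⟩, rfl⟩ ⟨g', ⟨hg', hgc'⟩, e⟩
  obtain rfl := (setMul_mem ht (hw.mem b)).2.1 hg' hg e
  exact disjoint_left.1 (hw.disjoint hc) hgc hgc'

/-- The index c records in which range of the transversal the intermediate point lies. These ranges
exhaust almost everything, so the products of entries account for the whole entry of s t, as in
matrix multiplication. -/
theorem sum_measure_block_setMul_block (hw : 𝒢.IsTransversal A w)
    (hs : s ∈ 𝒢.fullInverseSemigroup) (ht : t ∈ 𝒢.fullInverseSemigroup) (a b : Fin (k + 1)) :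
    ∑ c, 𝒢.μ.real (𝒢.src '' 𝒢.setMul (𝒢.block w s a c) (𝒢.block w t c b)) =
      𝒢.μ.real (𝒢.src '' 𝒢.block w (𝒢.setMul s t) a b) := by
  have hm := fun a => measurableSet_rng_image (hw.mem a)
  have hu := setMul_mem (setInv_mem (hw.mem a)) hs
  have hr := setMul_mem ht (hw.mem b)
  have e : 𝒢.block w (𝒢.setMul s t) a b =
      𝒢.setMul (𝒢.setMul (𝒢.setInv (w a)) s) (𝒢.setMul t (w b)) := by
    simp only [block, setMul_assoc]
  rw [e, Measure.real, measure_src_setMul hu hr, ← Measure.real,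
    ← hw.sum_measure_inter (_ ∩ _)]
  refine Finset.sum_congr rfl fun c _ => ?_
  rw [hw.block_setMul_block, Measure.real, measure_src_setMul hu (inter_rng_mem hr (hm c)),
    image_inter_preimage, Measure.real, inter_right_comm]

theorem disjoint_src_block (hw : 𝒢.IsTransversal A w) (hs : s ∈ 𝒢.fullInverseSemigroup)
    {a a' : Fin (k + 1)} (h : a ≠ a') (b : Fin (k + 1)) :
    Disjoint (𝒢.src '' 𝒢.block w s a b) (𝒢.src '' 𝒢.block w s a' b) := by
  rw [block, block, src_image_setMul, src_image_setMul, src_image_setInv, src_image_setInv,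
    disjoint_left]
  rintro _ ⟨g, ⟨hg, hga⟩, rfl⟩ ⟨g', ⟨hg', hga'⟩, e⟩
  obtain rfl := (setMul_mem hs (hw.mem b)).2.1 hg' hg e
  exact disjoint_left.1 (hw.disjoint h) hga hga'

theorem setInv_block (w : Fin (k + 1) → Set G) (s : Set G) (a b : Fin (k + 1)) :
    𝒢.setInv (𝒢.block w s a b) = 𝒢.block w (𝒢.setInv s) b a := by
  simp only [block, PmpGroupoid.setInv_setMul, setInv_setInv, setMul_assoc]

theorem disjoint_rng_block (hw : 𝒢.IsTransversal A w) (hs : s ∈ 𝒢.fullInverseSemigroup)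
    {b b' : Fin (k + 1)} (h : b ≠ b') (a : Fin (k + 1)) :
    Disjoint (𝒢.rng '' 𝒢.block w s a b) (𝒢.rng '' 𝒢.block w s a b') := by
  rw [← src_image_setInv, ← src_image_setInv, setInv_block, setInv_block]
  exact hw.disjoint_src_block (setInv_mem hs) h a

/-- The diagonal entry at a sees exactly the fixed points of s in the range of w_a, by `trace_conj`.
-/
theorem sum_trace_block (hw : 𝒢.IsTransversal A w) (hs : s ∈ 𝒢.fullInverseSemigroup) :
    ∑ a, 𝒢.trace (𝒢.block w s a a) = 𝒢.trace s := by
  conv_rhs => rw [trace, ← hw.sum_measure_inter]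
  exact Finset.sum_congr rfl fun a _ => by rw [block, trace_conj (hw.mem a) hs, inter_comm]

theorem src_block_subset (w : Fin (k + 1) → Set G) (s : Set G) (a b : Fin (k + 1)) :
    𝒢.src '' 𝒢.block w s a b ⊆ 𝒢.src '' w b := by
  rintro _ ⟨_, ⟨g, hg, _, ⟨h', hh', h, hh, e', rfl⟩, e, rfl⟩, rfl⟩
  rw [𝒢.src_mul, 𝒢.src_mul]
  exact mem_image_of_mem _ hh

theorem unitSet_mem (hw : 𝒢.IsTransversal A w) (a : Fin (k + 1)) :
    𝒢.unitSet (𝒢.src '' w a) ∈ 𝒢.cornerSemigroup A := by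
  refine ⟨PmpGroupoid.unitSet_mem (measurableSet_src_image (hw.mem a)), ?_, ?_⟩
  · rw [src_image_unitSet]; exact hw.src_subset a
  · rw [rng_image_unitSet]; exact hw.src_subset a

theorem src_zero (hw : 𝒢.IsTransversal A w) : 𝒢.src '' w 0 = A := by
  rw [hw.zero, src_image_unitSet]

theorem measurableSet (hw : 𝒢.IsTransversal A w) : MeasurableSet A := by
  rw [← hw.src_zero]; exact measurableSet_src_image (hw.mem 0)

theorem setMul_zero (hw : 𝒢.IsTransversal A w) (hs : 𝒢.src '' s ⊆ A) :
    𝒢.setMul s (w 0) = s := by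
  rw [hw.zero, setMul_unitSet]
  ext g
  exact ⟨fun hg => hg.1, fun hg => ⟨hg, hs (mem_image_of_mem _ hg)⟩⟩

theorem block_zero_zero (hw : 𝒢.IsTransversal A w) (hs : s ∈ 𝒢.cornerSemigroup A) :
    𝒢.block w s 0 0 = s := by
  have h1 : 𝒢.setMul (𝒢.setInv s) (w 0) = 𝒢.setInv s :=
    hw.setMul_zero (by rw [src_image_setInv]; exact hs.2.2)
  have h2 := congrArg 𝒢.setInv h1
  rw [PmpGroupoid.setInv_setMul, setInv_setInv] at h2
  rw [block, hw.setMul_zero hs.2.1, h2]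

theorem block_self_zero (hw : 𝒢.IsTransversal A w) (a : Fin (k + 1)) :
    𝒢.block w (w a) a 0 = 𝒢.unitSet (𝒢.src '' w a) := by
  rw [block, hw.setMul_zero (hw.src_subset a), hw.setInv_setMul]

end IsTransversal

end PmpGroupoid

/-! ### Matchings and finite products at the level of densities -/

namespace Sofic

/-- A partial bijection from `S` to `T` whose domain is as large as possible. -/
noncomputable def matching {α β : Type*} [Finite α] [Finite β] (S : Set α) (T : Set β) : α ≃. β :=
  (exists_matching S T).choose

theorem matching_mem {α β : Type*} [Finite α] [Finite β] {S : Set α} {T : Set β} {x : α} {y : β}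
    (h : matching S T x = some y) : x ∈ S ∧ y ∈ T :=
  (exists_matching S T).choose_spec.1 x y h

theorem ncard_matching {α β : Type*} [Finite α] [Finite β] (S : Set α) (T : Set β) :
    {x | ∃ y, matching S T x = some y}.ncard = min S.ncard T.ncard :=
  (exists_matching S T).choose_spec.2

section

variable {ι : Type*} {l : Filter ι} {N : ι → ℕ} {Y Z : ι → Type} [∀ i, Finite (Y i)]
  [∀ i, Finite (Z i)]

/-- The matching of two families of sets. -/
noncomputable def matchings (S : Set (Σ i, Y i)) (T : Set (Σ i, Z i)) (i : ι) : Y i ≃. Z i :=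
  matching {y | ⟨i, y⟩ ∈ S} {z | ⟨i, z⟩ ∈ T}

variable {S : Set (Σ i, Y i)} {T : Set (Σ i, Z i)} {c : ℝ}

theorem dens_matchings (hS : Tendsto (dens N S) l (𝓝 c)) (hT : Tendsto (dens N T) l (𝓝 c)) :
    Tendsto (dens N {y : Σ i, Y i | ∃ z, matchings S T y.1 y.2 = some z}) l (𝓝 c) := by
  have := hS.min hT
  rw [min_self] at this
  refine this.congr fun i => ?_
  have h1 := ncard_matching {y | (⟨i, y⟩ : Σ i, Y i) ∈ S} {z | (⟨i, z⟩ : Σ i, Z i) ∈ T}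
  unfold dens
  rw [min_div_div_right (Nat.cast_nonneg _), ← Nat.cast_min, ← h1]
  rfl

theorem ae_matchings_left (hS : Tendsto (dens N S) l (𝓝 c)) (hT : Tendsto (dens N T) l (𝓝 c)) :
    ∀ᶠ y in ae l N Y, y ∈ S → ∃ z, matchings S T y.1 y.2 = some z :=
  ae_of_dens_eq (Eventually.of_forall fun _ ⟨_, hz⟩ => (matching_mem hz).1)
    (dens_matchings hS hT) hS

theorem ae_matchings_right (hS : Tendsto (dens N S) l (𝓝 c)) (hT : Tendsto (dens N T) l (𝓝 c)) :
    ∀ᶠ z in ae l N Z, z ∈ T → ∃ y, matchings S T z.1 y = some z.2 := by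
  have h1 := dens_transfer (fun i => (matchings S T i).symm) (dens_matchings hS hT)
    (Eventually.of_forall fun y ⟨z, hz⟩ => ⟨z, (PEquiv.eq_some_iff _).2 hz⟩)
  have h2 := ae_of_dens_eq (Eventually.of_forall fun z => ?_) h1 hT
  · filter_upwards [h2] with z hz hzT
    obtain ⟨y, hy, -⟩ := hz hzT
    exact ⟨y, (PEquiv.eq_some_iff _).1 hy⟩
  · rintro ⟨y, hy, -⟩
    exact (matching_mem ((PEquiv.eq_some_iff _).1 hy)).2

/-- The inclusion of a slice of a product. -/
def slice {κ α : Type*} [DecidableEq κ] (b : κ) : α ≃. κ × α where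
  toFun y := some (b, y)
  invFun z := if z.1 = b then some z.2 else none
  inv := by
    rintro y ⟨a, z⟩
    rcases eq_or_ne a b with rfl | h
    · simp [eq_comm]
    · simp [h, h.symm]

@[simp] theorem slice_apply {κ α : Type*} [DecidableEq κ] (b : κ) (y : α) :
    slice b y = some (b, y) := rfl

theorem slice_symm_eq_some {κ α : Type*} [DecidableEq κ] {b : κ} {z : κ × α} {y : α} :
    (slice b).symm z = some y ↔ (b, y) = z := by
  rw [PEquiv.eq_some_iff, slice_apply, Option.some_inj]

theorem ae_prod {κ : Type} [Fintype κ] {P : (Σ i, κ × Y i) → Prop}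
    (h : ∀ b, ∀ᶠ y in ae l N Y, P ⟨y.1, (b, y.2)⟩) : ∀ᶠ z in ae l N (fun i => κ × Y i), P z := by
  classical
  have h1 : ∀ b : κ, ∀ᶠ z in ae l N (fun i => κ × Y i), ∀ y,
      (slice b).symm z.2 = some y → P ⟨z.1, (b, y)⟩ := fun b =>
    ae_pull (P := fun y => P ⟨y.1, (b, y.2)⟩) (fun i => (slice (α := Y i) b).symm) (h b)
  filter_upwards [Filter.eventually_all.2 h1] with ⟨i, b, y⟩ hz
  exact hz b y (slice_symm_eq_some.2 rfl)

theorem ae_slice {κ : Type} [Finite κ] {P : (Σ i, κ × Y i) → Prop}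
    (h : ∀ᶠ z in ae l N (fun i => κ × Y i), P z) (b : κ) :
    ∀ᶠ y in ae l N Y, P ⟨y.1, (b, y.2)⟩ := by
  classical
  filter_upwards [ae_pull (fun i => slice b) h] with y hy
  exact hy _ rfl

/-- The normalization N is not multiplied by the number of slices, so the densities of the slices
add up. -/
theorem dens_prod {κ : Type} [Fintype κ] {S : Set (Σ i, κ × Y i)} {c : κ → ℝ}
    (h : ∀ b, Tendsto (dens N {y : Σ i, Y i | (⟨y.1, (b, y.2)⟩ : Σ i, κ × Y i) ∈ S}) l (𝓝 (c b))) :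
    Tendsto (dens N S) l (𝓝 (∑ b, c b)) := by
  classical
  have h1 := fun b => dens_transfer (fun i => (slice (α := Y i) b).symm) (h b)
    (Eventually.of_forall fun y _ => ⟨(b, y.2), slice_symm_eq_some.2 rfl⟩)
  have h2 := dens_iUnion_tendsto (N := N) (l := l) _ c h1 (fun b b' hb => by
    refine Eventually.of_forall fun z => ?_
    rintro ⟨y, hy, -⟩ ⟨y', hy', -⟩
    rw [slice_symm_eq_some] at hy hy'
    exact hb (congrArg Prod.fst (hy.trans hy'.symm)))
  convert h2 using 2
  ext ⟨i, b, y⟩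
  simp only [mem_iUnion]
  constructor
  · exact fun h => ⟨b, y, slice_symm_eq_some.2 rfl, h⟩
  · rintro ⟨b', y', h, h'⟩
    rw [slice_symm_eq_some] at h
    have h' : (⟨i, (b', y')⟩ : Σ i, κ × Y i) ∈ S := h'
    rwa [h] at h'

end

end Sofic

/-! ### Passing between approximations of the corner and of the groupoid -/

namespace PmpGroupoid

open Sofic

variable {X : Type u} {G : Type v} [MeasurableSpace X] [MeasurableSpace G] {𝒢 : PmpGroupoid X G}
  {A : Set X} {k : ℕ} {w : Fin (k + 1) → Set G} {s t : Set G}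
  {ι : Type*} {l : Filter ι} {N : ι → ℕ} {Y Z : ι → Type} [∀ i, Finite (Y i)]
  [∀ i, Finite (Z i)] {σ : ∀ i, Set G → Y i ≃. Y i}

/-- The partial permutation of `Fin (k + 1) × Y` with given entries, conflicts being discarded. -/
noncomputable def inflate (𝒢 : PmpGroupoid X G) (w : Fin (k + 1) → Set G) {Y : Type}
    (σ : Set G → Y ≃. Y) (s : Set G) : (Fin (k + 1) × Y) ≃. (Fin (k + 1) × Y) :=
  pequivOfRel fun z z' => σ (𝒢.block w s z'.1 z.1) z.2 = some z'.2

namespace IsTransversal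

/-- Entries in one column have disjoint domains and entries in one row have disjoint ranges, so the
conflicts discarded in `inflate` occur only at a negligible set of points. -/
theorem inflate_iff (hw : 𝒢.IsTransversal A w) (h : 𝒢.IsSofic (𝒢.cornerSemigroup A) l N σ)
    (hs : s ∈ 𝒢.fullInverseSemigroup) :
    ∀ᶠ z in ae l N (fun i => Fin (k + 1) × Y i), ∀ z', 𝒢.inflate w (σ z.1) s z.2 = some z' ↔
      σ z.1 (𝒢.block w s z'.1 z.2.1) z.2.2 = some z'.2 := by
  have hK : 𝒢.IsInvSubsemigroup (𝒢.cornerSemigroup A) := .cornerSemigroup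
  refine ae_prod fun b => ?_
  have h1 : ∀ᶠ y in ae l N Y, ∀ a a', a ≠ a' → ∀ x x',
      σ y.1 (𝒢.block w s a b) y.2 = some x → σ y.1 (𝒢.block w s a' b) y.2 ≠ some x' := by
    simp only [Filter.eventually_all]
    intro a a' ha
    have := h.disjoint_src hK (hw.block_mem hs a b) (hw.block_mem hs a' b)
      (hw.disjoint_src_block hs ha b)
    filter_upwards [this] with y hy
    exact hy
  have h2 : ∀ᶠ y in ae l N Y, ∀ a, ∀ b', b ≠ b' → ∀ x, σ y.1 (𝒢.block w s a b) y.2 = some x →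
      ∀ x', σ y.1 (𝒢.block w s a b') x' ≠ some x := by
    simp only [Filter.eventually_all]
    intro a b' hb
    have := h.disjoint_rng hK (hw.block_mem hs a b) (hw.block_mem hs a b')
      (hw.disjoint_rng_block hs hb a)
    filter_upwards [ae_pull (fun i => σ i (𝒢.block w s a b)) this] with y hy x hx x'
    exact hy x hx y.2 x' hx
  filter_upwards [h1, h2] with y h1 h2 z'
  rw [inflate, pequivOfRel_eq_some]
  refine ⟨fun H => H.1, fun H => ⟨H, ?_, ?_⟩⟩
  · rintro ⟨a, x⟩ H'
    have ha : a = z'.1 := by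
      by_contra hne
      exact h1 a z'.1 hne x z'.2 H' H
    subst ha
    exact Prod.ext rfl (Option.some_injective _ (H'.symm.trans H))
  · rintro ⟨b', x⟩ H'
    have hb : b = b' := by
      by_contra hne
      exact h2 z'.1 b' hne z'.2 H x H'
    subst hb
    exact Prod.ext rfl ((σ y.1 _).inj H' H)

/-- Multiplicativity is matrix multiplication, with `IsSofic.decomp` splitting an entry of s t into
products of entries; the trace is the sum over the diagonal. -/
theorem isSofic_inflate (hw : 𝒢.IsTransversal A w)
    (h : 𝒢.IsSofic (𝒢.cornerSemigroup A) l N σ) :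
    𝒢.IsSofic 𝒢.fullInverseSemigroup l N (fun i => 𝒢.inflate w (σ i)) := by
  have hK : 𝒢.IsInvSubsemigroup (𝒢.cornerSemigroup A) := .cornerSemigroup
  refine ⟨fun s hs t ht => ?_, fun s hs => ?_⟩
  · have h1 : ∀ᶠ z in ae l N (fun i => Fin (k + 1) × Y i), ∀ a, ∀ y,
        σ z.1 (𝒢.block w (𝒢.setMul s t) a z.2.1) z.2.2 = some y ↔
        ∃ c x, σ z.1 (𝒢.block w t c z.2.1) z.2.2 = some x ∧
          σ z.1 (𝒢.block w s a c) x = some y := by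
      refine ae_prod fun b => Filter.eventually_all.2 fun a => ?_
      have h1 := h.decomp hK (hw.block_mem (setMul_mem hs ht) a b)
        (fun c => hK.mul _ (hw.block_mem hs a c) _ (hw.block_mem ht c b))
        (fun c => hw.block_setMul_block_subset s t a b c)
        (hw.disjoint_block_setMul_block ht a b) (hw.sum_measure_block_setMul_block hs ht a b)
      have h2 : ∀ᶠ y in ae l N Y, ∀ c, ∀ x,
          σ y.1 (𝒢.setMul (𝒢.block w s a c) (𝒢.block w t c b)) y.2 = some x ↔
            ∃ x', σ y.1 (𝒢.block w t c b) y.2 = some x' ∧ σ y.1 (𝒢.block w s a c) x' = some x :=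
        Filter.eventually_all.2 fun c => h.mul_iff (hw.block_mem hs a c) (hw.block_mem ht c b)
      filter_upwards [h1, h2] with y h1 h2 x
      rw [h1]
      exact exists_congr fun c => h2 c x
    filter_upwards [h1, hw.inflate_iff h (setMul_mem hs ht), hw.inflate_iff h ht,
      ae_pull (fun i => 𝒢.inflate w (σ i) t) (hw.inflate_iff h hs)] with z h1 h2 h3 h4
    ext z'
    rw [h2, h1, Option.bind_eq_some_iff]
    constructor
    · rintro ⟨c, x, hx, hxy⟩
      have h5 := (h3 (c, x)).2 hx
      exact ⟨(c, x), h5, (h4 _ h5 z').2 hxy⟩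
    · rintro ⟨⟨c, x⟩, hx, hxy⟩
      exact ⟨c, x, (h3 _).1 hx, (h4 _ hx z').1 hxy⟩
  · rw [← hw.sum_trace_block hs]
    refine dens_tendsto_of_ae_iff (S := {z : Σ i, Fin (k + 1) × Y i |
      σ z.1 (𝒢.block w s z.2.1 z.2.1) z.2.2 = some z.2.2}) ?_ ?_
    · filter_upwards [hw.inflate_iff h hs] with z hz
      exact (hz z.2).symm
    · refine dens_prod (c := fun b => 𝒢.trace (𝒢.block w s b b)) fun b => ?_
      have h1 := h.tr _ (hw.block_mem hs b b)
      convert h1 using 2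
      ext y
      exact Iff.rfl

/-- The support of an inflation. -/
def inflateSupport (𝒢 : PmpGroupoid X G) (w : Fin (k + 1) → Set G) {Y : Type}
    (σ : Set G → Y ≃. Y) : Set (Fin (k + 1) × Y) :=
  {z | σ (𝒢.unitSet (𝒢.src '' w z.1)) z.2 = some z.2}

/-- In the copy with index a only the points over the domain of w_a matter. The measures of these
domains sum to 1, so the support has about as many points as the target set of the expansion. -/
theorem dens_inflateSupport (hw : 𝒢.IsTransversal A w)
    (h : 𝒢.IsSofic (𝒢.cornerSemigroup A) l N σ) :
    Tendsto (dens N {z : Σ i, Fin (k + 1) × Y i | z.2 ∈ inflateSupport 𝒢 w (σ z.1)}) l (𝓝 1) := by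
  rw [← hw.sum_measure_src]
  refine dens_prod fun b => ?_
  have := h.tr _ (hw.unitSet_mem b)
  rwa [trace_unitSet] at this

theorem mem_inflateSupport (hw : 𝒢.IsTransversal A w)
    (h : 𝒢.IsSofic (𝒢.cornerSemigroup A) l N σ) (hs : s ∈ 𝒢.fullInverseSemigroup) :
    ∀ᶠ z in ae l N (fun i => Fin (k + 1) × Y i), ∀ z', 𝒢.inflate w (σ z.1) s z.2 = some z' →
      z.2 ∈ inflateSupport 𝒢 w (σ z.1) := by
  have h1 : ∀ᶠ z in ae l N (fun i => Fin (k + 1) × Y i), ∀ a, ∀ y,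
      σ z.1 (𝒢.block w s a z.2.1) z.2.2 = some y → z.2 ∈ inflateSupport 𝒢 w (σ z.1) := by
    refine ae_prod fun b => Filter.eventually_all.2 fun a => ?_
    filter_upwards [h.unit_of_eq_some (hw.block_mem hs a b) (hw.unitSet_mem b)
      (src_block_subset w s a b)] with y hy
    exact hy
  filter_upwards [h1, hw.inflate_iff h hs] with z h1 h2 z' hz'
  exact h1 _ _ ((h2 z').1 hz')

end IsTransversal

/-- The partial permutations of `Z` obtained from an inflation by matching its support with `Z`. -/
noncomputable def expandMap (𝒢 : PmpGroupoid X G) (w : Fin (k + 1) → Set G) {Y Z : Type}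
    [Finite Y] [Finite Z] (σ : Set G → Y ≃. Y) : (Fin (k + 1) × Y) ≃. Z :=
  matching (IsTransversal.inflateSupport 𝒢 w σ) univ

/-- The partial permutations of `Z` obtained from an inflation by matching its support with `Z`. -/
noncomputable def expand (𝒢 : PmpGroupoid X G) (w : Fin (k + 1) → Set G) {Y Z : Type}
    [Finite Y] [Finite Z] (σ : Set G → Y ≃. Y) (s : Set G) : Z ≃. Z :=
  (𝒢.expandMap w σ).symm.trans ((𝒢.inflate w σ s).trans (𝒢.expandMap w σ))

theorem expand_eq_some {Y Z : Type} [Finite Y] [Finite Z] {σ : Set G → Y ≃. Y} {x x' : Z} :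
    𝒢.expand w σ s x = some x' ↔ ∃ z z', 𝒢.expandMap w σ z = some x ∧
      𝒢.inflate w σ s z = some z' ∧ 𝒢.expandMap w σ z' = some x' := by
  rw [expand, PEquiv.trans_eq_some]
  constructor
  · rintro ⟨z, hz, hz'⟩
    obtain ⟨z', h1, h2⟩ := (PEquiv.trans_eq_some _ _ _ _).1 hz'
    exact ⟨z, z', (PEquiv.eq_some_iff _).1 hz, h1, h2⟩
  · rintro ⟨z, z', h1, h2, h3⟩
    exact ⟨z, (PEquiv.eq_some_iff _).2 h1, (PEquiv.trans_eq_some _ _ _ _).2 ⟨z', h2, h3⟩⟩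

namespace IsTransversal

theorem expandMap_left (hw : 𝒢.IsTransversal A w)
    (h : 𝒢.IsSofic (𝒢.cornerSemigroup A) l N σ)
    (hZ : Tendsto (dens N (univ : Set (Σ i, Z i))) l (𝓝 1)) :
    ∀ᶠ z in ae l N (fun i => Fin (k + 1) × Y i), z.2 ∈ inflateSupport 𝒢 w (σ z.1) →
      ∃ x : Z z.1, 𝒢.expandMap w (σ z.1) z.2 = some x := by
  have := ae_matchings_left (hw.dens_inflateSupport h) hZ
  filter_upwards [this] with z hz
  exact hz

theorem expandMap_right (hw : 𝒢.IsTransversal A w)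
    (h : 𝒢.IsSofic (𝒢.cornerSemigroup A) l N σ)
    (hZ : Tendsto (dens N (univ : Set (Σ i, Z i))) l (𝓝 1)) :
    ∀ᶠ x in ae l N Z, ∃ z, 𝒢.expandMap w (σ x.1) z = some x.2 := by
  filter_upwards [ae_matchings_right (hw.dens_inflateSupport h) hZ] with x hx
  exact hx (mem_univ _)

theorem isSofic_expand (hw : 𝒢.IsTransversal A w)
    (h : 𝒢.IsSofic (𝒢.cornerSemigroup A) l N σ)
    (hZ : Tendsto (dens N (univ : Set (Σ i, Z i))) l (𝓝 1)) :
    𝒢.IsSofic 𝒢.fullInverseSemigroup l N (fun i => 𝒢.expand w (Z := Z i) (σ i)) := by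
  refine (hw.isSofic_inflate h).transport .fullInverseSemigroup
    (fun i => (𝒢.expandMap w (σ i)).symm) fun s hs => ?_
  filter_upwards [hw.mem_inflateSupport h hs, hw.expandMap_left h hZ] with z h1 h2 z' hz'
  obtain ⟨x, hx⟩ := h2 (h1 z' hz')
  exact ⟨x, (PEquiv.eq_some_iff _).2 hx⟩

/-- `σ` is recovered from its expansion. -/
theorem expand_recover (hw : 𝒢.IsTransversal A w)
    (h : 𝒢.IsSofic (𝒢.cornerSemigroup A) l N σ)
    (hZ : Tendsto (dens N (univ : Set (Σ i, Z i))) l (𝓝 1))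
    (hY : Tendsto (dens N (univ : Set (Σ i, Y i))) l (𝓝 (𝒢.μ.real A)))
    (hs : s ∈ 𝒢.cornerSemigroup A) :
    ∀ᶠ y in ae l N Y, ∀ y', σ y.1 s y.2 = some y' ↔ ∃ x x' : Z y.1,
      𝒢.expandMap w (σ y.1) (0, y.2) = some x ∧ 𝒢.expand w (σ y.1) s x = some x' ∧
      𝒢.expandMap w (σ y.1) (0, y') = some x' := by
  have hK : 𝒢.IsInvSubsemigroup (𝒢.cornerSemigroup A) := .cornerSemigroup
  have hA : 𝒢.unitSet A ∈ 𝒢.cornerSemigroup A := by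
    have := hw.unitSet_mem 0
    rwa [hw.src_zero] at this
  -- All of Y has density μ(A), which is also the trace of p, so p acts as the identity almost
  -- everywhere on Y.
  have h1 : ∀ᶠ y in ae l N Y, y ∈ {y : Σ i, Y i | σ y.1 (𝒢.unitSet A) y.2 = some y.2} := by
    have := h.tr _ hA
    rw [trace_unitSet] at this
    filter_upwards [ae_of_dens_eq (Eventually.of_forall fun _ _ => mem_univ _) this hY] with y hy
    exact hy (mem_univ _)
  have h2 : ∀ᶠ y in ae l N Y, ∃ x : Z y.1, 𝒢.expandMap w (σ y.1) (0, y.2) = some x := by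
    filter_upwards [h1, ae_slice (hw.expandMap_left (Z := Z) h hZ) 0] with y h1 h2
    refine h2 ?_
    change σ y.1 (𝒢.unitSet (𝒢.src '' w 0)) y.2 = some y.2
    rw [hw.src_zero]
    exact h1
  -- Because w_0 is the unit over A, the entry of s at (0, 0) is s itself, so s can be read off on
  -- the zeroth copy.
  filter_upwards [h2, ae_pull (fun i => σ i s) h2, ae_slice (hw.inflate_iff h hs.1) 0]
    with y h2 h3 h4 y'
  rw [← hw.block_zero_zero hs] at h3
  constructor
  · intro hy
    obtain ⟨x, hx⟩ := h2
    rw [hw.block_zero_zero hs] at h3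
    obtain ⟨x', hx'⟩ := h3 y' hy
    refine ⟨x, x', hx, expand_eq_some.2 ⟨_, (0, y'), hx, (h4 _).2 ?_, hx'⟩, hx'⟩
    rw [hw.block_zero_zero hs]
    exact hy
  · rintro ⟨x, x', hx, hxx', hx'⟩
    obtain ⟨z, z', hz, hzz', hz'⟩ := expand_eq_some.1 hxx'
    obtain rfl := (𝒢.expandMap w (σ y.1)).inj hz hx
    obtain rfl := (𝒢.expandMap w (σ y.1)).inj hz' hx'
    have := (h4 _).1 hzz'
    rwa [hw.block_zero_zero hs] at this

/-- The expansions of the partial isometries of the transversal determine the matching. -/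
theorem expand_transversal (hw : 𝒢.IsTransversal A w)
    (h : 𝒢.IsSofic (𝒢.cornerSemigroup A) l N σ)
    (hZ : Tendsto (dens N (univ : Set (Σ i, Z i))) l (𝓝 1)) :
    ∀ᶠ x in ae l N Z, ∃ a y x₀, 𝒢.expandMap w (σ x.1) (a, y) = some x.2 ∧
      𝒢.expandMap w (σ x.1) (0, y) = some x₀ ∧ 𝒢.expand w (σ x.1) (w a) x₀ = some x.2 := by
  have hA : 𝒢.unitSet A ∈ 𝒢.cornerSemigroup A := by
    have := hw.unitSet_mem 0
    rwa [hw.src_zero] at this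
  -- Domains of the w_a lie in A, so a point y in the support of copy a also lies in that of copy 0.
  -- The entry of w_a at (a, 0) is the idempotent of its domain, hence its inflation moves (0, y) to
  -- (a, y).
  have h1 : ∀ᶠ z in ae l N (fun i => Fin (k + 1) × Y i),
      z.2 ∈ inflateSupport 𝒢 w (σ z.1) → (∃ x₀ : Z z.1,
        𝒢.expandMap w (σ z.1) (0, z.2.2) = some x₀) ∧
        𝒢.inflate w (σ z.1) (w z.2.1) (0, z.2.2) = some z.2 := by
    refine ae_prod fun b => ?_
    have hK : 𝒢.IsInvSubsemigroup (𝒢.cornerSemigroup A) := .cornerSemigroup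
    have h3 := h.of_subset hK hA (hw.unitSet_mem b) (image_mono (hw.src_subset b))
    filter_upwards [ae_slice (hw.expandMap_left (Z := Z) h hZ) 0, h3,
      ae_slice (hw.inflate_iff h (hw.mem b)) 0] with y h2 h3 h4 hy
    refine ⟨h2 ?_, (h4 _).2 ?_⟩
    · change σ y.1 (𝒢.unitSet (𝒢.src '' w 0)) y.2 = some y.2
      rw [hw.src_zero]
      exact h3 _ hy
    · rw [hw.block_self_zero]
      exact hy
  filter_upwards [hw.expandMap_right h hZ,
    ae_pull (fun i => (𝒢.expandMap w (Z := Z i) (σ i)).symm) h1] with x h2 h3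
  obtain ⟨⟨a, y⟩, hz⟩ := h2
  obtain ⟨⟨x₀, hx₀⟩, h4⟩ := h3 _ ((PEquiv.eq_some_iff _).2 hz) (matching_mem hz).1
  exact ⟨a, y, x₀, hz, hx₀, expand_eq_some.2 ⟨_, _, hx₀, h4, hz⟩⟩

end IsTransversal

/-- The matching of `Y` with the fixed points of `σ p`. -/
noncomputable def compressMap (A : Set X) {Y Z : Type} [Finite Y] [Finite Z]
    (𝒢 : PmpGroupoid X G) (σ : Set G → Y ≃. Y) : Z ≃. Y :=
  matching univ {y | σ (𝒢.unitSet A) y = some y}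

/-- The corner of `σ`, transported to `Z`. -/
noncomputable def compress (A : Set X) {Y Z : Type} [Finite Y] [Finite Z]
    (𝒢 : PmpGroupoid X G) (σ : Set G → Y ≃. Y) (s : Set G) : Z ≃. Z :=
  (compressMap A 𝒢 σ).trans ((σ s).trans (compressMap A 𝒢 σ).symm)

theorem unitSet_mem_cornerSemigroup (hA : MeasurableSet A) :
    𝒢.unitSet A ∈ 𝒢.cornerSemigroup A :=
  ⟨unitSet_mem hA, src_image_unitSet.subset, rng_image_unitSet.subset⟩

namespace IsSofic

theorem mono (h : 𝒢.IsSofic 𝒢.fullInverseSemigroup l N σ) :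
    𝒢.IsSofic (𝒢.cornerSemigroup A) l N σ :=
  ⟨fun s hs t ht => h.mul s hs.1 t ht.1, fun s hs => h.tr s hs.1⟩

theorem compressMap_right (h : 𝒢.IsSofic 𝒢.fullInverseSemigroup l N σ) (hA : MeasurableSet A)
    (hZ : Tendsto (dens N (univ : Set (Σ i, Z i))) l (𝓝 (𝒢.μ.real A)))
    (hs : s ∈ 𝒢.cornerSemigroup A) :
    ∀ᶠ y in ae l N Y, ∀ y', σ y.1 s y.2 = some y' →
      ∃ x : Z y.1, compressMap A 𝒢 (σ y.1) x = some y.2 := by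
  have hA' : 𝒢.unitSet A ∈ 𝒢.cornerSemigroup A := unitSet_mem_cornerSemigroup hA
  have h1 := h.tr _ hA'.1
  rw [trace_unitSet] at h1
  filter_upwards [ae_matchings_right hZ h1, h.unit_of_eq_some hs.1 hA'.1 hs.2.1] with y h1 h2 y' hy
  exact h1 (h2 y' hy)

theorem compress (h : 𝒢.IsSofic 𝒢.fullInverseSemigroup l N σ) (hA : MeasurableSet A)
    (hZ : Tendsto (dens N (univ : Set (Σ i, Z i))) l (𝓝 (𝒢.μ.real A))) :
    𝒢.IsSofic (𝒢.cornerSemigroup A) l N (fun i => compress A (Z := Z i) 𝒢 (σ i)) :=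
  h.mono.transport .cornerSemigroup _ fun _ hs => h.compressMap_right hA hZ hs

/-- `σ` is recovered from its compression. -/
theorem compress_recover (h : 𝒢.IsSofic 𝒢.fullInverseSemigroup l N σ)
    (hw : 𝒢.IsTransversal A w)
    (hZ : Tendsto (dens N (univ : Set (Σ i, Z i))) l (𝓝 (𝒢.μ.real A)))
    (hs : s ∈ 𝒢.fullInverseSemigroup) :
    ∀ᶠ y in ae l N Y, ∀ y', σ y.1 s y.2 = some y' ↔ ∃ a b, ∃ x x' : Z y.1,
      (compressMap A 𝒢 (σ y.1)).trans (σ y.1 (w b)) x = some y.2 ∧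
      PmpGroupoid.compress A 𝒢 (σ y.1) (𝒢.block w s a b) x = some x' ∧
      (compressMap A 𝒢 (σ y.1)).trans (σ y.1 (w a)) x' = some y' := by
  have hK : 𝒢.IsInvSubsemigroup 𝒢.fullInverseSemigroup := .fullInverseSemigroup
  have hKA : 𝒢.IsInvSubsemigroup (𝒢.cornerSemigroup A) := .cornerSemigroup
  have hm := hw.measurableSet
  have hbm := fun a b => (hw.block_mem hs a b)
  -- s is the sum of the pieces w_a (w_a⁻¹ s w_b) w_b⁻¹, up to null sets.
  have h1 := h.decomp hK hs (p := fun p : Fin (k + 1) × Fin (k + 1) =>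
      𝒢.setMul (w p.1) (𝒢.setMul (𝒢.block w s p.1 p.2) (𝒢.setInv (w p.2))))
    (fun p => setMul_mem (hw.mem _) (setMul_mem (hbm _ _).1 (setInv_mem (hw.mem _))))
    (fun p => by
      rw [hw.setMul_block_setMul]
      exact inter_subset_left.trans inter_subset_left)
    (by simp only [hw.setMul_block_setMul]; exact hw.disjoint_piece hs)
    (by simp only [hw.setMul_block_setMul]; exact hw.sum_measure_piece hs)
  have h2 : ∀ᶠ y in ae l N Y, ∀ p : Fin (k + 1) × Fin (k + 1), ∀ y',
      σ y.1 (𝒢.setMul (w p.1) (𝒢.setMul (𝒢.block w s p.1 p.2) (𝒢.setInv (w p.2)))) y.2 = some y' ↔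
      ∃ u u', σ y.1 (w p.2) u = some y.2 ∧ σ y.1 (𝒢.block w s p.1 p.2) u = some u' ∧
        σ y.1 (w p.1) u' = some y' := by
    refine Filter.eventually_all.2 fun p => ?_
    filter_upwards [h.mul_iff (hw.mem p.1) (setMul_mem (hbm p.1 p.2).1 (setInv_mem (hw.mem p.2))),
      h.mul_iff (hbm p.1 p.2).1 (setInv_mem (hw.mem p.2)), h.inv_iff hK (hw.mem p.2)]
      with y h1 h2 h3 y'
    rw [h1]
    simp only [h2, h3]
    exact ⟨fun ⟨u', ⟨u, h4, h5⟩, h6⟩ => ⟨u, u', h4, h5, h6⟩,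
      fun ⟨u, u', h4, h5, h6⟩ => ⟨u', ⟨u, h4, h5⟩, h6⟩⟩
  -- Both endpoints of a corner entry lie over A, hence almost always in the range of the matching
  -- of Z with the fixed points of p. The endpoint u' is treated through the inverse entry.
  have h3 : ∀ᶠ y in ae l N Y, ∀ p : Fin (k + 1) × Fin (k + 1), ∀ u u',
      σ y.1 (w p.2) u = some y.2 → σ y.1 (𝒢.block w s p.1 p.2) u = some u' →
      (∃ x : Z y.1, compressMap A 𝒢 (σ y.1) x = some u) ∧
      ∃ x : Z y.1, compressMap A 𝒢 (σ y.1) x = some u' := by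
    refine Filter.eventually_all.2 fun p => ?_
    have hq := hbm p.1 p.2
    have h4 := ae_pull (fun i => σ i (𝒢.block w s p.1 p.2))
      ((h.inv_iff hK hq.1).and (h.compressMap_right (Z := Z) hm hZ (hKA.inv _ hq)))
    filter_upwards [ae_pull (fun i => (σ i (w p.2)).symm)
      ((h.compressMap_right (Z := Z) hm hZ hq).and h4)] with y h5 u u' hu hu'
    obtain ⟨h6, h7⟩ := h5 u ((PEquiv.eq_some_iff _).2 hu)
    obtain ⟨h8, h9⟩ := h7 u' hu'
    exact ⟨h6 u' hu', h9 u ((h8 u).2 hu')⟩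
  filter_upwards [h1, h2, h3] with y h1 h2 h3 y'
  rw [h1]
  simp only [h2, PmpGroupoid.compress, PEquiv.trans_eq_some, PEquiv.eq_some_iff]
  constructor
  · rintro ⟨⟨a, b⟩, u, u', h4, h5, h6⟩
    obtain ⟨⟨x, hx⟩, x', hx'⟩ := h3 (a, b) u u' h4 h5
    exact ⟨a, b, x, x', ⟨u, hx, h4⟩, ⟨u, hx, u', h5, hx'⟩, u', hx', h6⟩
  · rintro ⟨a, b, x, x', ⟨u, hx, h4⟩, ⟨v, hv, u', h5, hx'⟩, v', hv', h6⟩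
    obtain rfl : u = v := Option.some_injective _ (hx.symm.trans hv)
    obtain rfl : u' = v' := Option.some_injective _ (hx'.symm.trans hv')
    exact ⟨(a, b), u, u', h4, h5, h6⟩

end IsSofic

/-- `σ p` is the identity on the range of the matching. -/
theorem IsTransversal.compressMap_trans_zero (hw : 𝒢.IsTransversal A w) {Y Z : Type} [Finite Y]
    [Finite Z] (σ : Set G → Y ≃. Y) :
    (compressMap A (Z := Z) 𝒢 σ).trans (σ (w 0)) = compressMap A 𝒢 σ := by
  ext x y
  rw [PEquiv.trans_eq_some, hw.zero]
  constructor
  · rintro ⟨u, hu, huy⟩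
    have : σ (𝒢.unitSet A) u = some u := (matching_mem hu).2
    rwa [← Option.some_injective _ (this.symm.trans huy)]
  · intro hy
    exact ⟨y, hy, (matching_mem hy).2⟩


end PmpGroupoid

/-! ### Approximations at a fixed finite level and the filter they generate -/

namespace Sofic

/-- Maps to partial permutations that are `δ`-multiplicative and `δ`-trace preserving on `M`. -/
def approx {S : Type*} (mul : S → S → S) (τ : S → ℝ) (M : Set S) (δ : ℝ) (d : ℕ) :
    Set (S → (Fin d ≃. Fin d)) :=
  {σ | (∀ s ∈ M, ∀ t ∈ M, mul s t ∈ M →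
        PEquiv.hammingDistance (σ (mul s t)) (PEquiv.prod (σ s) (σ t)) < δ) ∧
      ∀ s ∈ M, |PEquiv.normalizedTrace (σ s) - τ s| < δ}

theorem approx_mono {S : Type*} {mul : S → S → S} {τ : S → ℝ} {M M' : Set S} {δ δ' : ℝ} {d : ℕ}
    (hM : M ⊆ M') (hδ : δ' ≤ δ) : approx mul τ M' δ' d ⊆ approx mul τ M δ d :=
  fun _ h => ⟨fun s hs t ht hst => (h.1 s (hM hs) t (hM ht) (hM hst)).trans_le hδ,
    fun s hs => (h.2 s (hM hs)).trans_le hδ⟩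

/-- Conjugation of a partial permutation by a permutation. -/
def conj {d : ℕ} (π : Equiv.Perm (Fin d)) (a : Fin d ≃. Fin d) : Fin d ≃. Fin d :=
  π.symm.toPEquiv.trans (a.trans π.toPEquiv)

theorem conj_apply {d : ℕ} (π : Equiv.Perm (Fin d)) (a : Fin d ≃. Fin d) (x : Fin d) :
    conj π a x = (a (π.symm x)).map π := by
  change ((π.symm.toPEquiv x).bind fun y => (a y).bind π.toPEquiv) = _
  rw [Equiv.toPEquiv_apply, Option.bind_some]
  cases h : a (π.symm x) <;> simp [Equiv.toPEquiv_apply]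

theorem conj_eq_some {d : ℕ} (π : Equiv.Perm (Fin d)) (a : Fin d ≃. Fin d) (x y : Fin d) :
    conj π a (π x) = some (π y) ↔ a x = some y := by
  rw [conj_apply, Equiv.symm_apply_apply, Option.map_eq_some_iff]
  simp

theorem hammingDistance_conj {d : ℕ} (π : Equiv.Perm (Fin d)) (a b : Fin d ≃. Fin d) :
    PEquiv.hammingDistance (conj π a) (conj π b) = PEquiv.hammingDistance a b := by
  unfold PEquiv.hammingDistance
  congr 2
  have : {x | conj π a x ≠ conj π b x} = π '' {x | a x ≠ b x} := by
    ext x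
    rw [Equiv.image_eq_preimage_symm]
    change conj π a x ≠ conj π b x ↔ a (π.symm x) ≠ b (π.symm x)
    rw [conj_apply, conj_apply, (Option.map_injective π.injective).ne_iff]
  rw [this, ncard_image_of_injective _ π.injective]

theorem normalizedTrace_conj {d : ℕ} (π : Equiv.Perm (Fin d)) (a : Fin d ≃. Fin d) :
    PEquiv.normalizedTrace (conj π a) = PEquiv.normalizedTrace a := by
  unfold PEquiv.normalizedTrace
  congr 2
  have : {x | conj π a x = some x} = π '' {x | a x = some x} := by
    ext x
    obtain ⟨x, rfl⟩ := π.surjective x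
    rw [π.injective.mem_set_image]
    exact conj_eq_some π a x x
  rw [this, ncard_image_of_injective _ π.injective]

theorem prod_conj {d : ℕ} (π : Equiv.Perm (Fin d)) (a b : Fin d ≃. Fin d) :
    PEquiv.prod (conj π a) (conj π b) = conj π (PEquiv.prod a b) := by
  ext x y
  obtain ⟨x, rfl⟩ := π.surjective x
  obtain ⟨y, rfl⟩ := π.surjective y
  simp only [PEquiv.prod, PEquiv.trans_eq_some, conj_eq_some]
  constructor
  · rintro ⟨z, h1, h2⟩
    obtain ⟨z, rfl⟩ := π.surjective z
    rw [conj_eq_some] at h1 h2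
    exact ⟨z, h1, h2⟩
  · rintro ⟨z, h1, h2⟩
    exact ⟨π z, (conj_eq_some _ _ _ _).2 h1, (conj_eq_some _ _ _ _).2 h2⟩

theorem conj_mem_approx {S : Type*} {mul : S → S → S} {τ : S → ℝ} {M : Set S} {δ : ℝ} {d : ℕ}
    {σ : S → (Fin d ≃. Fin d)} (h : σ ∈ approx mul τ M δ d) (π : Equiv.Perm (Fin d)) :
    (fun s => conj π (σ s)) ∈ approx mul τ M δ d := by
  refine ⟨fun s hs t ht hst => ?_, fun s hs => ?_⟩
  · rw [prod_conj, hammingDistance_conj]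
    exact h.1 s hs t ht hst
  · rw [normalizedTrace_conj]
    exact h.2 s hs

end Sofic

namespace PmpGroupoid

open Sofic

variable {X : Type u} {G : Type v} [MeasurableSpace X] [MeasurableSpace G]

/-- The maps approximating `𝒢` on `M`, with the trace divided by `c`. -/
def approx (𝒢 : PmpGroupoid X G) (c : ℝ) (M : Set (Set G)) (δ : ℝ) (d : ℕ) :
    Set (Set G → (Fin d ≃. Fin d)) :=
  Sofic.approx 𝒢.setMul (fun s => 𝒢.trace s / c) M δ d

/-- The filter generated by the sets of all sufficiently good approximations on sufficiently
many points. -/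
def approxFilter (𝒢 : PmpGroupoid X G) (K : Set (Set G)) (c : ℝ) (f : ℕ → ℕ) :
    Filter (Σ d : ℕ, Set G → (Fin (f d) ≃. Fin (f d))) where
  sets := {S | ∃ M : Finset (Set G), (M : Set (Set G)) ⊆ K ∧ ∃ δ : ℝ, 0 < δ ∧ ∃ D, ∀ d ≥ D,
    ∀ σ ∈ 𝒢.approx c (M : Set (Set G)) δ (f d), ⟨d, σ⟩ ∈ S}
  univ_sets := ⟨∅, by simp, 1, one_pos, 0, fun _ _ _ _ => mem_univ _⟩
  sets_of_superset := by
    rintro S T ⟨M, hM, δ, hδ, D, h⟩ hST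
    exact ⟨M, hM, δ, hδ, D, fun d hd σ hσ => hST (h d hd σ hσ)⟩
  inter_sets := by
    classical
    rintro S T ⟨M, hM, δ, hδ, D, h⟩ ⟨M', hM', δ', hδ', D', h'⟩
    refine ⟨M ∪ M', by simp [hM, hM'], min δ δ', lt_min hδ hδ', max D D', fun d hd σ hσ => ⟨?_, ?_⟩⟩
    · exact h d (le_of_max_le_left hd) σ (approx_mono (by simp) (min_le_left _ _) hσ)
    · exact h' d (le_of_max_le_right hd) σ (approx_mono (by simp) (min_le_right _ _) hσ)

variable {𝒢 : PmpGroupoid X G} {K : Set (Set G)} {c : ℝ} {f : ℕ → ℕ}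

/-- An eventual property along this filter holds for all good approximations at once, with M, δ and
D independent of the map. If there are none the filter is trivial, consistently with counts equal to
0. -/
theorem eventually_approxFilter_iff {P : (Σ d : ℕ, Set G → (Fin (f d) ≃. Fin (f d))) → Prop} :
    (∀ᶠ i in 𝒢.approxFilter K c f, P i) ↔ ∃ M : Finset (Set G), (M : Set (Set G)) ⊆ K ∧
      ∃ δ : ℝ, 0 < δ ∧ ∃ D, ∀ d ≥ D, ∀ σ ∈ 𝒢.approx c (M : Set (Set G)) δ (f d), P ⟨d, σ⟩ :=
  Iff.rfl

theorem tendsto_fst_approxFilter :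
    Tendsto (fun i => i.1) (𝒢.approxFilter K c f) atTop := by
  refine tendsto_atTop.2 fun n => ?_
  exact eventually_approxFilter_iff.2 ⟨∅, by simp, 1, one_pos, n, fun d hd _ _ => hd⟩

theorem dens_eq_div_mul {ι : Type*} {N n : ι → ℕ} (S : Set (Σ i, Fin (n i))) (i : ι) :
    dens N S i = ({y | (⟨i, y⟩ : Σ i, Fin (n i)) ∈ S}.ncard : ℝ) / n i * ((n i : ℝ) / N i) := by
  unfold dens
  by_cases h : n i = 0
  · have : {y | (⟨i, y⟩ : Σ i, Fin (n i)) ∈ S} = ∅ := by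
      ext y
      exact absurd y.2 (by omega)
    rw [this]
    simp
  · have : (n i : ℝ) ≠ 0 := by exact_mod_cast h
    field_simp

/-- The tautological family: the index is itself an approximation. Densities are taken relative to d
rather than the number f d of points, and the limit c of f d / d cancels the division of the trace
by c. -/
theorem isSofic_approxFilter (hK : 𝒢.IsInvSubsemigroup K) (hc : 0 < c)
    (hf : Tendsto (fun d => (f d : ℝ) / d) atTop (𝓝 c)) :
    𝒢.IsSofic K (𝒢.approxFilter K c f) (fun i => i.1) (Y := fun i => Fin (f i.1))
      (fun i => i.2) := by
  classical
  have hf' : Tendsto (fun i : Σ d : ℕ, Set G → (Fin (f d) ≃. Fin (f d)) => (f i.1 : ℝ) / i.1)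
      (𝒢.approxFilter K c f) (𝓝 c) := hf.comp tendsto_fst_approxFilter
  refine ⟨fun s hs t ht => ?_, fun s hs => ?_⟩
  · rw [Filter.Eventually, mem_ae]
    have h1 : Tendsto (fun i : Σ d : ℕ, Set G → (Fin (f d) ≃. Fin (f d)) =>
        PEquiv.hammingDistance (i.2 (𝒢.setMul s t)) (PEquiv.prod (i.2 s) (i.2 t)))
        (𝒢.approxFilter K c f) (𝓝 0) := by
      rw [Metric.tendsto_nhds]
      intro ε hε
      refine eventually_approxFilter_iff.2 ⟨{s, t, 𝒢.setMul s t}, ?_, ε, hε, 0, fun d _ σ hσ => ?_⟩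
      · intro x hx
        simp only [Finset.coe_insert, Finset.coe_singleton, mem_insert_iff,
          mem_singleton_iff] at hx
        rcases hx with rfl | rfl | rfl
        exacts [hs, ht, hK.mul _ hs _ ht]
      · have := hσ.1 s (by simp) t (by simp) (by simp)
        rw [Real.dist_eq, sub_zero, abs_of_nonneg]
        · exact this
        · unfold PEquiv.hammingDistance; positivity
    have h2 := h1.mul hf'
    rw [zero_mul] at h2
    refine h2.congr fun i => ?_
    rw [dens_eq_div_mul]
    rfl
  · have h1 : Tendsto (fun i : Σ d : ℕ, Set G → (Fin (f d) ≃. Fin (f d)) =>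
        PEquiv.normalizedTrace (i.2 s)) (𝒢.approxFilter K c f) (𝓝 (𝒢.trace s / c)) := by
      rw [Metric.tendsto_nhds]
      intro ε hε
      refine eventually_approxFilter_iff.2 ⟨{s}, by simpa using hs, ε, hε, 0, fun d _ σ hσ => ?_⟩
      rw [Real.dist_eq]
      exact hσ.2 s (by simp)
    have h2 := h1.mul hf'
    rw [div_mul_cancel₀ _ hc.ne'] at h2
    refine h2.congr fun i => ?_
    rw [dens_eq_div_mul]
    rfl

/-- The way back: families built from the tautological one are again good approximations in the
numerical sense. -/
theorem IsSofic.eventually_mem_approx {ι : Type*} {l : Filter ι} {N n : ι → ℕ}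
    {σ : ∀ i, Set G → (Fin (n i) ≃. Fin (n i))} (h : 𝒢.IsSofic K l N σ) (hc : 0 < c)
    (hn : Tendsto (fun i => (n i : ℝ) / N i) l (𝓝 c)) {M : Finset (Set G)}
    (hM : (M : Set (Set G)) ⊆ K) {δ : ℝ} (hδ : 0 < δ) :
    ∀ᶠ i in l, σ i ∈ 𝒢.approx c (M : Set (Set G)) δ (n i) := by
  have key : ∀ (S : Set (Σ i, Fin (n i))) (a : ℝ), Tendsto (dens N S) l (𝓝 a) →
      Tendsto (fun i => ({y | (⟨i, y⟩ : Σ i, Fin (n i)) ∈ S}.ncard : ℝ) / n i) l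
        (𝓝 (a / c)) := by
    intro S a hS
    refine (hS.div hn hc.ne').congr' ?_
    filter_upwards [hn.eventually (lt_mem_nhds hc)] with i hi
    rw [Pi.div_apply, dens_eq_div_mul, mul_div_cancel_right₀ _ hi.ne']
  have h1 : ∀ᶠ i in l, ∀ s ∈ M, ∀ t ∈ M, 𝒢.setMul s t ∈ (M : Set (Set G)) →
      PEquiv.hammingDistance (σ i (𝒢.setMul s t)) (PEquiv.prod (σ i s) (σ i t)) < δ := by
    refine (Filter.eventually_all_finset _).2 fun s hs =>
      (Filter.eventually_all_finset _).2 fun t ht => ?_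
    have h2 := key _ _ (mem_ae.1 (h.mul s (hM hs) t (hM ht)))
    rw [zero_div] at h2
    filter_upwards [h2.eventually (gt_mem_nhds hδ)] with i hi _
    exact hi
  have h2 : ∀ᶠ i in l, ∀ s ∈ M, |PEquiv.normalizedTrace (σ i s) - 𝒢.trace s / c| < δ := by
    refine (Filter.eventually_all_finset _).2 fun s hs => ?_
    have h2 := key _ _ (h.tr s (hM hs))
    filter_upwards [(Metric.tendsto_nhds.1 h2) δ hδ] with i hi
    exact hi
  filter_upwards [h1, h2] with i h1 h2
  exact ⟨h1, h2⟩

end PmpGroupoid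

/-! ### Counting partial bijections -/

namespace Sofic

section Counting

theorem ncard_le_of_cover {α β : Type*} [Finite α] [Finite β] {S : Set α} (T : Set β)
    (ball : β → Set α) (n : ℕ) (h : ∀ x ∈ S, ∃ t ∈ T, x ∈ ball t)
    (hn : ∀ t ∈ T, (ball t).ncard ≤ n) : S.ncard ≤ T.ncard * n := by
  classical
  have := Fintype.ofFinite α
  have := Fintype.ofFinite β
  have h1 : S.toFinset ⊆ T.toFinset.biUnion fun t => (ball t).toFinset := by
    intro x hx
    obtain ⟨t, ht, hxt⟩ := h x (by simpa using hx)
    simp only [Finset.mem_biUnion, mem_toFinset]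
    exact ⟨t, ht, hxt⟩
  have h2 := (Finset.card_le_card h1).trans Finset.card_biUnion_le
  have h3 := h2.trans (Finset.sum_le_card_nsmul _ _ n fun t ht => by
    rw [← ncard_eq_toFinset_card']
    exact hn t (by simpa using ht))
  rwa [← ncard_eq_toFinset_card', ← ncard_eq_toFinset_card', smul_eq_mul] at h3

theorem ncard_pi_eq {κ : Type*} [Fintype κ] {α : κ → Type*} [∀ i, Finite (α i)]
    (B : ∀ i, Set (α i)) : {f : ∀ i, α i | ∀ i, f i ∈ B i}.ncard = ∏ i, (B i).ncard := by
  classical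
  have := fun i => Fintype.ofFinite (α i)
  have h : {f : ∀ i, α i | ∀ i, f i ∈ B i} =
      (Fintype.piFinset fun i => (B i).toFinset : Finset (∀ i, α i)) := by
    ext f; simp
  rw [h, ncard_coe_finset, Fintype.card_piFinset]
  exact Finset.prod_congr rfl fun i _ => (ncard_eq_toFinset_card' _).symm

theorem ncard_pi_le_pow {κ : Type*} [Fintype κ] {α : κ → Type*} [∀ i, Finite (α i)]
    (B : ∀ i, Set (α i)) (n : ℕ) (h : ∀ i, (B i).ncard ≤ n) :
    {f : ∀ i, α i | ∀ i, f i ∈ B i}.ncard ≤ n ^ Fintype.card κ := by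
  rw [ncard_pi_eq]
  exact (Finset.prod_le_prod' fun i _ => h i).trans (by simp)

instance {α β : Type*} [Finite α] [Finite β] : Finite (α ≃. β) :=
  Finite.of_injective (fun f : α ≃. β => (f : α → Option β)) DFunLike.coe_injective

/-- The number of partial bijections at bounded distance from a given partial function. -/
theorem ncard_ball_le {m d r : ℕ} (a : Fin m → Option (Fin d)) :
    {b : Fin m ≃. Fin d | {x | b x ≠ a x}.ncard ≤ r}.ncard ≤ 2 ^ m * (d + 1) ^ r := by
  classical
  have h := ncard_le_of_cover (S := {b : Fin m ≃. Fin d | {x | b x ≠ a x}.ncard ≤ r})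
    {D : Set (Fin m) | D.ncard ≤ r} (fun D => {b | ∀ x ∉ D, b x = a x}) ((d + 1) ^ r)
    (fun b hb => ⟨{x | b x ≠ a x}, hb, fun x hx => by
      by_contra h; exact hx h⟩) ?_
  · refine h.trans (Nat.mul_le_mul_right _ ?_)
    refine (ncard_le_ncard (subset_univ _) (toFinite _)).trans ?_
    rw [ncard_univ, Nat.card_eq_fintype_card, Fintype.card_set, Fintype.card_fin]
  · intro D hD
    have h1 : {b : Fin m ≃. Fin d | ∀ x ∉ D, b x = a x}.ncard ≤
        (univ : Set (D → Option (Fin d))).ncard := by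
      refine ncard_le_ncard_of_injOn (fun b x => b x) (fun _ _ => mem_univ _) ?_ (toFinite _)
      intro b hb b' hb' e
      ext1 x
      by_cases hx : x ∈ D
      · exact congrFun e ⟨x, hx⟩
      · rw [hb x hx, hb' x hx]
    refine h1.trans ?_
    have hc : Fintype.card D = D.ncard := by
      rw [← Nat.card_eq_fintype_card, Nat.card_coe_set_eq]
    rw [ncard_univ, Nat.card_eq_fintype_card, Fintype.card_fun, Fintype.card_option,
      Fintype.card_fin, hc]
    exact Nat.pow_le_pow_right (by omega) hD

theorem ncard_ball_univ {m d : ℕ} :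
    (univ : Set (Fin m ≃. Fin d)).ncard ≤ 2 ^ m * (d + 1) ^ m := by
  refine le_trans (ncard_le_ncard (fun b _ => ?_) (toFinite _)) (ncard_ball_le (fun _ => none))
  refine (ncard_le_ncard (subset_univ _) (toFinite _)).trans ?_
  rw [ncard_univ, Nat.card_eq_fintype_card, Fintype.card_fin]

/-- The number of restrictions to `E` of elements of `R`. -/
noncomputable def numRestr {S : Type*} {d : ℕ} (E : Set S) (R : Set (S → (Fin d ≃. Fin d))) : ℕ :=
  ((fun (σ : S → (Fin d ≃. Fin d)) (e : E) => σ e) '' R).ncard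

theorem ae_eventually_ncard_le {ι : Type*} {l : Filter ι} {N : ι → ℕ} {n : ι → ℕ}
    {P : (Σ i, Fin (n i)) → Prop} (h : ∀ᶠ z in ae l N (fun i => Fin (n i)), P z)
    (hN : Tendsto N l atTop) {κ : ℝ} (hκ : 0 < κ) :
    ∀ᶠ i in l, {x | ¬ P ⟨i, x⟩}.ncard ≤ ⌊κ * N i⌋₊ := by
  filter_upwards [(mem_ae.1 h).eventually (gt_mem_nhds hκ), hN.eventually_ge_atTop 1] with i hi hN
  have hN' : (0 : ℝ) < N i := by exact_mod_cast hN
  rw [dens, div_lt_iff₀ hN'] at hi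
  exact Nat.le_floor hi.le

theorem dens_eventually_ncard_le {ι : Type*} {l : Filter ι} {N : ι → ℕ} {n : ι → ℕ}
    {S : Set (Σ i, Fin (n i))} {a b : ℝ} (h : Tendsto (dens N S) l (𝓝 a))
    (hN : Tendsto N l atTop) (hab : a < b) :
    ∀ᶠ i in l, {x | (⟨i, x⟩ : Σ i, Fin (n i)) ∈ S}.ncard ≤ ⌊b * N i⌋₊ := by
  filter_upwards [h.eventually (gt_mem_nhds hab), hN.eventually_ge_atTop 1] with i hi hN
  have hN' : (0 : ℝ) < N i := by exact_mod_cast hN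
  rw [dens, div_lt_iff₀ hN'] at hi
  exact Nat.le_floor hi.le

end Counting

end Sofic

namespace Sofic

/-- The value determined by a functional relation. -/
noncomputable def optionOfRel {β : Type*} (R : β → Prop) : Option β := by
  classical
  exact if h : ∃ y, R y then some h.choose else none

theorem optionOfRel_eq {β : Type*} {R : β → Prop} {o : Option β} (h : ∀ y, o = some y ↔ R y) :
    optionOfRel R = o := by
  classical
  unfold optionOfRel
  split_ifs with H
  · exact ((h _).2 H.choose_spec).symm
  · cases o with
    | none => rfl
    | some y => exact absurd ⟨y, (h y).1 rfl⟩ H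

/-- Extension by the empty partial bijection. -/
noncomputable def extendBot {S α : Type*} {E : Set S} (ρ : E → (α ≃. α)) (s : S) : α ≃. α := by
  classical
  exact if h : s ∈ E then ρ ⟨s, h⟩ else ⊥

theorem extendBot_of_mem {S α : Type*} {E : Set S} (ρ : S → (α ≃. α)) {s : S} (hs : s ∈ E) :
    extendBot (fun e : E => ρ e) s = ρ s := dif_pos hs

theorem card_coe_finset {S : Type*} (E : Finset S) [Fintype (E : Set S)] :
    Fintype.card (E : Set S) = E.card := by
  rw [← Nat.card_eq_fintype_card, Nat.card_coe_set_eq, ncard_coe_finset]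

theorem ncard_trans_le {α β γ : Type*} [Finite β] (f : α ≃. β) (g : β ≃. γ) :
    {x | f.trans g x ≠ none}.ncard ≤ {y | ∃ z, g y = some z}.ncard := by
  rw [← ncard_image_of_injective {y | ∃ z, g y = some z} (Option.some_injective β)]
  have key : ∀ x ∈ {x | f.trans g x ≠ none}, ∃ y, f x = some y ∧ ∃ z, g y = some z := by
    intro x hx
    obtain ⟨z, hz⟩ := Option.ne_none_iff_exists'.1 hx
    obtain ⟨y, hy, hyz⟩ := (PEquiv.trans_eq_some _ _ _ _).1 hz
    exact ⟨y, hy, z, hyz⟩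
  refine ncard_le_ncard_of_injOn f (fun x hx => ?_) (fun x hx x' hx' e => ?_) (toFinite _)
  · obtain ⟨y, hy, hz⟩ := key x hx
    exact ⟨y, hz, hy.symm⟩
  · obtain ⟨y, hy, -⟩ := key x hx
    exact f.inj hy (e ▸ hy)

/-- The transversal together with a finite set. -/
noncomputable def withTransversal {S : Type*} {k : ℕ} (w : Fin (k + 1) → S) (E : Finset S) :
    Finset S := by
  classical
  exact E ∪ Finset.univ.image w

theorem mem_withTransversal {S : Type*} {k : ℕ} (w : Fin (k + 1) → S) {E : Finset S} {s : S}
    (hs : s ∈ E) : s ∈ withTransversal w E := by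
  classical
  exact Finset.mem_union_left _ hs

theorem apply_mem_withTransversal {S : Type*} {k : ℕ} (w : Fin (k + 1) → S) (E : Finset S)
    (a : Fin (k + 1)) : w a ∈ withTransversal w E := by
  classical
  exact Finset.mem_union_right _ (Finset.mem_image_of_mem _ (Finset.mem_univ _))

end Sofic

/-! ### The two counting inequalities -/

namespace PmpGroupoid

open Sofic

variable {X : Type u} {G : Type v} [MeasurableSpace X] [MeasurableSpace G] {𝒢 : PmpGroupoid X G}
  {A : Set X} {k : ℕ} {w : Fin (k + 1) → Set G} {m : ℕ → ℕ}

/-- The entries of the elements of `E`. -/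
noncomputable def blocks (𝒢 : PmpGroupoid X G) (w : Fin (k + 1) → Set G) (E : Finset (Set G)) :
    Finset (Set G) := by
  classical
  exact (E ×ˢ (Finset.univ : Finset (Fin (k + 1) × Fin (k + 1)))).image
    fun p => 𝒢.block w p.1 p.2.1 p.2.2

theorem block_mem_blocks {E : Finset (Set G)} {s : Set G} (hs : s ∈ E) (a b : Fin (k + 1)) :
    𝒢.block w s a b ∈ 𝒢.blocks w E := by
  classical
  exact Finset.mem_image.2 ⟨(s, a, b), by simpa using hs, rfl⟩

namespace IsTransversal

theorem blocks_subset (hw : 𝒢.IsTransversal A w) {E : Finset (Set G)}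
    (hE : (E : Set (Set G)) ⊆ 𝒢.fullInverseSemigroup) :
    (𝒢.blocks w E : Set (Set G)) ⊆ 𝒢.cornerSemigroup A := by
  classical
  intro s hs
  obtain ⟨⟨s, a, b⟩, h, rfl⟩ := Finset.mem_image.1 hs
  exact hw.block_mem (hE (by simpa using h)) a b

/-- Encode an approximation by the fixed point set of p, the partial bijections V_a obtained by
following the matching with the image of w_a for a ≥ 1, and its compression on the entries. Decoding
through `IsSofic.compress_recover` errs at no more than κ d points for each element of E; this
accounts for the last factor. -/
theorem numRestr_le (hw : 𝒢.IsTransversal A w) (hA : 0 < 𝒢.μ.real A)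
    (hm : Tendsto (fun d => (m d : ℝ) / d) atTop (𝓝 (𝒢.μ.real A)))
    {E : Finset (Set G)} (hE : (E : Set (Set G)) ⊆ 𝒢.fullInverseSemigroup)
    {M' : Finset (Set G)} (hM' : (M' : Set (Set G)) ⊆ 𝒢.cornerSemigroup A)
    {δ' κ : ℝ} (hδ' : 0 < δ') (hκ : 0 < κ) :
    ∃ M : Finset (Set G), (M : Set (Set G)) ⊆ 𝒢.fullInverseSemigroup ∧ ∃ δ : ℝ, 0 < δ ∧ ∃ D,
      ∀ d ≥ D, numRestr (E : Set (Set G)) (𝒢.approx 1 (M : Set (Set G)) δ d) ≤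
        (2 ^ d * (∏ a : Fin k,
          (2 ^ m d * (d + 1) ^ ⌊(𝒢.μ.real (𝒢.src '' w a.succ) + κ) * d⌋₊)) *
          numRestr (𝒢.blocks w E : Set (Set G))
            (𝒢.approx (𝒢.μ.real A) (M' : Set (Set G)) δ' (m d))) *
        (2 ^ d * (d + 1) ^ ⌊κ * d⌋₊) ^ E.card := by
  classical
  have h := isSofic_approxFilter (𝒢 := 𝒢) (f := fun d => d) .fullInverseSemigroup one_pos
    (tendsto_const_nhds.congr' (by
      filter_upwards [eventually_gt_atTop 0] with d hd
      have : (d : ℝ) ≠ 0 := by exact_mod_cast hd.ne'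
      field_simp))
  set l := 𝒢.approxFilter 𝒢.fullInverseSemigroup 1 (fun d => d)
  have hN : Tendsto (fun i => i.1) l atTop := tendsto_fst_approxFilter
  have hm' : Tendsto (fun i : Σ d : ℕ, Set G → (Fin d ≃. Fin d) => (m i.1 : ℝ) / i.1) l
      (𝓝 (𝒢.μ.real A)) := hm.comp hN
  have hZ : Tendsto (dens (fun i : Σ d : ℕ, Set G → (Fin d ≃. Fin d) => i.1)
      (univ : Set (Σ i : Σ d : ℕ, Set G → (Fin d ≃. Fin d), Fin (m i.1)))) l
      (𝓝 (𝒢.μ.real A)) := hm'.congr fun i => (dens_univ_fin i).symm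
  have h1 := (h.compress hw.measurableSet hZ).eventually_mem_approx hA hm' hM' hδ'
  have h2 : ∀ᶠ i in l, ∀ s ∈ E, _ := (Filter.eventually_all_finset E).2 fun s hs =>
    ae_eventually_ncard_le (h.compress_recover hw hZ (hE hs)) hN hκ
  have h3 : ∀ᶠ i in l, ∀ a : Fin k, _ := Filter.eventually_all.2 fun a =>
    dens_eventually_ncard_le (h.dens_dom .fullInverseSemigroup (hw.mem a.succ)) hN
      (lt_add_of_pos_right _ hκ)
  obtain ⟨M, hM, δ, hδ, D, H⟩ := eventually_approxFilter_iff.1 (h1.and (h2.and h3))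
  refine ⟨M, hM, δ, hδ, D, fun d hd => ?_⟩
  -- The zeroth bijection is the chosen matching onto the fixed point set of p. It is determined by
  -- that set, so it costs only 2 ^ d and not a factor of order exp(c d log d).
  let V : Set (Fin d) × (Fin k → (Fin (m d) ≃. Fin d)) → Fin (k + 1) → (Fin (m d) ≃. Fin d) :=
    fun p => Fin.cons (matching univ p.1) p.2
  let dec : (Set (Fin d) × (Fin k → (Fin (m d) ≃. Fin d))) ×
      (↥(𝒢.blocks w E : Set (Set G)) → (Fin (m d) ≃. Fin (m d))) → Set G →
      Fin d → Option (Fin d) := fun p s y =>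
    optionOfRel fun y' => ∃ a b, ∃ x x', V p.1 b x = some y ∧
      extendBot p.2 (𝒢.block w s a b) x = some x' ∧ V p.1 a x' = some y'
  have hcov := ncard_le_of_cover
    (S := (fun (σ : Set G → (Fin d ≃. Fin d)) (e : (E : Set (Set G))) => σ e) ''
      (𝒢.approx 1 (M : Set (Set G)) δ d))
    (((univ : Set (Set (Fin d))) ×ˢ {v : Fin k → (Fin (m d) ≃. Fin d) | ∀ a, v a ∈
      {b : Fin (m d) ≃. Fin d | {x | b x ≠ none}.ncard ≤
        ⌊(𝒢.μ.real (𝒢.src '' w a.succ) + κ) * d⌋₊}}) ×ˢ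
      ((fun (σ : Set G → (Fin (m d) ≃. Fin (m d))) (e : (𝒢.blocks w E : Set (Set G))) => σ e) ''
        (𝒢.approx (𝒢.μ.real A) (M' : Set (Set G)) δ' (m d))))
    (fun p => {τ | ∀ s : (E : Set (Set G)), τ s ∈
      {b : Fin d ≃. Fin d | {x | b x ≠ dec p s x}.ncard ≤ ⌊κ * d⌋₊}})
    ((2 ^ d * (d + 1) ^ ⌊κ * d⌋₊) ^ E.card) ?_ ?_
  · refine hcov.trans (Nat.mul_le_mul_right _ ?_)
    rw [ncard_prod, ncard_prod, ncard_pi_eq]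
    refine Nat.mul_le_mul_right _ (Nat.mul_le_mul ?_ ?_)
    · rw [ncard_univ, Nat.card_eq_fintype_card, Fintype.card_set, Fintype.card_fin]
    · exact Finset.prod_le_prod' fun a _ => ncard_ball_le fun _ => none
  · rintro _ ⟨σ, hσ, rfl⟩
    obtain ⟨g1, g2, g3⟩ := H d hd σ hσ
    let v : Fin k → (Fin (m d) ≃. Fin d) := fun a => (compressMap A 𝒢 σ).trans (σ (w a.succ))
    have hV : ∀ a, V ({y | σ (𝒢.unitSet A) y = some y}, v) a =
        (compressMap A 𝒢 σ).trans (σ (w a)) := by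
      intro a
      refine Fin.cases ?_ (fun a => rfl) a
      exact (hw.compressMap_trans_zero σ).symm
    refine ⟨(({y | σ (𝒢.unitSet A) y = some y}, v),
      fun s => compress A 𝒢 σ s), ⟨⟨mem_univ _, fun a => ?_⟩, ?_⟩, ?_⟩
    -- The domain of V_a is no larger than that of the image of w_a; this bound is what limits the
    -- cost to (1 - c) d log d.
    · exact (ncard_trans_le _ _).trans (g3 a)
    · exact mem_image_of_mem _ g1
    · intro s
      refine le_trans (ncard_le_ncard (fun x hx => ?_) (toFinite _)) (g2 s s.2)
      intro hiff
      refine hx (optionOfRel_eq fun y' => ?_).symm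
      rw [hiff]
      simp only [hV]
      refine exists_congr fun a => exists_congr fun b => exists_congr fun x =>
        exists_congr fun x' => ?_
      rw [extendBot_of_mem _ (block_mem_blocks s.2 a b)]
  · intro p _
    refine (ncard_pi_le_pow (κ := (E : Set (Set G))) _ _ fun s => ncard_ball_le (dec p s)).trans ?_
    rw [card_coe_finset]

theorem withTransversal_subset (hw : 𝒢.IsTransversal A w) {E : Finset (Set G)}
    (hE : (E : Set (Set G)) ⊆ 𝒢.fullInverseSemigroup) :
    (withTransversal w E : Set (Set G)) ⊆ 𝒢.fullInverseSemigroup := by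
  classical
  intro s hs
  rcases Finset.mem_union.1 hs with h | h
  · exact hE h
  · obtain ⟨a, -, rfl⟩ := Finset.mem_image.1 h
    exact hw.mem a

/-- Count pairs of a corner restriction ρ and a permutation π. Send such a pair to the expansion of
ρ conjugated by π, restricted to E and the transversal, together with the placement η of the zeroth
copy. Then ρ is read off through η, and π from η and the images of the w_a, each outside κ d points.
-/
theorem numRestr_mul_factorial_le (hw : 𝒢.IsTransversal A w) (hA : 0 < 𝒢.μ.real A)
    (hm : Tendsto (fun d => (m d : ℝ) / d) atTop (𝓝 (𝒢.μ.real A)))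
    {E : Finset (Set G)} (hE : (E : Set (Set G)) ⊆ 𝒢.cornerSemigroup A)
    {M : Finset (Set G)} (hM : (M : Set (Set G)) ⊆ 𝒢.fullInverseSemigroup)
    {δ κ : ℝ} (hδ : 0 < δ) (hκ : 0 < κ) :
    ∃ M' : Finset (Set G), (M' : Set (Set G)) ⊆ 𝒢.cornerSemigroup A ∧ ∃ δ' : ℝ, 0 < δ' ∧ ∃ D,
      ∀ d ≥ D, numRestr (E : Set (Set G))
          (𝒢.approx (𝒢.μ.real A) (M' : Set (Set G)) δ' (m d)) * d.factorial ≤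
        numRestr (withTransversal w E : Set (Set G)) (𝒢.approx 1 (M : Set (Set G)) δ d) *
          (2 ^ m d * (d + 1) ^ m d) *
          ((2 ^ m d * (m d + 1) ^ ⌊κ * d⌋₊) ^ E.card * (2 ^ d * (d + 1) ^ ⌊κ * d⌋₊)) := by
  classical
  have h := isSofic_approxFilter (𝒢 := 𝒢) (f := m) (.cornerSemigroup (A := A)) hA hm
  set l := 𝒢.approxFilter (𝒢.cornerSemigroup A) (𝒢.μ.real A) m
  have hN : Tendsto (fun i => i.1) l atTop := tendsto_fst_approxFilter
  have hY : Tendsto (dens (fun i : Σ d : ℕ, Set G → (Fin (m d) ≃. Fin (m d)) => i.1)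
      (univ : Set (Σ i : Σ d : ℕ, Set G → (Fin (m d) ≃. Fin (m d)), Fin (m i.1)))) l
      (𝓝 (𝒢.μ.real A)) := (hm.comp hN).congr fun i => (dens_univ_fin i).symm
  have hZ' : Tendsto (fun i : Σ d : ℕ, Set G → (Fin (m d) ≃. Fin (m d)) => (i.1 : ℝ) / i.1) l
      (𝓝 1) := by
    refine tendsto_const_nhds.congr' ?_
    filter_upwards [hN.eventually_gt_atTop 0] with i hi
    have : (i.1 : ℝ) ≠ 0 := by exact_mod_cast hi.ne'
    field_simp
  have hZ : Tendsto (dens (fun i : Σ d : ℕ, Set G → (Fin (m d) ≃. Fin (m d)) => i.1)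
      (univ : Set (Σ i : Σ d : ℕ, Set G → (Fin (m d) ≃. Fin (m d)), Fin i.1))) l
      (𝓝 1) := hZ'.congr fun i => (dens_univ_fin i).symm
  have h1 := (hw.isSofic_expand h hZ).eventually_mem_approx one_pos hZ' hM hδ
  have h2 : ∀ᶠ i in l, ∀ s ∈ E, _ := (Filter.eventually_all_finset E).2 fun s hs =>
    ae_eventually_ncard_le (hw.expand_recover h hZ hY (hE hs)) hN hκ
  have h3 := ae_eventually_ncard_le (hw.expand_transversal h hZ) hN hκ
  obtain ⟨M', hM', δ', hδ', D, H⟩ := eventually_approxFilter_iff.1 (h1.and (h2.and h3))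
  refine ⟨M', hM', δ', hδ', D, fun d hd => ?_⟩
  set R : Set (↥(E : Set (Set G)) → (Fin (m d) ≃. Fin (m d))) :=
    (fun (σ : Set G → (Fin (m d) ≃. Fin (m d))) (e : (E : Set (Set G))) => σ e) ''
      (𝒢.approx (𝒢.μ.real A) (M' : Set (Set G)) δ' (m d)) with hR
  have hrep : ∀ ρ ∈ R, ∃ σ ∈ 𝒢.approx (𝒢.μ.real A) (M' : Set (Set G)) δ' (m d),
      (fun e : (E : Set (Set G)) => σ e) = ρ := fun ρ hρ => hρ
  -- One representative is fixed for each restriction, so the matching Θ depends on ρ alone and is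
  -- known once ρ is.
  choose! rep hrep1 hrep2 using hrep
  let F : Finset (Set G) := withTransversal w E
  let Θ : (Set G → (Fin (m d) ≃. Fin (m d))) → (Fin (k + 1) × Fin (m d)) ≃. Fin d :=
    fun σ => 𝒢.expandMap w σ
  let dec₁ : (↥(F : Set (Set G)) → (Fin d ≃. Fin d)) × (Fin (m d) ≃. Fin d) → Set G →
      Fin (m d) → Option (Fin (m d)) := fun p s y =>
    optionOfRel fun y' => ∃ x x', p.2 y = some x ∧ extendBot p.1 s x = some x' ∧ p.2 y' = some x'
  let dec₂ : (↥(F : Set (Set G)) → (Fin d ≃. Fin d)) × (Fin (m d) ≃. Fin d) →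
      (Set G → (Fin (m d) ≃. Fin (m d))) → Fin d → Option (Fin d) := fun p σ x =>
    optionOfRel fun x' => ∃ a y v, Θ σ (a, y) = some x ∧ p.2 y = some v ∧
      extendBot p.1 (w a) v = some x'
  have hcov := ncard_le_of_cover (S := R ×ˢ (univ : Set (Equiv.Perm (Fin d))))
    (((fun (σ : Set G → (Fin d ≃. Fin d)) (e : (F : Set (Set G))) => σ e) ''
      (𝒢.approx 1 (M : Set (Set G)) δ d)) ×ˢ (univ : Set (Fin (m d) ≃. Fin d)))
    (fun p => {q | (∀ s : (E : Set (Set G)), q.1 s ∈ {b : Fin (m d) ≃. Fin (m d) |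
        {x | b x ≠ dec₁ p s x}.ncard ≤ ⌊κ * d⌋₊}) ∧
      q.2.toPEquiv ∈ {b : Fin d ≃. Fin d | {x | b x ≠ dec₂ p (rep q.1) x}.ncard ≤ ⌊κ * d⌋₊}})
    ((2 ^ m d * (m d + 1) ^ ⌊κ * d⌋₊) ^ E.card * (2 ^ d * (d + 1) ^ ⌊κ * d⌋₊)) ?_ ?_
  · have e1 : (univ : Set (Equiv.Perm (Fin d))).ncard = d.factorial := by
      rw [ncard_univ, Nat.card_eq_fintype_card, Fintype.card_perm, Fintype.card_fin]
    rw [ncard_prod, ncard_prod, e1] at hcov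
    exact hcov.trans (Nat.mul_le_mul_right _ (Nat.mul_le_mul_left _ ncard_ball_univ))
  · rintro ⟨ρ, π⟩ ⟨hρ, -⟩
    obtain ⟨g1, g2, g3⟩ := H d hd (rep ρ) (hrep1 ρ hρ)
    -- η sends y to π Θ(0, y). It has at most 2 ^ m (d + 1) ^ m values, which is the c d log d to be
    -- subtracted from log d!.
    let η : Fin (m d) ≃. Fin d := (slice 0).trans ((Θ (rep ρ)).trans π.toPEquiv)
    have hη : ∀ y x, η y = some x ↔ Θ (rep ρ) (0, y) = some (π.symm x) := by
      intro y x
      simp only [η, PEquiv.trans_eq_some, slice_apply, Option.some_inj, exists_eq_left',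
        Equiv.toPEquiv_apply]
      constructor
      · rintro ⟨z, hz, rfl⟩
        rw [hz, Equiv.symm_apply_apply]
      · intro hz
        exact ⟨_, hz, Equiv.apply_symm_apply _ _⟩
    have hΨ : ∀ s x x', conj π (𝒢.expand w (rep ρ) s) x = some x' ↔
        𝒢.expand w (Z := Fin d) (rep ρ) s (π.symm x) = some (π.symm x') := by
      intro s x x'
      have := conj_eq_some π (𝒢.expand w (Z := Fin d) (rep ρ) s) (π.symm x) (π.symm x')
      rwa [Equiv.apply_symm_apply, Equiv.apply_symm_apply] at this
    refine ⟨(fun s => conj π (𝒢.expand w (rep ρ) s), η), ⟨?_, mem_univ _⟩, ?_, ?_⟩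
    · exact mem_image_of_mem _ (conj_mem_approx g1 π)
    · intro s
      refine le_trans (ncard_le_ncard (fun y hy => ?_) (toFinite _)) (g2 s s.2)
      intro hiff
      refine hy (optionOfRel_eq fun y' => ?_).symm
      have hs : ρ s = rep ρ s := congrFun (hrep2 ρ hρ).symm s
      change ρ s y = some y' ↔ _
      rw [hs, hiff]
      simp only [hη]
      rw [extendBot_of_mem (fun s => conj π (𝒢.expand w (rep ρ) s))
        (mem_withTransversal w s.2)]
      simp only [hΨ]
      constructor
      · rintro ⟨x, x', h1, h2, h3⟩
        exact ⟨π x, π x', by simpa using h1, by simpa using h2, by simpa using h3⟩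
      · rintro ⟨x, x', h1, h2, h3⟩
        exact ⟨_, _, h1, h2, h3⟩
    · refine le_trans (ncard_le_ncard (fun x hx => ?_) (toFinite _)) g3
      rintro ⟨a, y, x₀, h1, h2, h3⟩
      refine hx (optionOfRel_eq fun x' => ?_).symm
      change some (π x) = some x' ↔ _
      have hF : ∀ a, extendBot (fun s : (F : Set (Set G)) => conj π (𝒢.expand w (rep ρ) s))
          (w a) = conj π (𝒢.expand w (rep ρ) (w a)) := fun a =>
        extendBot_of_mem (fun s => conj π (𝒢.expand w (rep ρ) s))
          (apply_mem_withTransversal w E a)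
      -- If x = Θ(a, y), then π x is the image of η y under the conjugated w_a. The pair (a, y) is
      -- determined by x because Θ is injective.
      simp only [hη, hF, hΨ]
      constructor
      · rintro h
        obtain rfl : π x = x' := Option.some_injective _ h
        exact ⟨a, y, π x₀, h1, by simpa using h2, by simpa using h3⟩
      · rintro ⟨a', y', v, k1, k2, k3⟩
        have e1 : (a, y) = (a', y') := (Θ (rep ρ)).inj h1 k1
        obtain ⟨rfl, rfl⟩ := Prod.mk.inj e1
        have e2 : x₀ = π.symm v := Option.some_injective _ (h2.symm.trans k2)
        rw [← e2, h3] at k3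
        have e3 : x = π.symm x' := Option.some_injective _ k3
        change some (π x) = some x'
        rw [e3, Equiv.apply_symm_apply]
  · intro p _
    -- The decoder for π uses ρ, so first count the possible ρ and then, for each of them, the
    -- possible π.
    have hcov' := ncard_le_of_cover
      (S := {q : (↥(E : Set (Set G)) → (Fin (m d) ≃. Fin (m d))) × Equiv.Perm (Fin d) |
        (∀ s : (E : Set (Set G)), q.1 s ∈ {b : Fin (m d) ≃. Fin (m d) |
          {x | b x ≠ dec₁ p s x}.ncard ≤ ⌊κ * d⌋₊}) ∧
        q.2.toPEquiv ∈ {b : Fin d ≃. Fin d | {x | b x ≠ dec₂ p (rep q.1) x}.ncard ≤ ⌊κ * d⌋₊}})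
      {ρ | ∀ s : (E : Set (Set G)), ρ s ∈ {b : Fin (m d) ≃. Fin (m d) |
          {x | b x ≠ dec₁ p s x}.ncard ≤ ⌊κ * d⌋₊}}
      (fun ρ => {q | q.1 = ρ ∧ q.2.toPEquiv ∈ {b : Fin d ≃. Fin d |
        {x | b x ≠ dec₂ p (rep ρ) x}.ncard ≤ ⌊κ * d⌋₊}})
      (2 ^ d * (d + 1) ^ ⌊κ * d⌋₊) (fun q hq => ⟨q.1, hq.1, rfl, hq.2⟩) (fun ρ _ => ?_)
    · refine hcov'.trans (Nat.mul_le_mul_right _ ?_)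
      refine (ncard_pi_le_pow (κ := (E : Set (Set G))) _ _ fun s => ncard_ball_le (dec₁ p s)).trans ?_
      rw [card_coe_finset]
    · refine le_trans ?_ (ncard_ball_le (r := ⌊κ * d⌋₊) (dec₂ p (rep ρ)))
      refine ncard_le_ncard_of_injOn (fun q => q.2.toPEquiv) (fun q hq => hq.2) ?_ (toFinite _)
      rintro ⟨ρ₁, π₁⟩ ⟨h1, -⟩ ⟨ρ₂, π₂⟩ ⟨h2, -⟩ e
      have h1 : ρ₁ = ρ := h1
      have h2 : ρ₂ = ρ := h2
      refine Prod.ext (h1.trans h2.symm) (Equiv.ext fun x => ?_)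
      have e' : π₁.toPEquiv x = π₂.toPEquiv x := by rw [show π₁.toPEquiv = π₂.toPEquiv from e]
      exact Option.some_injective _ e'

end IsTransversal

end PmpGroupoid

/-! ### Logarithmic asymptotics -/

namespace Sofic

/-- `log n / (d log d)`, with `log 0 = -∞`. -/
noncomputable def ratio (n : ℕ) (d : ℕ) : EReal :=
  ENNReal.log (n : ℝ≥0∞) / ((d * Real.log d : ℝ) : EReal)

theorem ratio_eq_coe {n d : ℕ} (hn : n ≠ 0) :
    ratio n d = ((Real.log n / (d * Real.log d) : ℝ) : EReal) := by
  unfold ratio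
  rw [ENNReal.log_pos_real (by exact_mod_cast hn) (by simp), EReal.coe_div]
  simp

theorem mul_log_pos {d : ℕ} (hd : 2 ≤ d) : 0 < (d : ℝ) * Real.log d := by
  have : (1 : ℝ) < d := by exact_mod_cast hd
  have := Real.log_pos this
  positivity

theorem ratio_zero {d : ℕ} (hd : 2 ≤ d) : ratio 0 d = ⊥ := by
  unfold ratio
  rw [Nat.cast_zero, ENNReal.log_zero]
  exact EReal.bot_div_of_pos_ne_top (EReal.coe_pos.2 (mul_log_pos hd)) (EReal.coe_ne_top _)

theorem tendsto_inv_log : Tendsto (fun d : ℕ => (Real.log d)⁻¹) atTop (𝓝 0) :=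
  (Real.tendsto_log_atTop.comp tendsto_natCast_atTop_atTop).inv_tendsto_atTop

theorem log_two_pow_mul_pow_floor_le {a b d : ℕ} (hb : b ≤ d) (hd : 2 ≤ d) {x : ℝ} (hx : 0 ≤ x) :
    Real.log ((2 ^ a * (b + 1) ^ ⌊x⌋₊ : ℕ) : ℝ) ≤ a + x * (Real.log d + 1) := by
  have hd' : (2 : ℝ) ≤ d := by exact_mod_cast hd
  have hb' : (b : ℝ) ≤ d := by exact_mod_cast hb
  have h2 : Real.log 2 ≤ 1 := Real.log_two_lt_d9.le.trans (by norm_num)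
  have h3 : Real.log (b + 1) ≤ Real.log d + 1 := by
    refine le_trans ?_ (add_le_add_right h2 _)
    rw [← Real.log_mul (by positivity) (by norm_num)]
    exact Real.log_le_log (by positivity) (by linarith)
  push_cast
  rw [Real.log_mul (by positivity) (by positivity), Real.log_pow, Real.log_pow]
  have h4 : (0 : ℝ) ≤ Real.log (b + 1) := Real.log_nonneg (by simp)
  gcongr
  · exact mul_le_of_le_one_right (by positivity) h2
  · exact Nat.floor_le hx

theorem floor_mul_le {c : ℝ} (hc1 : c ≤ 1) (d : ℕ) : ⌊c * d⌋₊ ≤ d := by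
  refine (Nat.floor_le_floor (mul_le_of_le_one_left (by positivity) hc1)).trans ?_
  rw [Nat.floor_natCast]

theorem tendsto_floor_mul {c : ℝ} (hc : 0 < c) :
    Tendsto (fun d : ℕ => ⌊c * d⌋₊) atTop atTop :=
  tendsto_nat_floor_atTop.comp (tendsto_natCast_atTop_atTop.const_mul_atTop hc)

theorem tendsto_floor_mul_div {c : ℝ} (hc : 0 ≤ c) :
    Tendsto (fun d : ℕ => (⌊c * d⌋₊ : ℝ) / d) atTop (𝓝 c) :=
  (tendsto_nat_floor_mul_div_atTop hc).comp tendsto_natCast_atTop_atTop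

/-- Logarithmic form of an upper bound on the number of approximations. -/
theorem ratio_le_of_le {c : ℝ} (hc : 0 < c) (hc1 : c ≤ 1) {k e : ℕ} {p : Fin k → ℝ}
    (hp : ∀ a, 0 ≤ p a) (hp1 : ∑ a, p a = 1 - c) {κ ε : ℝ} (hκ : 0 < κ)
    (hε : (k + e) * κ < ε) {n n' : ℕ → ℕ}
    (h : ∀ᶠ d : ℕ in atTop, n d ≤ (2 ^ d * (∏ a : Fin k,
          (2 ^ ⌊c * d⌋₊ * (d + 1) ^ ⌊(p a + κ) * d⌋₊)) * n' d) *
        (2 ^ d * (d + 1) ^ ⌊κ * d⌋₊) ^ e) :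
    ∀ᶠ d : ℕ in atTop, ratio (n d) d ≤ (c : EReal) * ratio (n' d) ⌊c * d⌋₊ +
      ((1 - c + ε : ℝ) : EReal) := by
  -- Λ is the total exponent of (d + 1) divided by d: the sum of the p a + κ, plus κ for each of the
  -- e elements. Powers of 2 and the passage from log (d + 1) to log d contribute only O(d).
  set Λ : ℝ := 1 - c + (k + e) * κ with hΛ
  have hlim : Tendsto (fun d : ℕ => (1 + k + e + Λ) * (Real.log d)⁻¹ + Λ) atTop (𝓝 Λ) := by
    simpa using (tendsto_inv_log.const_mul (1 + k + e + Λ)).add_const Λ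
  filter_upwards [h, hlim.eventually (gt_mem_nhds (show Λ < 1 - c + ε by linarith)),
    eventually_ge_atTop 2, (tendsto_floor_mul hc).eventually_ge_atTop 2] with d h hl hd hm
  by_cases hn : n d = 0
  · rw [hn, ratio_zero hd]
    exact bot_le
  have hn' : n' d ≠ 0 := by
    intro h0
    rw [h0] at h
    simp at h
    exact hn h
  rw [ratio_eq_coe hn, ratio_eq_coe hn', ← EReal.coe_mul, ← EReal.coe_add, EReal.coe_le_coe_iff]
  have hmd := floor_mul_le hc1 d
  have hmc : (⌊c * d⌋₊ : ℝ) ≤ c * d := Nat.floor_le (by positivity)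
  set m := ⌊c * d⌋₊
  have hD := mul_log_pos hd
  have hM := mul_log_pos hm
  have hd0 : (0 : ℝ) < d := by positivity
  have hld : 0 < Real.log d := pos_of_mul_pos_right hD hd0.le
  have hlm : Real.log m ≤ Real.log d :=
    Real.log_le_log (by positivity) (by exact_mod_cast hmd)
  have hlm0 : 0 < Real.log m := pos_of_mul_pos_right hM (by positivity)
  have hln' : 0 ≤ Real.log (n' d) := Real.log_natCast_nonneg _
  have h1 : Real.log (n d) ≤ Real.log (n' d) + (1 + k + e + Λ) * d + Λ * (d * Real.log d) := by
    have h2 : Real.log (n d) ≤ _ :=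
      Real.log_le_log (by exact_mod_cast Nat.pos_of_ne_zero hn) (Nat.cast_le.2 h)
    have h3 : Real.log ((∏ a : Fin k, (2 ^ m * (d + 1) ^ ⌊(p a + κ) * d⌋₊) : ℕ) : ℝ) ≤
        ∑ a : Fin k, ((d : ℝ) + (p a + κ) * d * (Real.log d + 1)) := by
      rw [Nat.cast_prod, Real.log_prod (fun a _ => by positivity)]
      refine Finset.sum_le_sum fun a _ => ?_
      refine (log_two_pow_mul_pow_floor_le le_rfl hd
        (by have := hp a; positivity)).trans ?_
      gcongr
    have h4 := log_two_pow_mul_pow_floor_le (a := d) (x := κ * d) le_rfl hd (by positivity)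
    have h5 : Real.log ((2 ^ d : ℕ) : ℝ) ≤ d := by
      push_cast
      rw [Real.log_pow]
      exact mul_le_of_le_one_right hd0.le (Real.log_two_lt_d9.le.trans (by norm_num))
    have h6 : ∑ a : Fin k, ((d : ℝ) + (p a + κ) * d * (Real.log d + 1)) =
        k * d + (1 - c + k * κ) * d * (Real.log d + 1) := by
      rw [Finset.sum_add_distrib, ← Finset.sum_mul, ← Finset.sum_mul, Finset.sum_add_distrib, hp1]
      simp
    rw [Nat.cast_mul, Nat.cast_mul, Nat.cast_mul, Nat.cast_pow _ e,
      Real.log_mul (by have : (n' d : ℝ) ≠ 0 := by exact_mod_cast hn'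
                       positivity) (by positivity),
      Real.log_mul (by positivity) (by exact_mod_cast hn'),
      Real.log_mul (by positivity) (by positivity), Real.log_pow] at h2
    have h7 := mul_le_mul_of_nonneg_left h4 (Nat.cast_nonneg (α := ℝ) e)
    have h8 : Λ * d + Λ * (d * Real.log d) = (1 - c + k * κ) * d * (Real.log d + 1) +
      e * (κ * d * (Real.log d + 1)) := by rw [hΛ]; ring
    linarith
  -- Since log n' is nonnegative, the inequality m log m ≤ c d log d suffices here; no asymptotic
  -- equality is needed.
  have h9 : Real.log (n' d) / (d * Real.log d) ≤ c * (Real.log (n' d) / (m * Real.log m)) := by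
    rw [← mul_div_assoc, div_le_div_iff₀ hD hM]
    have : (m : ℝ) * Real.log m ≤ c * d * Real.log d := by gcongr
    nlinarith
  have h10 : Real.log (n d) / (d * Real.log d) ≤
      Real.log (n' d) / (d * Real.log d) + ((1 + k + e + Λ) * (Real.log d)⁻¹ + Λ) := by
    have : Real.log (n' d) / (d * Real.log d) + ((1 + k + e + Λ) * (Real.log d)⁻¹ + Λ) =
      (Real.log (n' d) + (1 + k + e + Λ) * d + Λ * (d * Real.log d)) / (d * Real.log d) := by
      field_simp
      ring
    rw [this]
    gcongr
  linarith

/-- log ⌊c d⌋ differs from log d by log (⌊c d⌋ / d), which converges to log c and so is negligible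
against log d. -/
theorem tendsto_floor_mul_log {c : ℝ} (hc : 0 < c) :
    Tendsto (fun d : ℕ => (⌊c * d⌋₊ * Real.log ⌊c * d⌋₊ : ℝ) / (d * Real.log d)) atTop (𝓝 c) := by
  have h1 := tendsto_floor_mul_div hc.le
  have h2 : Tendsto (fun d : ℕ => 1 + Real.log ((⌊c * d⌋₊ : ℝ) / d) * (Real.log d)⁻¹) atTop
      (𝓝 1) := by
    simpa using ((h1.log hc.ne').mul tendsto_inv_log).const_add 1
  have h3 := h1.mul h2
  rw [mul_one] at h3
  refine h3.congr' ?_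
  filter_upwards [eventually_ge_atTop 2, (tendsto_floor_mul hc).eventually_ge_atTop 2] with d hd hm
  have hd0 : (d : ℝ) ≠ 0 := by positivity
  have hm0 : (⌊c * d⌋₊ : ℝ) ≠ 0 := by positivity
  have hl : Real.log d ≠ 0 := (pos_of_mul_pos_right (mul_log_pos hd) (by positivity)).ne'
  rw [Real.log_div hm0 hd0]
  field_simp
  ring

/-- A single term of the exponential series, d ^ d / d! ≤ exp d. -/
theorem mul_log_sub_le_log_factorial (d : ℕ) :
    (d : ℝ) * Real.log d - d ≤ Real.log (d.factorial : ℝ) := by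
  rcases Nat.eq_zero_or_pos d with rfl | hd
  · simp
  have hd0 : (0 : ℝ) < d := by exact_mod_cast hd
  have h := Real.pow_div_factorial_le_exp d hd0.le d
  have h2 := Real.log_le_log (by positivity) h
  rw [Real.log_exp, Real.log_div (by positivity) (by positivity), Real.log_pow] at h2
  linarith

/-- Logarithmic form of a lower bound on the number of approximations. -/
theorem le_ratio_of_le {c : ℝ} (hc : 0 < c) (hc1 : c ≤ 1) {e : ℕ} {κ ε : ℝ} (hκ : 0 < κ)
    (hε : (e + 1) * κ < ε) {n n' : ℕ → ℕ}
    (hn' : ∀ d, n' d ≤ (2 ^ ⌊c * d⌋₊ * (⌊c * d⌋₊ + 1) ^ ⌊c * d⌋₊) ^ e)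
    (h : ∀ᶠ d : ℕ in atTop, n' d * d.factorial ≤ n d * (2 ^ ⌊c * d⌋₊ * (d + 1) ^ ⌊c * d⌋₊) *
      ((2 ^ ⌊c * d⌋₊ * (⌊c * d⌋₊ + 1) ^ ⌊κ * d⌋₊) ^ e * (2 ^ d * (d + 1) ^ ⌊κ * d⌋₊))) :
    ∀ᶠ d : ℕ in atTop, (c : EReal) * ratio (n' d) ⌊c * d⌋₊ + ((1 - c - ε : ℝ) : EReal) ≤
      ratio (n d) d := by
  set Λ : ℝ := c + (e + 1) * κ with hΛ
  -- In this direction replacing m log m by c d log d costs an error, controlled by the a priori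
  -- bound 3 e on the ratio of n'. The 3 in 3 + e collects one power of 2 for the placement, one for
  -- the permutation, and the loss d in log d!.
  have hlim : Tendsto (fun d : ℕ => ((3 + e + Λ) * (Real.log d)⁻¹ + Λ) +
      |c - (⌊c * d⌋₊ * Real.log ⌊c * d⌋₊ : ℝ) / (d * Real.log d)| * (e * 3)) atTop (𝓝 Λ) := by
    simpa using ((tendsto_inv_log.const_mul (3 + e + Λ)).add_const Λ).add
      (((tendsto_floor_mul_log hc).const_sub c).abs.mul_const ((e : ℝ) * 3))
  filter_upwards [h, hlim.eventually (gt_mem_nhds (show Λ < c + ε by linarith)),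
    eventually_ge_atTop 2, (tendsto_floor_mul hc).eventually_ge_atTop 3] with d h hl hd hm
  by_cases hn0 : n' d = 0
  · rw [hn0, ratio_zero (by omega), EReal.coe_mul_bot_of_pos hc, EReal.bot_add]
    exact bot_le
  have hn : n d ≠ 0 := by
    intro h0
    rw [h0] at h
    simp only [zero_mul, nonpos_iff_eq_zero, mul_eq_zero, hn0, false_or] at h
    exact d.factorial_ne_zero h
  rw [ratio_eq_coe hn, ratio_eq_coe hn0, ← EReal.coe_mul, ← EReal.coe_add,
    EReal.coe_le_coe_iff]
  have hmd := floor_mul_le hc1 d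
  have hmc : (⌊c * d⌋₊ : ℝ) ≤ c * d := Nat.floor_le (by positivity)
  have hn'd := hn' d
  set m := ⌊c * d⌋₊ with hmdef
  have hD := mul_log_pos hd
  have hM := mul_log_pos (show 2 ≤ m by omega)
  have hd0 : (0 : ℝ) < d := by positivity
  have hm0 : (0 : ℝ) < m := by positivity
  have hmd' : (m : ℝ) ≤ d := by exact_mod_cast hmd
  have hld : 0 < Real.log d := pos_of_mul_pos_right hD hd0.le
  -- m ≥ 3 exceeds the base of natural logarithms, so m is at most m log m; this produces the
  -- constant 3 in the a priori bound.
  have hlm0 : 1 ≤ Real.log m := by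
    rw [Real.le_log_iff_exp_le hm0]
    have : (3 : ℝ) ≤ m := by exact_mod_cast hm
    linarith [Real.exp_one_lt_d9]
  have hln' : 0 ≤ Real.log (n' d) := Real.log_natCast_nonneg _
  have h1 : Real.log (n' d) + (d * Real.log d - d) ≤
      Real.log (n d) + (2 + e + Λ) * d + Λ * (d * Real.log d) := by
    have h2 := Real.log_le_log (by
      exact_mod_cast Nat.mul_pos (Nat.pos_of_ne_zero hn0) d.factorial_pos) (Nat.cast_le (α := ℝ).2 h)
    rw [Nat.cast_mul, Nat.cast_mul, Nat.cast_mul, Nat.cast_mul _ (2 ^ d * _), Nat.cast_pow _ e,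
      Real.log_mul (by exact_mod_cast hn0) (by positivity),
      Real.log_mul (by have : (n d : ℝ) ≠ 0 := by exact_mod_cast hn
                       positivity) (by positivity),
      Real.log_mul (by exact_mod_cast hn) (by positivity),
      Real.log_mul (by positivity) (by positivity), Real.log_pow] at h2
    have h3 := log_two_pow_mul_pow_floor_le (a := m) (x := c * d) le_rfl hd (by positivity)
    have h4 := log_two_pow_mul_pow_floor_le (a := m) (x := κ * d) hmd hd (by positivity)
    have h5 := log_two_pow_mul_pow_floor_le (a := d) (x := κ * d) le_rfl hd (by positivity)
    rw [← hmdef] at h3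
    have h6 := mul_log_sub_le_log_factorial d
    have h7 := mul_le_mul_of_nonneg_left (h4.trans (add_le_add_left hmd' _))
      (Nat.cast_nonneg (α := ℝ) e)
    have h8 : Λ * d + Λ * (d * Real.log d) = c * d * (Real.log d + 1) +
      e * (κ * d * (Real.log d + 1)) + κ * d * (Real.log d + 1) := by rw [hΛ]; ring
    linarith
  have h9 : Real.log (n' d) / (m * Real.log m) ≤ e * 3 := by
    rw [div_le_iff₀ hM]
    have h2 := Real.log_le_log (by exact_mod_cast Nat.pos_of_ne_zero hn0)
      (Nat.cast_le (α := ℝ).2 hn'd)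
    have h3 := log_two_pow_mul_pow_floor_le (a := m) (x := m) le_rfl (show 2 ≤ m by omega)
      (by positivity)
    rw [Nat.floor_natCast] at h3
    rw [Nat.cast_pow, Real.log_pow] at h2
    refine h2.trans ?_
    rw [mul_assoc]
    refine mul_le_mul_of_nonneg_left (h3.trans ?_) (by positivity)
    nlinarith
  have h10 : c * (Real.log (n' d) / (m * Real.log m)) - Real.log (n' d) / (d * Real.log d) ≤
      |c - (m * Real.log m : ℝ) / (d * Real.log d)| * (e * 3) := by
    have : c * (Real.log (n' d) / (m * Real.log m)) - Real.log (n' d) / (d * Real.log d) =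
        (c - (m * Real.log m : ℝ) / (d * Real.log d)) * (Real.log (n' d) / (m * Real.log m)) := by
      field_simp
    rw [this]
    exact mul_le_mul (le_abs_self _) h9 (by positivity) (abs_nonneg _)
  have h11 : Real.log (n' d) / (d * Real.log d) + 1 ≤ Real.log (n d) / (d * Real.log d) +
      ((3 + e + Λ) * (Real.log d)⁻¹ + Λ) := by
    have e1 : Real.log (n d) / (d * Real.log d) + ((3 + e + Λ) * (Real.log d)⁻¹ + Λ) =
      (Real.log (n d) + (3 + e + Λ) * d + Λ * (d * Real.log d)) / (d * Real.log d) := by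
      field_simp
      ring
    have e2 : Real.log (n' d) / (d * Real.log d) + 1 =
      (Real.log (n' d) + d * Real.log d) / (d * Real.log d) := by
      field_simp
    rw [e1, e2]
    exact div_le_div_of_nonneg_right (by linarith) hD.le
  linarith

end Sofic

/-! ### Affine maps of the extended reals and notions of limit -/

namespace Sofic

section Affine

/-- The order isomorphism `y ↦ c y + a` of the extended reals. -/
noncomputable def affineIso (c a : ℝ) (hc : 0 < c) : EReal ≃o EReal :=
  Equiv.toOrderIso
    { toFun := fun y => (c : EReal) * y + a
      invFun := fun y => ((c⁻¹ : ℝ) : EReal) * (y - a)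
      left_inv := by
        intro y
        induction y with
        | bot => simp [EReal.coe_mul_bot_of_pos hc, EReal.coe_mul_bot_of_pos (inv_pos.2 hc)]
        | top => simp [EReal.coe_mul_top_of_pos hc, EReal.coe_mul_top_of_pos (inv_pos.2 hc)]
        | coe y =>
          beta_reduce
          rw [← EReal.coe_mul, ← EReal.coe_add, ← EReal.coe_sub, ← EReal.coe_mul,
            add_sub_cancel_right, inv_mul_cancel_left₀ hc.ne']
      right_inv := by
        intro y
        induction y with
        | bot => simp [EReal.coe_mul_bot_of_pos hc, EReal.coe_mul_bot_of_pos (inv_pos.2 hc)]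
        | top => simp [EReal.coe_mul_top_of_pos hc, EReal.coe_mul_top_of_pos (inv_pos.2 hc)]
        | coe y =>
          beta_reduce
          rw [← EReal.coe_sub, ← EReal.coe_mul, ← EReal.coe_mul, ← EReal.coe_add,
            mul_inv_cancel_left₀ hc.ne', sub_add_cancel] }
    (fun x y h => add_le_add_left
      (mul_le_mul_of_nonneg_left h (EReal.coe_nonneg.2 hc.le)) _)
    (fun x y h => mul_le_mul_of_nonneg_left (EReal.sub_le_sub h le_rfl)
      (EReal.coe_nonneg.2 (inv_pos.2 hc).le))

theorem affineIso_apply {c a : ℝ} (hc : 0 < c) (y : EReal) :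
    affineIso c a hc y = (c : EReal) * y + a := rfl

theorem affineIso_sub_one {c : ℝ} (hc : 0 < c) (y : EReal) :
    affineIso c (1 - c) hc y - 1 = (c : EReal) * (y - 1) := by
  rw [affineIso_apply]
  induction y with
  | bot => simp [EReal.coe_mul_bot_of_pos hc]
  | top =>
    rw [EReal.coe_mul_top_of_pos hc, EReal.top_add_coe]
    have : (⊤ : EReal) - 1 = ⊤ := EReal.top_sub_coe 1
    rw [this, EReal.coe_mul_top_of_pos hc]
  | coe y =>
    norm_cast
    ring

theorem le_of_forall_pos_le_add_coe {x y : EReal} (h : ∀ ε : ℝ, 0 < ε → x ≤ y + ε) : x ≤ y := by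
  induction y with
  | bot => simpa using h 1 one_pos
  | top => exact le_top
  | coe y =>
    refine EReal.le_of_forall_lt_iff_le.1 fun z hz => ?_
    have h1 := h (z - y) (sub_pos.2 (EReal.coe_lt_coe_iff.1 hz))
    rwa [← EReal.coe_add, add_sub_cancel] at h1

end Affine

section Limits

/-- As c ≤ 1, every n is attained, at d = ⌈n / c⌉, because n ≤ c d < n + c. Upper and lower limits
along ⌊c d⌋ are therefore those along all integers. -/
theorem map_floor_mul_atTop {c : ℝ} (hc : 0 < c) (hc1 : c ≤ 1) :
    map (fun d : ℕ => ⌊c * d⌋₊) atTop = atTop := by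
  refine le_antisymm (tendsto_floor_mul hc) fun s hs => ?_
  obtain ⟨N, hN⟩ := mem_atTop_sets.1 (mem_map.1 hs)
  refine mem_atTop_sets.2 ⟨⌊c * N⌋₊ + 1, fun n hn => ?_⟩
  have h1 : ⌊c * (⌈n / c⌉₊ : ℕ)⌋₊ = n := by
    rw [Nat.floor_eq_iff (by positivity)]
    have h2 := Nat.le_ceil ((n : ℝ) / c)
    have h3 := Nat.ceil_lt_add_one (show 0 ≤ (n : ℝ) / c by positivity)
    rw [div_le_iff₀ hc] at h2
    have h4 := mul_lt_mul_of_pos_left h3 hc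
    rw [mul_add, mul_div_cancel₀ _ hc.ne'] at h4
    constructor <;> linarith
  rw [← h1]
  refine hN _ (le_of_not_gt fun h => ?_)
  have : ⌊c * (⌈n / c⌉₊ : ℕ)⌋₊ ≤ ⌊c * N⌋₊ := by
    gcongr
  omega

/-- The compatibility of the notions of limit `L` and `L'` needed to compare dimensions. -/
structure LimitPair (c : ℝ) (L L' : (ℕ → EReal) → EReal) : Prop where
  mono : ∀ f g : ℕ → EReal, (∀ᶠ d in atTop, f d ≤ g d) → L f ≤ L g
  mono' : ∀ f g : ℕ → EReal, (∀ᶠ d in atTop, f d ≤ g d) → L' f ≤ L' g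
  affine : ∀ (f : ℕ → EReal) (a : ℝ),
    L (fun d => (c : EReal) * f ⌊c * d⌋₊ + a) = (c : EReal) * L' f + a

theorem limitPair_limsup {c : ℝ} (hc : 0 < c) (hc1 : c ≤ 1) :
    LimitPair c (fun f => limsup f atTop) (fun f => limsup f atTop) where
  mono _ _ h := limsup_le_limsup h
  mono' _ _ h := limsup_le_limsup h
  affine f a := by
    have h := (affineIso c a hc).limsup_apply (u := fun d : ℕ => f ⌊c * d⌋₊) (f := atTop)
    have h2 : limsup (fun d : ℕ => f ⌊c * d⌋₊) atTop = limsup f atTop := by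
      conv_rhs => rw [← map_floor_mul_atTop hc hc1]
      rfl
    rw [h2] at h
    exact h.symm

theorem limitPair_liminf {c : ℝ} (hc : 0 < c) (hc1 : c ≤ 1) :
    LimitPair c (fun f => liminf f atTop) (fun f => liminf f atTop) where
  mono _ _ h := liminf_le_liminf h
  mono' _ _ h := liminf_le_liminf h
  affine f a := by
    have h := (affineIso c a hc).liminf_apply (u := fun d : ℕ => f ⌊c * d⌋₊) (f := atTop)
    have h2 : liminf (fun d : ℕ => f ⌊c * d⌋₊) atTop = liminf f atTop := by
      conv_rhs => rw [← map_floor_mul_atTop hc hc1]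
      rfl
    rw [h2] at h
    exact h.symm

theorem limUnder_mono {ω : Ultrafilter ℕ} (hω : (ω : Filter ℕ) ≤ atTop) {f g : ℕ → EReal}
    (h : ∀ᶠ d in atTop, f d ≤ g d) :
    limUnder (ω : Filter ℕ) f ≤ limUnder (ω : Filter ℕ) g :=
  le_of_tendsto_of_tendsto (PmpGroupoid.tendsto_limUnder_ultrafilter ω f)
    (PmpGroupoid.tendsto_limUnder_ultrafilter ω g) (h.filter_mono hω)

theorem rescaleUltrafilter_le {c : ℝ} (hc : 0 < c) {ω : Ultrafilter ℕ}
    (hω : (ω : Filter ℕ) ≤ atTop) : (rescaleUltrafilter c ω : Filter ℕ) ≤ atTop :=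
  (tendsto_floor_mul hc).mono_left hω

/-- Along an ultrafilter the subsequence ⌊c d⌋ need not have the same limit, so the corner uses the
image ultrafilter. -/
theorem limitPair_limUnder {c : ℝ} (hc : 0 < c) {ω : Ultrafilter ℕ}
    (hω : (ω : Filter ℕ) ≤ atTop) :
    LimitPair c (fun f => limUnder (ω : Filter ℕ) f)
      (fun f => limUnder (rescaleUltrafilter c ω : Filter ℕ) f) where
  mono _ _ h := limUnder_mono hω h
  mono' _ _ h := limUnder_mono (rescaleUltrafilter_le hc hω) h
  affine f a := by
    have h1 := PmpGroupoid.tendsto_limUnder_ultrafilter (rescaleUltrafilter c ω) f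
    have h2 : Tendsto (fun d : ℕ => f ⌊c * d⌋₊) ω
      (𝓝 (limUnder (rescaleUltrafilter c ω : Filter ℕ) f)) := h1
    exact (((affineIso c a hc).continuous.tendsto _).comp h2).limUnder_eq

theorem liminf_le_limUnder {ω : Ultrafilter ℕ} (hω : (ω : Filter ℕ) ≤ atTop) (f : ℕ → EReal) :
    liminf f atTop ≤ limUnder (ω : Filter ℕ) f := by
  rw [← (PmpGroupoid.tendsto_limUnder_ultrafilter ω f).liminf_eq]
  exact liminf_le_liminf_of_le hω

theorem limUnder_le_limsup {ω : Ultrafilter ℕ} (hω : (ω : Filter ℕ) ≤ atTop) (f : ℕ → EReal) :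
    limUnder (ω : Filter ℕ) f ≤ limsup f atTop := by
  rw [← (PmpGroupoid.tendsto_limUnder_ultrafilter ω f).limsup_eq]
  exact limsup_le_limsup_of_le hω

end Limits

end Sofic

/-! ### Growth rates of the groupoid and of its corner -/

namespace PmpGroupoid

open Sofic

variable {X : Type u} {G : Type v} [MeasurableSpace X] [MeasurableSpace G]

theorem dimOf_mono_limit (𝒢 : PmpGroupoid X G) {L L' : (ℕ → EReal) → EReal}
    (h : ∀ f, L f ≤ L' f) (K : Set (Set G)) : 𝒢.dimOf L K ≤ 𝒢.dimOf L' K :=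
  iSup₂_mono fun _ _ => iInf₂_mono fun _ _ => iInf_mono fun _ => iInf₂_mono fun _ _ =>
    iInf₂_mono fun _ _ => h _

/-- The growth of the number of restrictions to `E` of approximations of `𝒢` on `K`, where the
trace is divided by `c`. -/
noncomputable def growth (𝒢 : PmpGroupoid X G) (c : ℝ) (K : Set (Set G))
    (L : (ℕ → EReal) → EReal) (E : Finset (Set G)) : EReal :=
  ⨅ (M : Finset (Set G)) (_ : (M : Set (Set G)) ⊆ K) (δ : ℝ) (_ : 0 < δ),
    L fun d => ratio (numRestr (E : Set (Set G)) (𝒢.approx c (M : Set (Set G)) δ d)) d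

variable {𝒢 : PmpGroupoid X G}

theorem growth_le {c : ℝ} {K : Set (Set G)} {L : (ℕ → EReal) → EReal} {E M : Finset (Set G)}
    (hM : (M : Set (Set G)) ⊆ K) {δ : ℝ} (hδ : 0 < δ) :
    𝒢.growth c K L E ≤
      L fun d => ratio (numRestr (E : Set (Set G)) (𝒢.approx c (M : Set (Set G)) δ d)) d :=
  (iInf₂_le M hM).trans (iInf₂_le δ hδ)

theorem le_growth {c : ℝ} {K : Set (Set G)} {L : (ℕ → EReal) → EReal} {E : Finset (Set G)}
    {x : EReal} (h : ∀ M : Finset (Set G), (M : Set (Set G)) ⊆ K → ∀ δ : ℝ, 0 < δ →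
      x ≤ L fun d => ratio (numRestr (E : Set (Set G)) (𝒢.approx c (M : Set (Set G)) δ d)) d) :
    x ≤ 𝒢.growth c K L E :=
  le_iInf₂ fun M hM => le_iInf₂ fun δ hδ => h M hM δ hδ

theorem numRestr_le_pow {S : Type*} {d : ℕ} (E : Finset S) (R : Set (S → (Fin d ≃. Fin d))) :
    numRestr (E : Set S) R ≤ (2 ^ d * (d + 1) ^ d) ^ E.card := by
  classical
  have h := ncard_pi_le_pow (κ := (E : Set S)) (fun _ => (univ : Set (Fin d ≃. Fin d))) _
    fun _ => ncard_ball_univ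
  rw [card_coe_finset] at h
  exact (ncard_le_ncard (fun f _ => fun _ => mem_univ _) (toFinite _)).trans h

/-- The counting inequalities compare growth rates for different finite sets: E is bounded above
through its entries `blocks w E`, and a set E of corner elements bounds from below the rate of
`withTransversal w E`. Only the suprema over finite sets agree. -/
theorem iSup_growth_eq {A : Set X} {k : ℕ} {w : Fin (k + 1) → Set G} (hw : 𝒢.IsTransversal A w)
    (hA : 0 < 𝒢.μ.real A) {L L' : (ℕ → EReal) → EReal} (hL : LimitPair (𝒢.μ.real A) L L') :
    ⨆ (E : Finset (Set G)) (_ : (E : Set (Set G)) ⊆ 𝒢.fullInverseSemigroup),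
      𝒢.growth 1 𝒢.fullInverseSemigroup L E =
    affineIso (𝒢.μ.real A) (1 - 𝒢.μ.real A) hA
      (⨆ (E : Finset (Set G)) (_ : (E : Set (Set G)) ⊆ 𝒢.cornerSemigroup A),
        𝒢.growth (𝒢.μ.real A) (𝒢.cornerSemigroup A) L' E) := by
  have := 𝒢.isProbabilityMeasure
  have hc1 : 𝒢.μ.real A ≤ 1 := measureReal_le_one
  have hm := tendsto_floor_mul_div hA.le
  set c := 𝒢.μ.real A with hc
  refine le_antisymm (iSup₂_le fun E hE => ?_) ?_
  · refine le_trans ?_ ((affineIso c (1 - c) hA).monotone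
      (le_iSup₂_of_le (𝒢.blocks w E) (hw.blocks_subset hE) le_rfl))
    rw [← OrderIso.symm_apply_le]
    refine le_growth fun M' hM' δ' hδ' => ?_
    rw [OrderIso.symm_apply_le]
    refine le_of_forall_pos_le_add_coe fun ε hε => ?_
    -- κ occurs k times in the domains of the V_a and once per element of E; the extra 1 makes the
    -- total strictly below ε.
    have hκ : 0 < ε / (k + E.card + 1) := by positivity
    obtain ⟨M, hM, δ, hδ, D, H⟩ := hw.numRestr_le hA hm hE hM' hδ' hκ
    refine (growth_le hM hδ).trans ?_
    have h1 := ratio_le_of_le hA hc1 (p := fun a => 𝒢.μ.real (𝒢.src '' w a.succ))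
      (fun a => measureReal_nonneg) (by
        have h2 := hw.sum_measure_src
        rw [Fin.sum_univ_succ, hw.src_zero] at h2
        linarith) hκ (e := E.card) (ε := ε) (by
        rw [← mul_div_assoc, div_lt_iff₀ (by positivity)]
        nlinarith) (eventually_atTop.2 ⟨D, H⟩)
    refine (hL.mono _ _ h1).trans ?_
    rw [hL.affine (fun d => ratio (numRestr (𝒢.blocks w E : Set (Set G))
      (𝒢.approx c (M' : Set (Set G)) δ' d)) d), affineIso_apply, EReal.coe_add, add_assoc]
  · rw [← OrderIso.le_symm_apply]
    refine iSup₂_le fun E hE => ?_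
    have hE' : (E : Set (Set G)) ⊆ 𝒢.fullInverseSemigroup := fun s hs => (hE hs).1
    rw [OrderIso.le_symm_apply]
    refine le_iSup₂_of_le (withTransversal w E) (hw.withTransversal_subset hE') ?_
    refine le_growth fun M hM δ hδ => ?_
    refine le_of_forall_pos_le_add_coe fun ε hε => ?_
    have hκ : 0 < ε / (E.card + 2) := by positivity
    obtain ⟨M', hM', δ', hδ', D, H⟩ := hw.numRestr_mul_factorial_le hA hm hE hM hδ hκ
    refine ((affineIso c (1 - c) hA).monotone (growth_le hM' hδ')).trans ?_
    have h1 := le_ratio_of_le hA hc1 hκ (e := E.card) (ε := ε) (by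
        rw [← mul_div_assoc, div_lt_iff₀ (by positivity)]
        nlinarith) (fun d => numRestr_le_pow E _) (eventually_atTop.2 ⟨D, H⟩)
    have h2 := hL.mono _ _ h1
    rw [hL.affine (fun d => ratio (numRestr (E : Set (Set G))
      (𝒢.approx c (M' : Set (Set G)) δ' d)) d)] at h2
    have h3 := add_le_add_left h2 (ε : EReal)
    rwa [add_assoc, ← EReal.coe_add, sub_add_cancel] at h3

end PmpGroupoid

/-! ### Sofic dimension as a supremum of growth rates -/

namespace PmpGroupoid

open Sofic

variable {X : Type u} {G : Type v} [MeasurableSpace X] [MeasurableSpace G] {𝒢 : PmpGroupoid X G}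

theorem subset_wordBall_one {F : Set (Set G)} : F ⊆ 𝒢.wordBall F 1 :=
  fun s hs => ⟨𝒢.setOne, rfl, s, Or.inl (Or.inl hs), 𝒢.setOne_setMul s⟩

theorem subset_orthogonalSums {B : Set (Set G)} : B ⊆ 𝒢.orthogonalSums B := by
  intro s hs
  refine ⟨{s}, by simpa using hs, ?_, ?_, by simp⟩ <;> simp

theorem finite_wordBall {F : Set (Set G)} (hF : F.Finite) (n : ℕ) : (𝒢.wordBall F n).Finite := by
  induction n with
  | zero => exact finite_singleton _
  | succ n ih => exact ih.image2 _ ((hF.union (hF.image _)).union (finite_singleton _))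

theorem wordBall_subset {F : Set (Set G)} (hF : F ⊆ 𝒢.fullInverseSemigroup) (n : ℕ) :
    𝒢.wordBall F n ⊆ 𝒢.fullInverseSemigroup := by
  induction n with
  | zero => rintro s rfl; exact 𝒢.setOne_mem
  | succ n ih =>
    rintro _ ⟨s, hs, t, ht, rfl⟩
    refine setMul_mem (ih hs) ?_
    rcases ht with (ht | ⟨t, ht, rfl⟩) | rfl
    exacts [hF ht, setInv_mem (hF ht), 𝒢.setOne_mem]

theorem finite_orthogonalSums {B : Set (Set G)} (hB : B.Finite) :
    (𝒢.orthogonalSums B).Finite := by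
  refine (hB.finite_subsets.image fun T : Set (Set G) => ⋃₀ T).subset ?_
  rintro u ⟨T, hT, -, -, rfl⟩
  exact ⟨T, hT, rfl⟩

theorem injOn_sUnion {α β : Type*} {f : α → β} {T : Set (Set α)} (h : ∀ s ∈ T, InjOn f s)
    (hd : T.Pairwise fun s t => Disjoint (f '' s) (f '' t)) : InjOn f (⋃₀ T) := by
  rintro x ⟨s, hs, hx⟩ y ⟨t, ht, hy⟩ e
  by_cases hst : s = t
  · subst hst
    exact h s hs hx hy e
  · exact absurd e (disjoint_iff_forall_ne.1 (hd hs ht hst) (mem_image_of_mem _ hx)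
      (mem_image_of_mem _ hy))

theorem orthogonalSums_subset {B : Set (Set G)} (hB : B ⊆ 𝒢.fullInverseSemigroup) :
    𝒢.orthogonalSums B ⊆ 𝒢.fullInverseSemigroup := by
  rintro u ⟨T, hT, h1, h2, rfl⟩
  exact ⟨MeasurableSet.sUnion T.countable_toSet fun s hs => (hB (hT hs)).1,
    injOn_sUnion (fun s hs => (hB (hT hs)).2.1) h1,
    injOn_sUnion (fun s hs => (hB (hT hs)).2.2) h2⟩

theorem logRatio_eq (E : Finset (Set G)) (F : Set (Set G)) (n : ℕ) (δ : ℝ) (d : ℕ) :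
    𝒢.logRatio (E : Set (Set G)) F n δ d =
      ratio (numRestr (E : Set (Set G)) (𝒢.SA F n δ d)) d := by
  unfold logRatio ratio cardSA numRestr
  rw [← (toFinite _).cast_ncard_eq, ENat.toENNReal_coe]

theorem ratio_mono {n n' d : ℕ} (h : n ≤ n') : ratio n d ≤ ratio n' d := by
  refine EReal.div_le_div_right_of_nonneg (EReal.coe_nonneg.2 ?_)
    (ENNReal.log_monotone (by exact_mod_cast h))
  exact mul_nonneg (Nat.cast_nonneg _) (Real.log_natCast_nonneg _)

theorem numRestr_mono {S : Type*} {d : ℕ} (E : Finset S) {R R' : Set (S → (Fin d ≃. Fin d))}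
    (h : R ⊆ R') : numRestr (E : Set S) R ≤ numRestr (E : Set S) R' :=
  ncard_le_ncard (image_mono h) (toFinite _)

/-- Words and orthogonal sums only organize finite test sets. Each Σ F_±^n is a finite subset of
[[G]], and conversely a finite M is contained in F_±^1 for F = E ∪ M, so both infima run over
cofinal conditions. -/
theorem dimOf_eq_iSup_growth {L : (ℕ → EReal) → EReal} (hL : Monotone L) :
    𝒢.dimOf L 𝒢.fullInverseSemigroup =
      ⨆ (E : Finset (Set G)) (_ : (E : Set (Set G)) ⊆ 𝒢.fullInverseSemigroup),
        𝒢.growth 1 𝒢.fullInverseSemigroup L E := by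
  classical
  unfold dimOf
  refine iSup_congr fun E => iSup_congr fun hE => le_antisymm (le_growth fun M hM δ hδ => ?_) ?_
  · refine (iInf₂_le (E ∪ M) Finset.subset_union_left).trans
      ((iInf_le _ (by rw [Finset.coe_union]; exact union_subset hE hM)).trans
      ((iInf₂_le 1 le_rfl).trans ((iInf₂_le δ hδ).trans (hL fun d => ?_))))
    simp only [logRatio_eq]
    refine ratio_mono (numRestr_mono E fun σ hσ => ?_)
    have h1 : (M : Set (Set G)) ⊆ 𝒢.wordBall ((E ∪ M : Finset (Set G)) : Set (Set G)) 1 :=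
      (Finset.coe_subset.2 Finset.subset_union_right).trans subset_wordBall_one
    have h2 := h1.trans (subset_orthogonalSums (𝒢 := 𝒢))
    refine ⟨fun s hs t ht hst => hσ.1 s (h2 hs) t (h2 ht) (h2 hst), fun s hs => ?_⟩
    have := hσ.2 s (h1 hs)
    rwa [← div_one (𝒢.trace s)] at this
  · refine le_iInf₂ fun F hEF => le_iInf fun hF => le_iInf₂ fun n _ => le_iInf₂ fun δ hδ => ?_
    have h1 := finite_orthogonalSums (𝒢 := 𝒢) (finite_wordBall (𝒢 := 𝒢) F.finite_toSet n)
    refine (growth_le (M := h1.toFinset) ?_ hδ).trans (hL fun d => ?_)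
    · rw [h1.coe_toFinset]
      exact orthogonalSums_subset (wordBall_subset hF n)
    simp only [logRatio_eq]
    refine ratio_mono (numRestr_mono E fun σ hσ => ?_)
    rw [h1.coe_toFinset] at hσ
    refine ⟨hσ.1, fun s hs => ?_⟩
    have := hσ.2 s (subset_orthogonalSums (𝒢 := 𝒢) hs)
    beta_reduce at this
    rwa [div_one] at this

/-! ### The corner groupoid inside the ambient groupoid -/

section Corner

theorem numRestr_image {S S' : Type*} {φ : S → S'} (hφ : Function.Injective φ)
    {mul : S → S → S} {mul' : S' → S' → S'} (hmul : ∀ s t, φ (mul s t) = mul' (φ s) (φ t))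
    {τ : S → ℝ} {τ' : S' → ℝ} (hτ : ∀ s, τ' (φ s) = τ s) (E M : Set S) (δ : ℝ) (d : ℕ) :
    numRestr E (Sofic.approx mul τ M δ d) =
      numRestr (φ '' E) (Sofic.approx mul' τ' (φ '' M) δ d) := by
  unfold numRestr
  let Ψ : ((φ '' E : Set S') → (Fin d ≃. Fin d)) → E → (Fin d ≃. Fin d) :=
    fun ρ e => ρ ⟨φ e, mem_image_of_mem φ e.2⟩
  have hΨ : Function.Injective Ψ := by
    intro ρ ρ' h
    ext1 ⟨_, e, he, rfl⟩
    exact congrFun h ⟨e, he⟩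
  rw [← ncard_image_of_injective _ hΨ, image_image]
  congr 1
  ext ρ
  constructor
  · rintro ⟨σ, hσ, rfl⟩
    -- Values off the image of φ are never tested, so the empty partial permutation serves as a
    -- default.
    refine ⟨Function.extend φ σ fun _ => ⊥, ⟨?_, ?_⟩, ?_⟩
    · rintro _ ⟨s, hs, rfl⟩ _ ⟨t, ht, rfl⟩ hst
      rw [← hmul, hφ.mem_set_image] at hst
      rw [← hmul, hφ.extend_apply, hφ.extend_apply, hφ.extend_apply]
      exact hσ.1 s hs t ht hst
    · rintro _ ⟨s, hs, rfl⟩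
      rw [hφ.extend_apply, hτ]
      exact hσ.2 s hs
    · funext e
      exact hφ.extend_apply _ _ _
  · rintro ⟨σ, hσ, rfl⟩
    refine ⟨fun s => σ (φ s), ⟨fun s hs t ht hst => ?_, fun s hs => ?_⟩, rfl⟩
    · have := hσ.1 _ (mem_image_of_mem φ hs) _ (mem_image_of_mem φ ht)
      rw [← hmul] at this
      exact this (mem_image_of_mem φ hst)
    · have := hσ.2 _ (mem_image_of_mem φ hs)
      rwa [hτ] at this

variable {A : Set X} (hA : MeasurableSet A) (h0 : 𝒢.μ A ≠ 0)

theorem image_val_setMul (s t : Set (𝒢.CornerArrow A)) :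
    Subtype.val '' (𝒢.corner A hA h0).setMul s t =
      𝒢.setMul (Subtype.val '' s) (Subtype.val '' t) := by
  ext g
  constructor
  · rintro ⟨_, ⟨a, ha, b, hb, e, rfl⟩, rfl⟩
    exact ⟨a, ⟨a, ha, rfl⟩, b, ⟨b, hb, rfl⟩, congrArg Subtype.val e, rfl⟩
  · rintro ⟨_, ⟨a, ha, rfl⟩, _, ⟨b, hb, rfl⟩, e, rfl⟩
    exact ⟨_, ⟨a, ha, b, hb, Subtype.ext e, rfl⟩, rfl⟩

theorem trace_image_val (s : Set (𝒢.CornerArrow A)) :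
    𝒢.trace (Subtype.val '' s) / 𝒢.μ.real A = (𝒢.corner A hA h0).trace s / 1 := by
  have h : Subtype.val '' {e : A | (𝒢.corner A hA h0).one e ∈ s} =
      {e | 𝒢.one e ∈ Subtype.val '' s} := by
    ext e
    constructor
    · rintro ⟨e, he, rfl⟩
      exact ⟨_, he, rfl⟩
    · rintro ⟨g, hg, e'⟩
      have he : e ∈ A := by
        have := g.2.1
        rwa [e', 𝒢.src_one] at this
      refine ⟨⟨e, he⟩, ?_, rfl⟩
      have : (𝒢.corner A hA h0).one ⟨e, he⟩ = g := Subtype.ext e'.symm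
      change (𝒢.corner A hA h0).one ⟨e, he⟩ ∈ s
      rwa [this]
  have hμ : (𝒢.corner A hA h0).μ = (𝒢.μ A)⁻¹ • 𝒢.μ.comap Subtype.val := rfl
  rw [div_one]
  unfold trace Measure.real
  rw [hμ, Measure.smul_apply, comap_subtype_coe_apply hA, h, smul_eq_mul, ENNReal.toReal_mul,
    ENNReal.toReal_inv, div_eq_inv_mul]

theorem image_val_fullInverseSemigroup :
    image Subtype.val '' (𝒢.corner A hA h0).fullInverseSemigroup = 𝒢.cornerSemigroup A := by
  ext s
  constructor
  · rintro ⟨s, ⟨h1, h2, h3⟩, rfl⟩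
    refine ⟨⟨(𝒢.measurableSet_cornerArrow hA).subtype_image h1, ?_, ?_⟩, ?_, ?_⟩
    · rintro _ ⟨a, ha, rfl⟩ _ ⟨b, hb, rfl⟩ e
      exact congrArg Subtype.val (h2 ha hb (Subtype.ext e))
    · rintro _ ⟨a, ha, rfl⟩ _ ⟨b, hb, rfl⟩ e
      exact congrArg Subtype.val (h3 ha hb (Subtype.ext e))
    · rintro _ ⟨_, ⟨a, ha, rfl⟩, rfl⟩
      exact a.2.1
    · rintro _ ⟨_, ⟨a, ha, rfl⟩, rfl⟩
      exact a.2.2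
  · rintro ⟨⟨h1, h2, h3⟩, h4, h5⟩
    refine ⟨Subtype.val ⁻¹' s, ⟨measurable_subtype_coe h1, ?_, ?_⟩, ?_⟩
    · intro a ha b hb e
      exact Subtype.ext (h2 ha hb (congrArg Subtype.val e))
    · intro a ha b hb e
      exact Subtype.ext (h3 ha hb (congrArg Subtype.val e))
    · refine image_preimage_eq_of_subset ?_
      exact fun g hg => ⟨⟨g, h4 (mem_image_of_mem _ hg), h5 (mem_image_of_mem _ hg)⟩, rfl⟩

/-- Taking images under the inclusion of arrows identifies [[pGp]] with `cornerSemigroup`;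
normalizing the measure becomes division of the ambient trace by μ(A). -/
theorem iSup_growth_corner (L : (ℕ → EReal) → EReal) :
    ⨆ (E : Finset (Set (𝒢.CornerArrow A)))
        (_ : (E : Set (Set (𝒢.CornerArrow A))) ⊆ (𝒢.corner A hA h0).fullInverseSemigroup),
      (𝒢.corner A hA h0).growth 1 (𝒢.corner A hA h0).fullInverseSemigroup L E =
    ⨆ (E : Finset (Set G)) (_ : (E : Set (Set G)) ⊆ 𝒢.cornerSemigroup A),
      𝒢.growth (𝒢.μ.real A) (𝒢.cornerSemigroup A) L E := by
  classical
  have hφ : Function.Injective (image (Subtype.val : 𝒢.CornerArrow A → G)) :=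
    Subtype.val_injective.image_injective
  have key : ∀ (E M : Finset (Set (𝒢.CornerArrow A))) (δ : ℝ) (d : ℕ),
      numRestr (E : Set (Set (𝒢.CornerArrow A)))
        ((𝒢.corner A hA h0).approx 1 (M : Set (Set (𝒢.CornerArrow A))) δ d) =
      numRestr (E.image (image Subtype.val) : Set (Set G)) (𝒢.approx (𝒢.μ.real A)
        (M.image (image Subtype.val) : Set (Set G)) δ d) := by
    intro E M δ d
    rw [Finset.coe_image, Finset.coe_image]
    exact numRestr_image hφ (image_val_setMul hA h0) (trace_image_val hA h0) _ _ _ _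
  have hg : ∀ E : Finset (Set (𝒢.CornerArrow A)),
      (𝒢.corner A hA h0).growth 1 (𝒢.corner A hA h0).fullInverseSemigroup L E =
      𝒢.growth (𝒢.μ.real A) (𝒢.cornerSemigroup A) L (E.image (image Subtype.val)) := by
    intro E
    refine le_antisymm (le_growth fun M' hM' δ hδ => ?_) (le_growth fun M hM δ hδ => ?_)
    · rw [← image_val_fullInverseSemigroup hA h0, Finset.subset_set_image_iff] at hM'
      obtain ⟨M, hM, rfl⟩ := hM'
      simp only [← key]
      exact growth_le hM hδ
    · simp only [key]
      refine growth_le ?_ hδ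
      rw [← image_val_fullInverseSemigroup hA h0, Finset.coe_image]
      exact image_mono hM
  refine le_antisymm (iSup₂_le fun E hE => ?_) (iSup₂_le fun E' hE' => ?_)
  · rw [hg]
    refine le_iSup₂_of_le (E.image (image Subtype.val)) ?_ le_rfl
    rw [← image_val_fullInverseSemigroup hA h0, Finset.coe_image]
    exact image_mono hE
  · rw [← image_val_fullInverseSemigroup hA h0, Finset.subset_set_image_iff] at hE'
    obtain ⟨E, hE, rfl⟩ := hE'
    rw [← hg]
    exact le_iSup₂_of_le E hE le_rfl

theorem dimOf_sub_one (hG : 𝒢.IsErgodic) {L L' : (ℕ → EReal) → EReal}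
    (hL : LimitPair (𝒢.μ.real A) L L') :
    𝒢.dimOf L 𝒢.fullInverseSemigroup - 1 = ((𝒢.μ.real A : ℝ) : EReal) *
      ((𝒢.corner A hA h0).dimOf L' (𝒢.corner A hA h0).fullInverseSemigroup - 1) := by
  have := 𝒢.isProbabilityMeasure
  have hc : 0 < 𝒢.μ.real A := ENNReal.toReal_pos h0 (measure_ne_top _ _)
  obtain ⟨k, w, hw⟩ := hG.exists_isTransversal hA h0
  rw [dimOf_eq_iSup_growth fun f g h => hL.mono f g (Eventually.of_forall h),
    dimOf_eq_iSup_growth fun f g h => hL.mono' f g (Eventually.of_forall h),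
    iSup_growth_corner, iSup_growth_eq hw hc hL, affineIso_sub_one]

end Corner

end PmpGroupoid

/-! ### The scaling formulas and regularity -/

theorem mainTheorem3 {X : Type u} {G : Type v} [MeasurableSpace X] [MeasurableSpace G]
    (𝒢 : PmpGroupoid X G) (hG : 𝒢.IsErgodic)
    (A : Set X) (hA : MeasurableSet A) (h0 : 𝒢.μ A ≠ 0) :
    𝒢.soficDim - 1 = ((𝒢.μ.real A : ℝ) : EReal) * ((𝒢.corner A hA h0).soficDim - 1) ∧
    𝒢.lowerSoficDim - 1 =
      ((𝒢.μ.real A : ℝ) : EReal) * ((𝒢.corner A hA h0).lowerSoficDim - 1) ∧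
    (∀ ω : Ultrafilter ℕ, (ω : Filter ℕ) ≤ atTop →
      𝒢.ultraSoficDim ω - 1 = ((𝒢.μ.real A : ℝ) : EReal) *
        ((𝒢.corner A hA h0).ultraSoficDim (rescaleUltrafilter (𝒢.μ.real A) ω) - 1)) ∧
    (𝒢.IsSRegular ↔ (𝒢.corner A hA h0).IsSRegular) ∧
    (𝒢.IsSRegular → ∀ ω : Ultrafilter ℕ, (ω : Filter ℕ) ≤ atTop →
      𝒢.ultraSoficDim ω - 1 =
        ((𝒢.μ.real A : ℝ) : EReal) * ((𝒢.corner A hA h0).ultraSoficDim ω - 1)) := by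
  have := 𝒢.isProbabilityMeasure
  have hc : 0 < 𝒢.μ.real A := ENNReal.toReal_pos h0 (measure_ne_top _ _)
  have hc1 : 𝒢.μ.real A ≤ 1 := measureReal_le_one
  have h1 := PmpGroupoid.dimOf_sub_one hA h0 hG (Sofic.limitPair_limsup hc hc1)
  have h2 := PmpGroupoid.dimOf_sub_one hA h0 hG (Sofic.limitPair_liminf hc hc1)
  -- Cancellation in the extended reals fails in general; for finite constants and a positive finite
  -- factor it follows from `affineIso`.
  have hsub : Function.Injective fun y : EReal => y - 1 := by
    have h := (Sofic.affineIso 1 (-1) one_pos).injective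
    intro x y hxy
    refine h ?_
    simp only [Sofic.affineIso_apply, EReal.coe_one, one_mul, EReal.coe_neg]
    exact hxy
  have hmul : Function.Injective fun y : EReal => ((𝒢.μ.real A : ℝ) : EReal) * y := by
    intro x y hxy
    refine (Sofic.affineIso (𝒢.μ.real A) 0 hc).injective ?_
    simp only [Sofic.affineIso_apply, EReal.coe_zero, add_zero]
    exact hxy
  have h4 : 𝒢.IsSRegular ↔ (𝒢.corner A hA h0).IsSRegular := by
    unfold PmpGroupoid.IsSRegular
    rw [← hsub.eq_iff, ← (hmul.comp hsub).eq_iff (a := (𝒢.corner A hA h0).lowerSoficDim)]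
    change 𝒢.lowerSoficDim - 1 = 𝒢.soficDim - 1 ↔ _ * (_ - 1) = _ * (_ - 1)
    unfold PmpGroupoid.lowerSoficDim PmpGroupoid.soficDim
    rw [h1, h2]
  -- Ultrafilter limits lie between lower and upper limits, so regularity makes every ω sofic
  -- dimension equal to the sofic dimension. It is used for both groupoids, which removes the
  -- rescaling of ω.
  have h5 : ∀ {X : Type u} {G : Type v} [MeasurableSpace X] [MeasurableSpace G]
      (𝒢 : PmpGroupoid X G), 𝒢.IsSRegular → ∀ ω : Ultrafilter ℕ, (ω : Filter ℕ) ≤ atTop →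
      𝒢.ultraSoficDim ω = 𝒢.soficDim := by
    intro X G _ _ 𝒢 hr ω hω
    refine le_antisymm (𝒢.dimOf_mono_limit (Sofic.limUnder_le_limsup hω) _) ?_
    rw [← hr]
    exact 𝒢.dimOf_mono_limit (Sofic.liminf_le_limUnder hω) _
  refine ⟨h1, h2, fun ω hω => PmpGroupoid.dimOf_sub_one hA h0 hG
    (Sofic.limitPair_limUnder hc hω), h4, fun hr ω hω => ?_⟩
  rw [h5 𝒢 hr ω hω, h5 _ (h4.1 hr) ω hω]
  exact h1
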